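/- **Conventions.** Manifolds are smooth, with possibly empty boundary. $\mathbb H^m=[0,\infty)\times\mathbb R^{m-1}$ ($\mathbb H^0=\mathbb R^0$), $Q=(-1,1)$, and $g_m$ is the Euclidean metric of $\mathbb R^m$. Let $M$ be an $m$-dimensional submanifold of $\mathbb R^n$ with the induced metric $g$, and let $S\subset M$. For a local chart $\kappa$ of $M$ with domain $U_\kappa$ let $i_\kappa=\kappa^{-1}:\kappa(U_\kappa)\to\mathbb R^n$ be its parametrization and $\kappa_*g=i_\kappa^*g_n$, $\kappa_*\rho=\rho\circ\kappa^{-1}$. A chart is normalized if $\kappa(U_\kappa)=Q^m$ (when $U_\kappa$ lies in the interior of $M$) or $\kappa(U_\kappa)=Q^m\cap\mathbb H^m$ (when $U_\kappa$ meets $\partial M$). For an atlas $\mathfrak K$ put $\mathfrak K_S=\{\kappa\in\mathfrak K: U_\kappa\cap S\neq\emptyset\}$. $\mathfrak K_S$ is shrinkable if it consists of normalized charts and, for some $r\in(0,1)$, the sets $\kappa^{-1}(r\,\kappa(U_\kappa))$, $\kappa\in\mathfrak K_S$, cover $S$; it has finite multiplicity if for some $k$ any intersection of more than $k$ patches $U_\kappa$,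 $\kappa\in\mathfrak K_S$, is empty. Below, $c\ge 1$ and $c(k)$ are constants independent of the charts in $\mathfrak K_S$; $\|\cdot\|_{k,\infty}$ is the $BC^k$-norm; $f\sim h$ means $h/c\le f\le ch$. A function $\rho\in C^\infty(M,(0,\infty))$ is a *parametrization-regular (p-r) singularity function for $(M,g)$ on $S$* if there is an atlas $\mathfrak K$ of $M$ such that $\mathfrak K_S$ is shrinkable and has finite multiplicity and, with $\rho_\kappa=\rho(\kappa^{-1}(0))$, for all $\kappa\in\mathfrak K_S$, $$\|\kappa_*\rho\|_{k,\infty}\le c(k)\rho_\kappa\ (k\ge0),\quad \rho|_{U_\kappa}\sim\rho_\kappa,\quad \kappa_*g\ge\rho_\kappa^2g_m/c,\quad \|\partial^k i_\kappa\|_\infty\le c(k)\rho_\kappa\ (k\ge1).$$ It is a *singularity function for $(M,g)$ on $S$* if there is an atlas $\mathfrak K$ of $M$ such that $\mathfrak K_S$ is shrinkable and has finite multiplicity, $\|\tilde\kappa\circ\kappa^{-1}\|_{k,\infty}\le c(k)$ on $\kappa(U_\kappa\cap U_{\tilde\kappa})$ for all $\kappa,\tilde\kappa\in\mathfrak K_S$,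 $k\ge0$, and $\kappa_*(g/\rho^2)\sim g_m$, $\|\kappa_*(g/\rho^2)\|_{k,\infty}\le c(k)$ for all $\kappa\in\mathfrak K_S$, $k\ge0$. Let $J_0=(0,1]$, $J_\infty=[1,\infty)$ and $J=J_\omega$ with $\omega\in\{0,\infty\}$; $\mathring J$ is the interior of $J$. A subinterval $I$ of $J$ is *cofinal* if $1\notin I$ and $J\setminus\mathring I$ is a compact interval. Let $\mathcal R(J)$ be the set of $R\in C^\infty(J,(0,\infty))$ with $R(1)=1$ such that $R(\omega):=\lim_{t\to\omega}R(t)$ exists in $[0,\infty]$. $R\in\mathcal R(J)$ is a *cusp characteristic on $J$* if $R(\infty)=0$ in case $J=J_\infty$, $\int_J dt/R(t)=\infty$, and $\|\partial^kR\|_\infty<\infty$ for all $k\ge1$. $R\in\mathcal R(J_\infty)$ is a *funnel characteristic* (on $J=J_\infty$) if $R(\infty)>0$ and $\|\partial^kR\|_\infty<\infty$ for all $k\ge1$. Put $r=R$ if $R$ is a cusp characteristic and $r=1$ if $R$ is a funnel characteristic. For a $d$-dimensional submanifold $B$ of $\mathbb R^{\bar d}$ the $R$-pipe over $B$ on $J$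 is $P=P(R,B)=\{(t,R(t)y): t\in\mathring J,\ y\in B\}\subset\mathbb R^{1+\bar d}$, a $(1+d)$-dimensional submanifold, with the diffeomorphism $\varphi:P\to\mathring J\times B$, $(t,R(t)y)\mapsto(t,y)$. Let $g_B$, $g_P$ be the metrics induced by $\mathbb R^{\bar d}$, $\mathbb R^{1+\bar d}$. **Proposition 7.3.** Let $B$ be a $d$-dimensional submanifold of $\mathbb R^{\bar d}$ which is bounded in $\mathbb R^{\bar d}$, let $S\subset B$, and let $b$ be a p-r singularity function for $(B,g_B)$ on $S$; if $d=0$, assume in addition that $b$ is bounded on $S$. Let $R$ be a cusp characteristic on $J\in\{J_0,J_\infty\}$ or a funnel characteristic on $J=J_\infty$. Then $p:=\varphi^*(r\otimes b)$, i.e. $p(t,R(t)y)=r(t)b(y)$, is a cofinal p-r singularity function for $(P,g_P)$ on $S$: there is a cofinal subinterval $I$ of $J$ such that $p$ is a p-r singularity function for $(P,g_P)$ on $\varphi^{-1}(I\times S)$. For this $I$, $p$ is also a singularity function for $(P,g_P)$ on $\varphi^{-1}(I\times S)$. -/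

import Mathlib

open Set Filter Topology MeasureTheory
open scoped ContDiff ENNReal Pointwise

/-! ### Submanifolds of Euclidean spaces, their charts and atlases -/

/-- The Euclidean space `ℝᵐ`. -/
abbrev Euc (m : ℕ) : Type := EuclideanSpace ℝ (Fin m)

/-- The closed half-space `ℍᵐ = [0, ∞) × ℝᵐ⁻¹` (with `ℍ⁰ = ℝ⁰`). -/
def halfSpace (m : ℕ) : Set (Euc m) := {x | ∀ i : Fin m, i.val = 0 → 0 ≤ x i}

/-- The open cube `Qᵐ = (-1, 1)ᵐ`. -/
def cube (m : ℕ) : Set (Euc m) := {x | ∀ i : Fin m, x i ∈ Ioo (-1 : ℝ) 1}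

/-- A local chart `κ` of a subset `M` of `ℝⁿ`, regarded as an `m`-dimensional smooth submanifold
with (possibly empty) boundary. It is described by the local parametrization `i_κ = ι_M ∘ κ⁻¹`,
a smooth immersion of an open subset of `ℝᵐ` or of `ℍᵐ` which is a homeomorphism onto a relatively
open subset of `M`. (Any two such charts are automatically smoothly compatible.) Only the values
of `param` on `dom` are relevant. -/
structure Chart (m : ℕ) {n : ℕ} (M : Set (Euc n)) where
  /-- The range `κ(U_κ)` of the chart. -/
  dom : Set (Euc m)
  /-- The local parametrization `i_κ`. -/
  param : Euc m → Euc n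
  dom_open : ∃ O : Set (Euc m), IsOpen O ∧ (dom = O ∨ dom = O ∩ halfSpace m)
  mapsTo : MapsTo param dom M
  isOpenEmbedding : IsOpenEmbedding (mapsTo.restrict param dom M)
  smooth : ContDiffOn ℝ ∞ param dom
  immersion : ∀ x ∈ dom, Function.Injective (fderivWithin ℝ param dom x)

namespace Chart

variable {m n : ℕ} {M : Set (Euc n)}

/-- The coordinate patch `U_κ ⊆ M`. -/
def patch (κ : Chart m M) : Set (Euc n) := κ.param '' κ.dom

/-- The chart map `κ : U_κ → κ(U_κ)`, the inverse of the parametrization. -/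
noncomputable def coord (κ : Chart m M) : Euc n → Euc m := Function.invFunOn κ.param κ.dom

/-- A chart is normalized if its range is `Qᵐ` or `Qᵐ ∩ ℍᵐ`. In the first case the patch lies in
the interior of `M`; in the second case (and `m ≥ 1`) it meets the boundary of `M`. -/
def IsNormalized (κ : Chart m M) : Prop := κ.dom = cube m ∨ κ.dom = cube m ∩ halfSpace m

/-- The coordinate representation `κ_* g` of the metric `g` which `M` inherits from the Euclidean
metric of `ℝⁿ`, that is, the pull-back of the Euclidean metric by `i_κ`. -/
noncomputable def metric (κ : Chart m M) (x ξ η : Euc m) : ℝ :=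
  inner ℝ (fderivWithin ℝ κ.param κ.dom x ξ) (fderivWithin ℝ κ.param κ.dom x η)

/-- The subset `κ(U_κ ∩ U_κ')` of `ℝᵐ`. -/
def overlap (κ κ' : Chart m M) : Set (Euc m) := {x ∈ κ.dom | κ.param x ∈ κ'.patch}

/-- The value `ρ_κ = ρ(κ⁻¹(0))` of a function `ρ` at the center of `κ`. -/
def center (κ : Chart m M) (ρ : Euc n → ℝ) : ℝ := ρ (κ.param 0)

end Chart

/-- `M` is an `m`-dimensional smooth submanifold, with possibly empty boundary, of `ℝⁿ`. -/
def IsSubmanifold (m : ℕ) {n : ℕ} (M : Set (Euc n)) : Prop :=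
  ∀ p ∈ M, ∃ κ : Chart m M, p ∈ κ.patch

/-- A set of charts is an atlas for `M` if the coordinate patches cover `M`. -/
def IsAtlas {m n : ℕ} {M : Set (Euc n)} (K : Set (Chart m M)) : Prop :=
  ∀ p ∈ M, ∃ κ ∈ K, p ∈ κ.patch

/-- `K_S`, the set of those charts of `K` whose patch meets `S`. -/
def chartsOn {m n : ℕ} {M : Set (Euc n)} (K : Set (Chart m M)) (S : Set (Euc n)) :
    Set (Chart m M) :=
  {κ ∈ K | (κ.patch ∩ S).Nonempty}

/-- `K_S` has finite multiplicity: for some `k`, any intersection of more than `k` coordinate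
patches of charts in `K_S` is empty. -/
def HasFiniteMultiplicityOn {m n : ℕ} {M : Set (Euc n)} (K : Set (Chart m M))
    (S : Set (Euc n)) : Prop :=
  ∃ k : ℕ, ∀ F : Finset (Chart m M), ↑F ⊆ chartsOn K S → k < F.card →
    (⋂ κ ∈ F, κ.patch) = ∅

/-- `K_S` is shrinkable: it consists of normalized charts, and for some `r ∈ (0, 1)` the sets
`κ⁻¹(r Q_κ)`, `κ ∈ K_S`, cover `S`. -/
def IsShrinkableOn {m n : ℕ} {M : Set (Euc n)} (K : Set (Chart m M)) (S : Set (Euc n)) : Prop :=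
  (∀ κ ∈ chartsOn K S, κ.IsNormalized) ∧
    ∃ r ∈ Ioo (0 : ℝ) 1, S ⊆ ⋃ κ ∈ chartsOn K S, κ.param '' (r • κ.dom)

/-- `ρ ∈ C^∞(M, (0, ∞))`. Only the values of `ρ` on `M` are relevant. -/
def IsSmoothPositive (m : ℕ) {n : ℕ} (M : Set (Euc n)) (ρ : Euc n → ℝ) : Prop :=
  (∀ p ∈ M, 0 < ρ p) ∧ ∀ κ : Chart m M, ContDiffOn ℝ ∞ (fun x => ρ (κ.param x)) κ.dom

/-! ### Uniform regularity and singularity functions -/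

/-- The atlas `K` for `M` is uniformly regular on `S`. -/
structure IsUniformlyRegularAtlasOn {m n : ℕ} {M : Set (Euc n)} (K : Set (Chart m M))
    (S : Set (Euc n)) : Prop where
  atlas : IsAtlas K
  shrinkable : IsShrinkableOn K S
  multiplicity : HasFiniteMultiplicityOn K S
  /-- `‖κ' ∘ κ⁻¹‖_{k,∞} ≤ c(k)`. -/
  transition : ∀ k : ℕ, ∃ c : ℝ, ∀ κ ∈ chartsOn K S, ∀ κ' ∈ chartsOn K S,
    ∀ x ∈ κ.overlap κ', ∀ j ≤ k,
      ‖iteratedFDerivWithin ℝ j (fun y => κ'.coord (κ.param y)) (κ.overlap κ') x‖ ≤ c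

/-- `ρ` is a singularity function on `S` for the Riemannian submanifold `(M, g)` of `ℝⁿ`: there is
an atlas `K`, uniformly regular on `S`, such that `(M, K, g/ρ²)` is uniformly regular on `S`. -/
def IsSingularityFunctionOn (m : ℕ) {n : ℕ} (M S : Set (Euc n)) (ρ : Euc n → ℝ) : Prop :=
  IsSmoothPositive m M ρ ∧
  ∃ K : Set (Chart m M), IsUniformlyRegularAtlasOn K S ∧
    -- `κ_*(g/ρ²) ∼ g_m`
    (∃ c : ℝ, 1 ≤ c ∧ ∀ κ ∈ chartsOn K S, ∀ x ∈ κ.dom, ∀ ξ : Euc m,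
      ‖ξ‖ ^ 2 / c ≤ κ.metric x ξ ξ / ρ (κ.param x) ^ 2 ∧
        κ.metric x ξ ξ / ρ (κ.param x) ^ 2 ≤ c * ‖ξ‖ ^ 2) ∧
    -- `‖κ_*(g/ρ²)‖_{k,∞} ≤ c(k)`, in terms of the coefficients of the metric
    (∀ k : ℕ, ∃ c : ℝ, ∀ κ ∈ chartsOn K S, ∀ x ∈ κ.dom, ∀ j ≤ k, ∀ a a' : Fin m,
      ‖iteratedFDerivWithin ℝ j
        (fun y => κ.metric y (EuclideanSpace.single a 1) (EuclideanSpace.single a' 1)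
          / ρ (κ.param y) ^ 2) κ.dom x‖ ≤ c)

/-- `(ρ, K)` is a parametrization-regular singularity datum on `S` for the Riemannian submanifold
`(M, g)` of `ℝⁿ`. -/
structure IsPRSingularityDatumOn {m n : ℕ} {M : Set (Euc n)} (S : Set (Euc n))
    (ρ : Euc n → ℝ) (K : Set (Chart m M)) : Prop where
  atlas : IsAtlas K
  shrinkable : IsShrinkableOn K S
  multiplicity : HasFiniteMultiplicityOn K S
  smooth : IsSmoothPositive m M ρ
  /-- `‖κ_* ρ‖_{k,∞} ≤ c(k) ρ_κ`. -/
  bound : ∀ k : ℕ, ∃ c : ℝ, ∀ κ ∈ chartsOn K S, ∀ x ∈ κ.dom, ∀ j ≤ k,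
    ‖iteratedFDerivWithin ℝ j (fun y => ρ (κ.param y)) κ.dom x‖ ≤ c * κ.center ρ
  /-- `ρ | U_κ ∼ ρ_κ`. -/
  equiv : ∃ c : ℝ, 1 ≤ c ∧ ∀ κ ∈ chartsOn K S, ∀ x ∈ κ.dom,
    κ.center ρ / c ≤ ρ (κ.param x) ∧ ρ (κ.param x) ≤ c * κ.center ρ
  /-- `κ_* g ≥ ρ_κ² g_m / c`. -/
  metric_lower : ∃ c : ℝ, 1 ≤ c ∧ ∀ κ ∈ chartsOn K S, ∀ x ∈ κ.dom, ∀ ξ : Euc m,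
    κ.center ρ ^ 2 * ‖ξ‖ ^ 2 / c ≤ κ.metric x ξ ξ
  /-- `‖∂ᵏ i_κ‖_∞ ≤ c(k) ρ_κ` for `k ≥ 1`. -/
  param_bound : ∀ k : ℕ, 1 ≤ k → ∃ c : ℝ, ∀ κ ∈ chartsOn K S, ∀ x ∈ κ.dom,
    ‖iteratedFDerivWithin ℝ k κ.param κ.dom x‖ ≤ c * κ.center ρ

/-- `ρ` is a parametrization-regular singularity function on `S` for the `m`-dimensional Riemannian
submanifold `(M, g)` of `ℝⁿ`. -/
def IsPRSingularityFunctionOn (m : ℕ) {n : ℕ} (M S : Set (Euc n)) (ρ : Euc n → ℝ) : Prop :=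
  ∃ K : Set (Chart m M), IsPRSingularityDatumOn S ρ K

/-! ### Cusp and funnel characteristics -/

/-- The two possible ends `e ∈ {0, ∞}`. -/
inductive EndPoint : Type
  | zero
  | infty

namespace EndPoint

/-- `J_0 = (0, 1]` and `J_∞ = [1, ∞)`. -/
def J : EndPoint → Set ℝ
  | zero => Ioc 0 1
  | infty => Ici 1

/-- The filter `t → e` in `J_e`. -/
def filter : EndPoint → Filter ℝ
  | zero => 𝓝[>] 0
  | infty => atTop

end EndPoint

/-- `I` is a cofinal subinterval of `J_e`. -/
def IsCofinalInterval (e : EndPoint) (I : Set ℝ) : Prop :=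
  I.OrdConnected ∧ I ⊆ e.J ∧ (1 : ℝ) ∉ I ∧
    (e.J \ interior I).OrdConnected ∧ IsCompact (e.J \ interior I)

/-- The class `𝓡(J_e)`: smooth positive functions on `J_e` (up to the end point `1`) with `R(1) = 1`
having a limit in `[0, ∞]` at the end `e`. -/
structure IsCharacteristic (e : EndPoint) (R : ℝ → ℝ) : Prop where
  smooth : ContDiffOn ℝ ∞ R e.J
  pos : ∀ t ∈ e.J, 0 < R t
  one : R 1 = 1
  limit : ∃ L : ℝ≥0∞, Tendsto (fun t => ENNReal.ofReal (R t)) e.filter (𝓝 L)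

/-- Cusp characteristics, the class `𝓒(J_e)`. -/
structure IsCuspCharacteristic (e : EndPoint) (R : ℝ → ℝ) : Prop where
  characteristic : IsCharacteristic e R
  limit_zero : e = EndPoint.infty → Tendsto R e.filter (𝓝 0)
  integral : ∫⁻ t in e.J, ENNReal.ofReal (1 / R t) = ⊤
  deriv_bound : ∀ k : ℕ, 1 ≤ k → ∃ c : ℝ, ∀ t ∈ e.J, |iteratedDerivWithin k R e.J t| ≤ c

/-- Funnel characteristics, the class `𝓕(J_∞)`. -/
structure IsFunnelCharacteristic (R : ℝ → ℝ) : Prop where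
  characteristic : IsCharacteristic EndPoint.infty R
  limit_pos : ∃ L : ℝ≥0∞, 0 < L ∧ Tendsto (fun t => ENNReal.ofReal (R t)) atTop (𝓝 L)
  deriv_bound : ∀ k : ℕ, 1 ≤ k → ∃ c : ℝ, ∀ t ∈ EndPoint.infty.J,
    |iteratedDerivWithin k R EndPoint.infty.J t| ≤ c

open Classical in
/-- `r = r[R]`: it equals `R` if `R` is a cusp characteristic, and `1` if it is a funnel
characteristic. -/
noncomputable def weight (e : EndPoint) (R : ℝ → ℝ) : ℝ → ℝ :=
  if IsCuspCharacteristic e R then R else fun _ => 1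

/-! ### Pipes -/

/-- The point `(t, y)` of `ℝ × ℝⁿ = ℝ¹⁺ⁿ`. -/
def consPoint {n : ℕ} (t : ℝ) (y : Euc n) : Euc (n + 1) :=
  WithLp.toLp 2 (Fin.cons t (fun i => y i))

/-- The component in `ℝⁿ` of a point of `ℝ × ℝⁿ = ℝ¹⁺ⁿ`. -/
def tailPoint {n : ℕ} (x : Euc (n + 1)) : Euc n := WithLp.toLp 2 (fun i => x i.succ)

/-- The model `R`-pipe `P(R, B) = {(t, R(t) y) ; t ∈ int J, y ∈ B}` over `B` on `J = J_e`. -/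
def pipe (e : EndPoint) (R : ℝ → ℝ) {n : ℕ} (B : Set (Euc n)) : Set (Euc (n + 1)) :=
  {x | ∃ t ∈ interior e.J, ∃ y ∈ B, x = consPoint t (R t • y)}

/-- The canonical stretching diffeomorphism `φ : (t, R(t) y) ↦ (t, y)` of `P(R, B)` onto
`int J × B`. Only its values on the pipe are relevant. -/
noncomputable def stretch (R : ℝ → ℝ) {n : ℕ} (x : Euc (n + 1)) : ℝ × Euc n :=
  (x 0, (R (x 0))⁻¹ • tailPoint x)

theorem stretch_consPoint {R : ℝ → ℝ} {n : ℕ} {t : ℝ} (ht : 0 < R t) (y : Euc n) :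
    stretch R (consPoint t (R t • y)) = (t, y) := by
  ext i
  · simp [stretch, consPoint]
  · simp [stretch, consPoint, tailPoint, ht.ne']

/-- The function `φ^*(r ⊗ b)`, that is, `(t, R(t) y) ↦ r(t) b(y)`, on the pipe. -/
noncomputable def pipeFunction (R r : ℝ → ℝ) {n : ℕ} (b : Euc n → ℝ) (x : Euc (n + 1)) : ℝ :=
  r (stretch R x).1 * b (stretch R x).2

/-- The subset `φ⁻¹(I × S)` of the pipe. -/
def pipePart (e : EndPoint) (R : ℝ → ℝ) {n : ℕ} (B : Set (Euc n)) (I : Set ℝ) (S : Set (Euc n)) :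
    Set (Euc (n + 1)) :=
  {x ∈ pipe e R B | stretch R x ∈ I ×ˢ S}

/-! The charts of the pipe have parametrizations (z, u) ↦ (t, R(t) i_κ(x₀ + l z)) with t = t₀ + a u,
where κ is a chart of the base. There p has the size w = r(t₀) b_κ, with b_κ the value of b at the
center of κ, so the derivative must be exactly of order w in every direction. In the direction u it
is a (1, R'(t) i_κ); as R' and B are bounded, a = δ w is the right choice. In the directions z it is
of order R(t₀) l b_κ, so l must be comparable to r(t₀)/R(t₀). For a cusp this is a constant; for a
funnel with R unbounded, the charts of the base have to be cut into ever finer cubes, and half-cubes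
at the boundary.

Three facts make this possible. The b_κ are bounded, because a chart with d > 0 has an image of size
at least a multiple of b_κ in the bounded set B (`exists_center_bound`). A cusp characteristic at 0
satisfies R(t) ≤ L t, since otherwise 1/R would be integrable (`exists_le_mul_of_zero`); hence the
short intervals stay inside J, and R and r vary on them by at most a factor 2. Finally a, as a
function of t₀, has a small Lipschitz constant, so the intervals can be chosen with multiplicity at
most 16 (`exists_interval_cover`), while at most 4 ^ d cubes of a grid share a point.

After division by w, the derivative of the parametrization is a combination of uniformly bounded
families (`fderivWithin_chart`) and is bounded below because of its triangular form
(`PipeSetup.exists_scaledDeriv_lower`). This gives the p-r property.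

The second assertion holds for every p-r singularity function. The metric g/ρ² is an algebraic
expression in the scaled data, and a transition map ψ solves i_κ' ∘ ψ = i_κ. Hence Dψ is a left
inverse of Di_κ'(ψ) composed with Di_κ, and bounds follow by induction on the order
(`unifBdd_transition`). -/

/-! ### Uniformly bounded families of smooth maps -/

section UnifBdd

variable {ι E F G H : Type*} [NormedAddCommGroup E] [NormedSpace ℝ E] [NormedAddCommGroup F]
  [NormedSpace ℝ F] [NormedAddCommGroup G] [NormedSpace ℝ G] [NormedAddCommGroup H]
  [NormedSpace ℝ H]

/-- The smooth maps `f i` on the sets `s i` have derivatives up to order `k` which are bounded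
uniformly with respect to `i`. -/
def UnifBdd (k : ℕ) (s : ι → Set E) (f : ι → E → F) : Prop :=
  (∀ i, ContDiffOn ℝ ∞ (f i) (s i)) ∧
    ∃ C : ℝ, ∀ i, ∀ x ∈ s i, ∀ j ≤ k, ‖iteratedFDerivWithin ℝ j (f i) (s i) x‖ ≤ C

namespace UnifBdd

variable {k : ℕ} {s : ι → Set E} {f : ι → E → F}

theorem mono_order {l : ℕ} (h : UnifBdd k s f) (hl : l ≤ k) : UnifBdd l s f := by
  obtain ⟨h1, C, hC⟩ := h
  exact ⟨h1, C, fun i x hx j hj => hC i x hx j (hj.trans hl)⟩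

theorem congr {g : ι → E → F} (h : UnifBdd k s f) (hg : ∀ i, EqOn (g i) (f i) (s i)) :
    UnifBdd k s g := by
  obtain ⟨h1, C, hC⟩ := h
  refine ⟨fun i => (h1 i).congr (hg i), C, fun i x hx j hj => ?_⟩
  rw [iteratedFDerivWithin_congr (hg i) hx]
  exact hC i x hx j hj

theorem exists_bound (h : UnifBdd k s f) : ∃ C : ℝ, 0 < C ∧ ∀ i, ∀ x ∈ s i, ‖f i x‖ ≤ C := by
  obtain ⟨h1, C, hC⟩ := h
  refine ⟨max C 1, by positivity, fun i x hx => le_max_of_le_left ?_⟩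
  simpa using hC i x hx 0 (Nat.zero_le k)

theorem of_norm_le (hf : ∀ i, ContDiffOn ℝ ∞ (f i) (s i))
    (hC : ∃ C : ℝ, ∀ i, ∀ x ∈ s i, ‖f i x‖ ≤ C) : UnifBdd 0 s f := by
  obtain ⟨C, hC⟩ := hC
  refine ⟨hf, C, fun i x hx j hj => ?_⟩
  obtain rfl : j = 0 := by omega
  simpa using hC i x hx

theorem fderivWithin (hs : ∀ i, UniqueDiffOn ℝ (s i)) (h : UnifBdd (k + 1) s f) :
    UnifBdd k s (fun i => fderivWithin ℝ (f i) (s i)) := by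
  obtain ⟨h1, C, hC⟩ := h
  refine ⟨fun i => (h1 i).fderivWithin (hs i) (by simp), C, fun i x hx j hj => ?_⟩
  rw [norm_iteratedFDerivWithin_fderivWithin (hs i) hx]
  exact hC i x hx _ (by omega)

theorem of_fderivWithin (hs : ∀ i, UniqueDiffOn ℝ (s i)) (hf : ∀ i, ContDiffOn ℝ ∞ (f i) (s i))
    (hC : ∃ C : ℝ, ∀ i, ∀ x ∈ s i, ‖f i x‖ ≤ C)
    (h : UnifBdd k s (fun i => _root_.fderivWithin ℝ (f i) (s i))) : UnifBdd (k + 1) s f := by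
  obtain ⟨C, hC⟩ := hC
  obtain ⟨h1, C', hC'⟩ := h
  refine ⟨hf, max C C', fun i x hx j hj => ?_⟩
  cases j with
  | zero => exact le_max_of_le_left (by simpa using hC i x hx)
  | succ j =>
    rw [← norm_iteratedFDerivWithin_fderivWithin (hs i) hx]
    exact le_max_of_le_right (hC' i x hx j (by omega))

/-- The induction step for families whose derivative is given by a formula in already controlled
quantities. -/
theorem of_fderivWithin_eq {f' : ι → E → E →L[ℝ] F} (hs : ∀ i, UniqueDiffOn ℝ (s i))
    (hf : ∀ i, ContDiffOn ℝ ∞ (f i) (s i))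
    (hC : ∃ C : ℝ, ∀ i, ∀ x ∈ s i, ‖f i x‖ ≤ C)
    (hf' : ∀ i, ∀ x ∈ s i, HasFDerivWithinAt (f i) (f' i x) (s i) x)
    (h : UnifBdd k s f') : UnifBdd (k + 1) s f :=
  of_fderivWithin hs hf hC (h.congr fun i x hx => (hf' i x hx).fderivWithin (hs i x hx))

/-- Indices with an empty set are exempt: ratios of center values are controlled only for charts
that overlap. -/
theorem const {c : ι → F} (hc : ∃ C : ℝ, ∀ i, (s i).Nonempty → ‖c i‖ ≤ C) :
    UnifBdd k s (fun i _ => c i) := by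
  obtain ⟨C, hC⟩ := hc
  refine ⟨fun i => contDiffOn_const, max C 0, fun i x hx j _ => ?_⟩
  cases j with
  | zero => exact le_max_of_le_left (by simpa using hC i ⟨x, hx⟩)
  | succ j => simp [iteratedFDerivWithin_succ_const]

theorem bilin (B : F →L[ℝ] G →L[ℝ] H) {g : ι → E → G} (hs : ∀ i, UniqueDiffOn ℝ (s i))
    (hf : UnifBdd k s f) (hg : UnifBdd k s g) : UnifBdd k s (fun i x => B (f i x) (g i x)) := by
  obtain ⟨h1, C, hC⟩ := hf
  obtain ⟨h2, D, hD⟩ := hg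
  refine ⟨fun i => B.isBoundedBilinearMap.contDiff.comp_contDiffOn ((h1 i).prodMk (h2 i)),
    -- The Leibniz bounds for all orders up to `k` are added, so that one constant serves each of
    -- them.
    ‖B‖ * ∑ j ∈ Finset.range (k + 1), ∑ l ∈ Finset.range (j + 1), ((j.choose l : ℕ) : ℝ) * |C| * |D|,
    fun i x hx j hj => ?_⟩
  refine (B.norm_iteratedFDerivWithin_le_of_bilinear (h1 i) (h2 i) (hs i) hx
    (by exact_mod_cast le_top)).trans ?_
  refine mul_le_mul_of_nonneg_left ?_ (by positivity)
  refine le_trans (Finset.sum_le_sum fun l hl => ?_) (Finset.single_le_sum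
    (f := fun j => ∑ l ∈ Finset.range (j + 1), ((j.choose l : ℕ) : ℝ) * |C| * |D|)
    (fun j _ => by positivity) (Finset.mem_range.2 (by omega : j < k + 1)))
  have hl' := Finset.mem_range.1 hl
  gcongr
  · exact (hC i x hx l (by omega)).trans (le_abs_self C)
  · exact (hD i x hx _ (by omega)).trans (le_abs_self D)

theorem clm (L : F →L[ℝ] G) (hs : ∀ i, UniqueDiffOn ℝ (s i)) (hf : UnifBdd k s f) :
    UnifBdd k s (fun i x => L (f i x)) := by
  have h1 : UnifBdd k s (fun _ _ => (1 : ℝ)) := const ⟨1, fun _ _ => by simp⟩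
  -- A linear map of `f` is a bilinear map of `f` and the constant function 1.
  simpa using bilin (((ContinuousLinearMap.lsmul ℝ ℝ : ℝ →L[ℝ] G →L[ℝ] G).flip).comp L) hs hf h1

theorem smul {c : ι → E → ℝ} (hs : ∀ i, UniqueDiffOn ℝ (s i)) (hc : UnifBdd k s c)
    (hf : UnifBdd k s f) : UnifBdd k s (fun i x => c i x • f i x) :=
  bilin (ContinuousLinearMap.lsmul ℝ ℝ) hs hc hf

theorem mul {c g : ι → E → ℝ} (hs : ∀ i, UniqueDiffOn ℝ (s i)) (hc : UnifBdd k s c)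
    (hg : UnifBdd k s g) : UnifBdd k s (fun i x => c i x * g i x) :=
  smul hs hc hg

theorem const_smul {c : ι → ℝ} (hs : ∀ i, UniqueDiffOn ℝ (s i))
    (hc : ∃ C : ℝ, ∀ i, (s i).Nonempty → |c i| ≤ C)
    (hf : UnifBdd k s f) : UnifBdd k s (fun i x => c i • f i x) :=
  smul hs (const hc) hf

theorem add {g : ι → E → F} (hs : ∀ i, UniqueDiffOn ℝ (s i)) (hf : UnifBdd k s f)
    (hg : UnifBdd k s g) : UnifBdd k s (fun i x => f i x + g i x) := by
  obtain ⟨h1, C, hC⟩ := hf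
  obtain ⟨h2, D, hD⟩ := hg
  refine ⟨fun i => (h1 i).add (h2 i), C + D, fun i x hx j hj => ?_⟩
  rw [fun_iteratedFDerivWithin_add_apply (((h1 i) x hx).of_le (by exact_mod_cast le_top))
    (((h2 i) x hx).of_le (by exact_mod_cast le_top)) (hs i) hx]
  exact (norm_add_le _ _).trans (add_le_add (hC i x hx j hj) (hD i x hx j hj))

theorem mono_set {t : ι → Set E} (ht : ∀ i, UniqueDiffOn ℝ (t i)) (hs : ∀ i, UniqueDiffOn ℝ (s i))
    (hf : UnifBdd k s f) (hts : ∀ i, t i ⊆ s i) : UnifBdd k t f := by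
  obtain ⟨h1, C, hC⟩ := hf
  refine ⟨fun i => (h1 i).mono (hts i), C, fun i x hx j hj => ?_⟩
  rw [iteratedFDerivWithin_subset (hts i) (ht i) (hs i)
    ((h1 i).of_le (by exact_mod_cast le_top)) hx]
  exact hC i x (hts i hx) j hj

theorem reindex {κ : Type*} (e : κ → ι) (hf : UnifBdd k s f) :
    UnifBdd k (fun i => s (e i)) (fun i => f (e i)) := by
  obtain ⟨h1, C, hC⟩ := hf
  exact ⟨fun i => h1 (e i), C, fun i => hC (e i)⟩

/-- By Faà di Bruno, only derivatives of order at least 1 of the inner map enter. Its values need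
not be bounded, which matters because t is unbounded on J_∞. -/
theorem comp_of_bounds {t : ι → Set F} {g : ι → F → G} (hs : ∀ i, UniqueDiffOn ℝ (s i))
    (ht : ∀ i, UniqueDiffOn ℝ (t i)) (hg : ∀ i, ContDiffOn ℝ ∞ (g i) (t i))
    (hf : ∀ i, ContDiffOn ℝ ∞ (f i) (s i)) (hst : ∀ i, MapsTo (f i) (s i) (t i))
    (hC : ∃ C : ℝ, ∀ i, ∀ x ∈ s i, ∀ j ≤ k, ‖iteratedFDerivWithin ℝ j (g i) (t i) (f i x)‖ ≤ C)
    (hD : ∃ D : ℝ, ∀ i, ∀ x ∈ s i, ∀ j ≤ k, 1 ≤ j →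
      ‖iteratedFDerivWithin ℝ j (f i) (s i) x‖ ≤ D) :
    UnifBdd k s (fun i x => g i (f i x)) := by
  obtain ⟨C, hC⟩ := hC
  obtain ⟨D, hD⟩ := hD
  refine ⟨fun i => (hg i).comp (hf i) (hst i), (k.factorial : ℝ) * |C| * (max D 1) ^ k,
    fun i x hx j hj => ?_⟩
  have h := norm_iteratedFDerivWithin_comp_le (hg i) (hf i) (n := j)
    (by exact_mod_cast le_top) (ht i) (hs i) (hst i) hx (C := |C|) (D := max D 1)
    (fun l hl => (hC i x hx l (hl.trans hj)).trans (le_abs_self C))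
    (fun l hl hl' => ((hD i x hx l (hl'.trans hj) hl).trans (le_max_left _ _)).trans
      (le_self_pow₀ (le_max_right _ _) (by omega)))
  refine h.trans ?_
  gcongr
  exact le_max_right _ _

theorem comp {t : ι → Set F} {g : ι → F → G} (hs : ∀ i, UniqueDiffOn ℝ (s i))
    (ht : ∀ i, UniqueDiffOn ℝ (t i)) (hg : UnifBdd k t g) (hf : UnifBdd k s f)
    (hst : ∀ i, MapsTo (f i) (s i) (t i)) : UnifBdd k s (fun i x => g i (f i x)) := by
  obtain ⟨h1, C, hC⟩ := hg
  obtain ⟨h2, D, hD⟩ := hf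
  exact comp_of_bounds hs ht h1 h2 hst ⟨C, fun i x hx j hj => hC i _ (hst i hx) j hj⟩
    ⟨D, fun i x hx j hj _ => hD i x hx j hj⟩

/-- Composition with affine maps whose linear parts are bounded. -/
theorem comp_affine {t : ι → Set F} {g : ι → F → G} {L : ι → E →L[ℝ] F}
    (hs : ∀ i, UniqueDiffOn ℝ (s i)) (ht : ∀ i, UniqueDiffOn ℝ (t i)) (hg : UnifBdd k t g)
    (hf : ∀ i, ∀ x ∈ s i, HasFDerivWithinAt (f i) (L i) (s i) x)
    (hL : ∃ C : ℝ, ∀ i, ‖L i‖ ≤ C)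
    (hst : ∀ i, MapsTo (f i) (s i) (t i)) : UnifBdd k s (fun i x => g i (f i x)) := by
  obtain ⟨h1, C, hC⟩ := hg
  have hcs : ∀ i, EqOn (_root_.fderivWithin ℝ (f i) (s i)) (fun _ => L i) (s i) :=
    fun i x hx => (hf i x hx).fderivWithin (hs i x hx)
  have hfs : ∀ i, ContDiffOn ℝ ∞ (f i) (s i) := fun i =>
    (contDiffOn_infty_iff_fderivWithin (hs i)).2
      ⟨fun x hx => (hf i x hx).differentiableWithinAt, contDiffOn_const.congr (hcs i)⟩
  have hD : UnifBdd k s (fun i => _root_.fderivWithin ℝ (f i) (s i)) :=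
    (const (hL.imp fun C hC i _ => hC i)).congr hcs
  obtain ⟨-, D, hD⟩ := hD
  refine comp_of_bounds hs ht h1 hfs hst ⟨C, fun i x hx j hj => hC i _ (hst i hx) j hj⟩
    ⟨D, fun i x hx j hj hj1 => ?_⟩
  obtain ⟨j, rfl⟩ := Nat.exists_eq_add_of_le' hj1
  rw [← norm_iteratedFDerivWithin_fderivWithin (hs i) hx]
  exact hD i x hx j (by omega)

/-- Composition with a fixed smooth map if the values stay in a compact set. -/
theorem comp_of_compact {U K : Set F} {Φ : F → G} (hs : ∀ i, UniqueDiffOn ℝ (s i))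
    (hU : IsOpen U) (hΦ : ContDiffOn ℝ ∞ Φ U) (hK : IsCompact K) (hKU : K ⊆ U)
    (hf : UnifBdd k s f) (hfK : ∀ i, MapsTo (f i) (s i) K) :
    UnifBdd k s (fun i x => Φ (f i x)) := by
  obtain ⟨h2, D, hD⟩ := hf
  have hb : ∀ j : ℕ, ∃ C, ∀ y ∈ K, ‖iteratedFDerivWithin ℝ j Φ U y‖ ≤ C := fun j =>
    hK.exists_bound_of_continuousOn ((hΦ.continuousOn_iteratedFDerivWithin
      (by exact_mod_cast le_top) hU.uniqueDiffOn).mono hKU)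
  choose C hC using hb
  refine comp_of_bounds (t := fun _ => U) (g := fun _ => Φ) hs (fun _ => hU.uniqueDiffOn)
    (fun _ => hΦ) h2 (fun i x hx => hKU (hfK i hx))
    ⟨∑ j ∈ Finset.range (k + 1), |C j|, fun i x hx j hj => ?_⟩
    ⟨D, fun i x hx j hj _ => hD i x hx j hj⟩
  exact ((hC j _ (hfK i hx)).trans (le_abs_self _)).trans
    (Finset.single_le_sum (f := fun j => |C j|) (fun j _ => abs_nonneg _)
      (Finset.mem_range.2 (by omega : j < k + 1)))

theorem inv_of_le {c : ι → E → ℝ} {δ : ℝ} (hδ : 0 < δ) (hs : ∀ i, UniqueDiffOn ℝ (s i))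
    (hc : UnifBdd k s c) (h : ∀ i, ∀ x ∈ s i, δ ≤ c i x) :
    UnifBdd k s (fun i x => (c i x)⁻¹) := by
  obtain ⟨C, -, hC⟩ := hc.exists_bound
  refine comp_of_compact (U := Ioi 0) (K := Icc δ C) hs isOpen_Ioi
    (contDiffOn_inv ℝ |>.mono fun x hx => (mem_Ioi.1 hx).ne') isCompact_Icc
    (fun x hx => hδ.trans_le hx.1) hc fun i x hx => ⟨h i x hx, ?_⟩
  exact (le_abs_self _).trans (hC i x hx)

/-- Bounds relative to positive weights `μ i` are bounds of the rescaled family. -/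
theorem of_bound {μ : ι → ℝ} (hμ : ∀ i, 0 < μ i) (hs : ∀ i, UniqueDiffOn ℝ (s i))
    (hf : ∀ i, ContDiffOn ℝ ∞ (f i) (s i))
    (hC : ∃ C : ℝ, ∀ i, ∀ x ∈ s i, ∀ j ≤ k,
      ‖iteratedFDerivWithin ℝ j (f i) (s i) x‖ ≤ C * μ i) :
    UnifBdd k s (fun i x => (μ i)⁻¹ • f i x) := by
  obtain ⟨C, hC⟩ := hC
  refine ⟨fun i => (hf i).const_smul _, C, fun i x hx j hj => ?_⟩
  have h : iteratedFDerivWithin ℝ j (fun x => (μ i)⁻¹ • f i x) (s i) x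
      = (μ i)⁻¹ • iteratedFDerivWithin ℝ j (f i) (s i) x :=
    iteratedFDerivWithin_const_smul_apply ((hf i x hx).of_le (by exact_mod_cast le_top)) (hs i) hx
  rw [h, norm_smul, norm_inv, Real.norm_of_nonneg (hμ i).le, inv_mul_le_iff₀ (hμ i), mul_comm]
  exact hC i x hx j hj

theorem bound {μ : ι → ℝ} (hμ : ∀ i, 0 < μ i) (hs : ∀ i, UniqueDiffOn ℝ (s i))
    (h : UnifBdd k s (fun i x => (μ i)⁻¹ • f i x)) :
    ∃ C : ℝ, ∀ i, ∀ x ∈ s i, ∀ j ≤ k, ‖iteratedFDerivWithin ℝ j (f i) (s i) x‖ ≤ C * μ i := by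
  obtain ⟨h1, C, hC⟩ := h
  refine ⟨C, fun i x hx j hj => ?_⟩
  have e : f i = fun x => μ i • ((μ i)⁻¹ • f i x) := by
    ext x; rw [smul_inv_smul₀ (hμ i).ne']
  have h : iteratedFDerivWithin ℝ j (f i) (s i) x
      = μ i • iteratedFDerivWithin ℝ j (fun x => (μ i)⁻¹ • f i x) (s i) x := by
    conv_lhs => rw [e]
    exact iteratedFDerivWithin_const_smul_apply ((h1 i x hx).of_le (by exact_mod_cast le_top))
      (hs i) hx
  rw [h, norm_smul, Real.norm_of_nonneg (hμ i).le, mul_comm]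
  exact mul_le_mul_of_nonneg_right (hC i x hx j hj) (hμ i).le

end UnifBdd

end UnifBdd

/-! ### Left inverses of injective linear maps and smoothness of lifts through immersions -/

section LeftInverse

variable {m n : ℕ}

/-- The Gram operator `Aᵀ A`. -/
noncomputable def gram (A : Euc m →L[ℝ] Euc n) : Euc m →L[ℝ] Euc m :=
  (ContinuousLinearMap.adjoint A) ∘L A

/-- The left inverse `(Aᵀ A)⁻¹ Aᵀ` of an injective linear map. -/
noncomputable def leftInv (A : Euc m →L[ℝ] Euc n) : Euc n →L[ℝ] Euc m :=
  (Ring.inverse (gram A)) ∘L (ContinuousLinearMap.adjoint A)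

theorem contDiff_adjoint :
    ContDiff ℝ ∞ (fun A : Euc m →L[ℝ] Euc n => ContinuousLinearMap.adjoint A) := by
  let l : (Euc m →L[ℝ] Euc n) →ₗ[ℝ] (Euc n →L[ℝ] Euc m) :=
    { toFun := fun A => ContinuousLinearMap.adjoint A
      map_add' := fun A B => map_add _ A B
      map_smul' := fun c A => by simp }
  exact (LinearMap.toContinuousLinearMap l).contDiff

theorem contDiff_gram : ContDiff ℝ ∞ (gram : (Euc m →L[ℝ] Euc n) → _) :=
  contDiff_adjoint.clm_comp contDiff_id

/-- From ⟨AᵀA v, v⟩ = ‖A v‖² the Gram operator is injective, hence bijective in finite dimension. -/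
theorem isUnit_gram {A : Euc m →L[ℝ] Euc n} (hA : Function.Injective A) : IsUnit (gram A) := by
  have hinj : Function.Injective (gram A) := by
    rw [injective_iff_map_eq_zero]
    intro v hv
    have h : inner ℝ (gram A v) v = ‖A v‖ ^ 2 := by
      simp [gram, ContinuousLinearMap.adjoint_inner_left]
    rw [hv, inner_zero_left] at h
    have h0 : A v = 0 := by
      have := pow_eq_zero_iff (two_ne_zero) |>.1 h.symm
      exact norm_eq_zero.1 this
    exact (injective_iff_map_eq_zero A).1 hA v h0
  rw [ContinuousLinearMap.isUnit_iff_bijective]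
  exact ⟨hinj, (LinearMap.injective_iff_surjective (f := (gram A).toLinearMap)).1 hinj⟩

theorem leftInv_comp {A : Euc m →L[ℝ] Euc n} (hA : Function.Injective A) :
    (leftInv A) ∘L A = ContinuousLinearMap.id ℝ (Euc m) :=
  Ring.inverse_mul_cancel _ (isUnit_gram hA)

theorem isOpen_isUnit_gram : IsOpen {A : Euc m →L[ℝ] Euc n | IsUnit (gram A)} :=
  Units.isOpen.preimage contDiff_gram.continuous

theorem contDiffOn_leftInv :
    ContDiffOn ℝ ∞ (leftInv : (Euc m →L[ℝ] Euc n) → _) {A | IsUnit (gram A)} := by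
  refine ContDiffOn.clm_comp (fun A hA => ?_) contDiff_adjoint.contDiffOn
  obtain ⟨u, hu⟩ := (hA : IsUnit (gram A))
  refine ContDiffAt.contDiffWithinAt ?_
  refine ContDiffAt.comp A (g := Ring.inverse) ?_ contDiff_gram.contDiffAt
  rw [← hu]
  exact contDiffAt_ringInverse ℝ u

theorem injective_of_le {A : Euc m →L[ℝ] Euc n} {c : ℝ} (hc : 0 < c)
    (h : ∀ v, c * ‖v‖ ≤ ‖A v‖) : Function.Injective A := by
  rw [injective_iff_map_eq_zero]
  intro v hv
  have := h v
  rw [hv, norm_zero] at this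
  exact norm_le_zero_iff.1 (by nlinarith [norm_nonneg v])

theorem isCompact_bounded_below (c C : ℝ) :
    IsCompact {A : Euc m →L[ℝ] Euc n | ‖A‖ ≤ C ∧ ∀ v, c * ‖v‖ ≤ ‖A v‖} := by
  have h1 : IsCompact (Metric.closedBall (0 : Euc m →L[ℝ] Euc n) C) := isCompact_closedBall 0 C
  have h2 : IsClosed {A : Euc m →L[ℝ] Euc n | ∀ v, c * ‖v‖ ≤ ‖A v‖} := by
    simp only [Set.ofPred_forall]
    exact isClosed_iInter fun v => isClosed_le continuous_const (by fun_prop)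
  convert h1.inter_right h2 using 1
  ext A
  simp

/-- Operators bounded above and below form a compact subset of the open set on which the left
inverse is smooth. -/
theorem UnifBdd.leftInv {ι E : Type*} [NormedAddCommGroup E] [NormedSpace ℝ E] {k : ℕ}
    {s : ι → Set E} {A : ι → E → Euc m →L[ℝ] Euc n} {c : ℝ} (hc : 0 < c)
    (hs : ∀ i, UniqueDiffOn ℝ (s i)) (hA : UnifBdd k s A)
    (h : ∀ i, ∀ x ∈ s i, ∀ v, c * ‖v‖ ≤ ‖A i x v‖) :
    UnifBdd k s (fun i x => _root_.leftInv (A i x)) := by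
  obtain ⟨C, -, hC⟩ := hA.exists_bound
  exact UnifBdd.comp_of_compact hs isOpen_isUnit_gram contDiffOn_leftInv
    (isCompact_bounded_below c C) (fun A hA => isUnit_gram (injective_of_le hc hA.2)) hA
    fun i x hx => ⟨hC i x hx, h i x hx⟩

variable {E : Type*} [NormedAddCommGroup E] [NormedSpace ℝ E]

/-- Applying the left inverse P of A to the expansion of i at ψ(x) gives ψ(y) - ψ(x) = P(f(y) -
f(x)) + o(ψ(y) - ψ(x)). The remainder is absorbed, so ψ(y) - ψ(x) = O(y - x), and the remainder is
then o(y - x). Mere continuity of ψ suffices to start. -/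
theorem hasFDerivWithinAt_lift {s : Set E} {t : Set (Euc m)} {ψ : E → Euc m} {i : Euc m → Euc n}
    {f : E → Euc n} {x : E} {A : Euc m →L[ℝ] Euc n} {f' : E →L[ℝ] Euc n} (hx : x ∈ s)
    (hψ : ContinuousWithinAt ψ s x) (hst : MapsTo ψ s t) (hi : HasFDerivWithinAt i A t (ψ x))
    (hA : Function.Injective A) (hf : HasFDerivWithinAt f f' s x)
    (hfi : ∀ y ∈ s, i (ψ y) = f y) : HasFDerivWithinAt ψ ((leftInv A) ∘L f') s x := by
  set P := leftInv A with hP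
  have hPA : ∀ v, P (A v) = v := fun v => by
    have := congrArg (fun T => T v) (leftInv_comp hA)
    simpa using this
  have ht : Tendsto ψ (𝓝[s] x) (𝓝[t] (ψ x)) := hψ.tendsto_nhdsWithin hst
  have h1 : (fun y => i (ψ y) - i (ψ x) - A (ψ y - ψ x)) =o[𝓝[s] x] fun y => ψ y - ψ x :=
    (hasFDerivWithinAt_iff_isLittleO.1 hi).comp_tendsto ht
  have h2 : (fun y => P (f y - f x) - (ψ y - ψ x)) =o[𝓝[s] x] fun y => ψ y - ψ x := by
    refine ((P.isBigO_comp _ _).trans_isLittleO h1).congr' ?_ EventuallyEq.rfl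
    filter_upwards [self_mem_nhdsWithin] with y hy
    rw [map_sub, hPA, hfi y hy, hfi x hx]
  have h3 : (fun y => f y - f x - f' (y - x)) =o[𝓝[s] x] fun y => y - x :=
    hasFDerivWithinAt_iff_isLittleO.1 hf
  have h4 : (fun y => f y - f x) =O[𝓝[s] x] fun y => y - x := by
    simpa using h3.isBigO.add (f'.isBigO_comp (fun y => y - x) (𝓝[s] x))
  -- Absorption: a quantity differing from P(f(y) - f(x)) by little-o of itself is big-O of it.
  have h5 : (fun y => ψ y - ψ x) =O[𝓝[s] x] fun y => y - x := by
    refine h2.right_isBigO_add.trans ?_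
    simpa using (P.isBigO_comp _ _).trans h4
  rw [hasFDerivWithinAt_iff_isLittleO]
  have h6 : (fun y => P (f y - f x - f' (y - x))) =o[𝓝[s] x] fun y => y - x :=
    (P.isBigO_comp _ _).trans_isLittleO h3
  refine (h6.sub (h2.trans_isBigO h5)).congr' (Eventually.of_forall fun y => ?_) EventuallyEq.rfl
  simp only [map_sub, ContinuousLinearMap.comp_apply]
  abel

/-- Bootstrap: the formula for the derivative of ψ involves ψ only through Di(ψ), so if ψ is of
class C^k, its derivative is too. -/
theorem contDiffOn_lift {s : Set E} {t : Set (Euc m)} {ψ : E → Euc m} {i : Euc m → Euc n}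
    {f : E → Euc n} (hs : UniqueDiffOn ℝ s) (ht : UniqueDiffOn ℝ t)
    (hψ : ContinuousOn ψ s) (hst : MapsTo ψ s t) (hi : ContDiffOn ℝ ∞ i t)
    (hA : ∀ y ∈ t, Function.Injective (fderivWithin ℝ i t y)) (hf : ContDiffOn ℝ ∞ f s)
    (hfi : ∀ y ∈ s, i (ψ y) = f y) : ContDiffOn ℝ ∞ ψ s := by
  have hd : ∀ x ∈ s, HasFDerivWithinAt ψ
      ((leftInv (fderivWithin ℝ i t (ψ x))) ∘L (fderivWithin ℝ f s x)) s x := fun x hx =>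
    hasFDerivWithinAt_lift hx (hψ x hx) hst
      ((hi.differentiableOn (by simp)) _ (hst hx)).hasFDerivWithinAt (hA _ (hst hx))
      ((hf.differentiableOn (by simp)) _ hx).hasFDerivWithinAt hfi
  have hi' : ContDiffOn ℝ ∞ (fderivWithin ℝ i t) t := hi.fderivWithin ht (by simp)
  have hf' : ContDiffOn ℝ ∞ (fderivWithin ℝ f s) s := hf.fderivWithin hs (by simp)
  rw [contDiffOn_infty]
  intro k
  induction k with
  | zero => simpa using hψ
  | succ k ih =>
    push_cast
    rw [contDiffOn_succ_iff_fderivWithin hs]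
    refine ⟨fun x hx => (hd x hx).differentiableWithinAt, by simp, ?_⟩
    have hk : ((k : ℕ) : WithTop ℕ∞) ≤ (∞ : WithTop ℕ∞) := by exact_mod_cast le_top
    refine ContDiffOn.congr (ContDiffOn.clm_comp ?_ (hf'.of_le hk))
      (fun x hx => (hd x hx).fderivWithin (hs x hx))
    exact (contDiffOn_leftInv.of_le hk).comp ((hi'.of_le hk).comp ih hst)
      fun x hx => isUnit_gram (hA _ (hst hx))

end LeftInverse

/-! ### Half-spaces, cubes and charts -/

theorem convex_halfSpace (m : ℕ) : Convex ℝ (halfSpace m) := by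
  intro x hx y hy a b ha hb _ i hi
  have h1 := hx i hi
  have h2 := hy i hi
  simp only [PiLp.add_apply, PiLp.smul_apply, smul_eq_mul]
  positivity

theorem convex_cube (m : ℕ) : Convex ℝ (cube m) := by
  intro x hx y hy a b ha hb hab i
  have := (convex_Ioo (-1 : ℝ) 1) (hx i) (hy i) ha hb hab
  simpa using this

theorem isOpen_cube (m : ℕ) : IsOpen (cube m) := by
  have : cube m = ⋂ i : Fin m, (fun x : Euc m => x i) ⁻¹' Ioo (-1 : ℝ) 1 := by
    ext x; simp [cube]
  rw [this]
  exact isOpen_iInter_of_finite fun i => isOpen_Ioo.preimage (by fun_prop)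

theorem interior_halfSpace_nonempty (m : ℕ) : (interior (halfSpace m)).Nonempty := by
  refine ⟨WithLp.toLp 2 fun _ => 1, mem_interior.2
    ⟨⋂ i : Fin m, (fun x : Euc m => x i) ⁻¹' Ioi 0, fun x hx i _ => ?_,
      isOpen_iInter_of_finite fun i => isOpen_Ioi.preimage (by fun_prop), by simp⟩⟩
  exact le_of_lt (mem_iInter.1 hx i)

theorem uniqueDiffOn_halfSpace (m : ℕ) : UniqueDiffOn ℝ (halfSpace m) :=
  uniqueDiffOn_convex (convex_halfSpace m) (interior_halfSpace_nonempty m)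

theorem uniqueDiffOn_of_open_or_inter {m : ℕ} {D : Set (Euc m)}
    (h : ∃ O : Set (Euc m), IsOpen O ∧ (D = O ∨ D = O ∩ halfSpace m)) : UniqueDiffOn ℝ D := by
  obtain ⟨O, hO, h | h⟩ := h
  · rw [h]; exact hO.uniqueDiffOn
  · rw [h, inter_comm]; exact (uniqueDiffOn_halfSpace m).inter hO

theorem zero_mem_cube (m : ℕ) : (0 : Euc m) ∈ cube m := fun i => by simp

theorem zero_mem_halfSpace (m : ℕ) : (0 : Euc m) ∈ halfSpace m := fun i _ => by simp

theorem halfSpace_zero : halfSpace 0 = univ := by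
  ext x; simp [halfSpace]

theorem norm_le_of_mem_cube {m : ℕ} {x : Euc m} (hx : x ∈ cube m) : ‖x‖ ≤ Real.sqrt m := by
  rw [EuclideanSpace.norm_eq]
  refine Real.sqrt_le_sqrt ?_
  calc ∑ i, ‖x i‖ ^ 2 ≤ ∑ _i : Fin m, (1 : ℝ) := Finset.sum_le_sum fun i _ => by
        have := abs_lt.2 (hx i)
        rw [Real.norm_eq_abs]
        exact pow_le_one₀ (abs_nonneg _) this.le
    _ = m := by simp

namespace Chart

variable {m n : ℕ} {M : Set (Euc n)} (κ : Chart m M)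

theorem uniqueDiffOn : UniqueDiffOn ℝ κ.dom := uniqueDiffOn_of_open_or_inter κ.dom_open

theorem injOn : InjOn κ.param κ.dom := by
  have := κ.isOpenEmbedding.injective
  exact fun x hx y hy h => congrArg Subtype.val
    (@this ⟨x, hx⟩ ⟨y, hy⟩ (Subtype.ext h))

theorem coord_mem {p : Euc n} (hp : p ∈ κ.patch) : κ.coord p ∈ κ.dom :=
  Function.invFunOn_mem hp

theorem param_coord {p : Euc n} (hp : p ∈ κ.patch) : κ.param (κ.coord p) = p :=
  Function.invFunOn_eq hp

theorem coord_param {x : Euc m} (hx : x ∈ κ.dom) : κ.coord (κ.param x) = x :=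
  κ.injOn (κ.coord_mem ⟨x, hx, rfl⟩) hx (κ.param_coord ⟨x, hx, rfl⟩)

theorem exists_isOpen_patch : ∃ W : Set (Euc n), IsOpen W ∧ κ.patch = M ∩ W := by
  have h := κ.isOpenEmbedding.isOpen_range
  obtain ⟨W, hW, hWe⟩ := isOpen_induced_iff.1 h
  refine ⟨W, hW, ?_⟩
  ext p
  constructor
  · rintro ⟨x, hx, rfl⟩
    refine ⟨κ.mapsTo hx, ?_⟩
    have : (⟨κ.param x, κ.mapsTo hx⟩ : M) ∈ Subtype.val ⁻¹' W := by
      rw [hWe]; exact ⟨⟨x, hx⟩, rfl⟩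
    exact this
  · rintro ⟨hpM, hpW⟩
    have : (⟨p, hpM⟩ : M) ∈ Subtype.val ⁻¹' W := hpW
    rw [hWe] at this
    obtain ⟨x, hx⟩ := this
    exact ⟨x, x.2, congrArg Subtype.val hx⟩

theorem continuousOn_coord : ContinuousOn κ.coord κ.patch := by
  intro p hp
  obtain ⟨x, hx, rfl⟩ := hp
  rw [ContinuousWithinAt, coord_param κ hx, Filter.tendsto_def]
  intro V hV
  obtain ⟨V', hV'V, hV'o, hxV'⟩ := mem_nhds_iff.1 hV
  have ho := κ.isOpenEmbedding.isOpenMap (Subtype.val ⁻¹' V') (hV'o.preimage continuous_subtype_val)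
  obtain ⟨W, hW, hWe⟩ := isOpen_induced_iff.1 ho
  have hmem : ∀ y (hy : y ∈ κ.dom), κ.param y ∈ W ↔ y ∈ V' := by
    intro y hy
    have : (⟨κ.param y, κ.mapsTo hy⟩ : M) ∈ Subtype.val ⁻¹' W ↔ y ∈ V' := by
      rw [hWe]
      constructor
      · rintro ⟨z, hz, hzy⟩
        have := κ.injOn z.2 hy (congrArg Subtype.val hzy)
        rw [← this]; exact hz
      · intro h
        exact ⟨⟨y, hy⟩, h, rfl⟩
    exact this
  refine mem_nhdsWithin.2 ⟨W, hW, (hmem x hx).2 hxV', ?_⟩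
  rintro _ ⟨hq, y, hy, rfl⟩
  rw [mem_preimage, coord_param κ hy]
  exact hV'V ((hmem y hy).1 hq)

theorem continuousOn_param : ContinuousOn κ.param κ.dom := κ.smooth.continuousOn

theorem overlap_subset (κ' : Chart m M) : κ.overlap κ' ⊆ κ.dom := fun _ hx => hx.1

/-- The other patch is relatively open in M, so by continuity the overlap is relatively open in the
range of the chart. -/
theorem uniqueDiffOn_overlap (κ' : Chart m M) : UniqueDiffOn ℝ (κ.overlap κ') := by
  obtain ⟨W, hW, hWe⟩ := κ'.exists_isOpen_patch
  obtain ⟨O, hO, hOe⟩ := (continuousOn_iff'.1 κ.continuousOn_param) W hW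
  have : κ.overlap κ' = κ.dom ∩ O := by
    ext x
    have h := Set.ext_iff.1 hOe x
    simp only [mem_inter_iff, mem_preimage] at h
    simp only [overlap, hWe, mem_ofPred_eq, mem_inter_iff]
    constructor
    · rintro ⟨hx, -, hxW⟩
      exact ⟨hx, (h.1 ⟨hxW, hx⟩).1⟩
    · rintro ⟨hx, hxO⟩
      exact ⟨hx, κ.mapsTo hx, (h.2 ⟨hxO, hx⟩).1⟩
  rw [this]
  exact κ.uniqueDiffOn.inter hO

theorem hasFDerivWithinAt {x : Euc m} (hx : x ∈ κ.dom) :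
    HasFDerivWithinAt κ.param (fderivWithin ℝ κ.param κ.dom x) κ.dom x :=
  (κ.smooth.differentiableOn (by simp) x hx).hasFDerivWithinAt

/-- A smooth map into the submanifold has smooth coordinates. -/
theorem contDiffOn_coord_comp {E : Type*} [NormedAddCommGroup E] [NormedSpace ℝ E] {s : Set E}
    {f : E → Euc n} (hs : UniqueDiffOn ℝ s) (hf : ContDiffOn ℝ ∞ f s) (hfs : MapsTo f s κ.patch) :
    ContDiffOn ℝ ∞ (fun x => κ.coord (f x)) s :=
  contDiffOn_lift hs κ.uniqueDiffOn (κ.continuousOn_coord.comp hf.continuousOn hfs)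
    (fun _ hx => κ.coord_mem (hfs hx)) κ.smooth κ.immersion hf
    fun _ hx => κ.param_coord (hfs hx)

theorem IsNormalized.dom_subset {κ : Chart m M} (h : κ.IsNormalized) : κ.dom ⊆ cube m := by
  rcases h with h | h <;> rw [h]
  exact inter_subset_left

theorem IsNormalized.convex {κ : Chart m M} (h : κ.IsNormalized) : Convex ℝ κ.dom := by
  rcases h with h | h <;> rw [h]
  · exact convex_cube m
  · exact (convex_cube m).inter (convex_halfSpace m)

theorem IsNormalized.zero_mem {κ : Chart m M} (h : κ.IsNormalized) : (0 : Euc m) ∈ κ.dom := by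
  rcases h with h | h <;> rw [h]
  · exact zero_mem_cube m
  · exact ⟨zero_mem_cube m, zero_mem_halfSpace m⟩

end Chart

/-! ### Parametrization-regular singularity functions are singularity functions -/

/-- Finitely many bounds have a common upper bound. -/
theorem exists_forall_le_of_forall_exists {P : ℕ → ℝ → Prop}
    (hP : ∀ j C C', C ≤ C' → P j C → P j C') (h : ∀ j, ∃ C, P j C) (k : ℕ) :
    ∃ C, ∀ j ≤ k, P j C := by
  choose C hC using h
  refine ⟨∑ j ∈ Finset.range (k + 1), |C j|, fun j hj => hP j _ _ ?_ (hC j)⟩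
  exact (le_abs_self _).trans (Finset.single_le_sum (f := fun j => |C j|)
    (fun j _ => abs_nonneg _) (Finset.mem_range.2 (by omega : j < k + 1)))

namespace IsPRSingularityDatumOn

variable {m n : ℕ} {M S : Set (Euc n)} {ρ : Euc n → ℝ} {K : Set (Chart m M)}

theorem center_pos (h : IsPRSingularityDatumOn S ρ K) (κ : chartsOn K S) :
    0 < κ.1.center ρ :=
  h.smooth.1 _ (κ.1.mapsTo (h.shrinkable.1 κ κ.2).zero_mem)

/-- The derivative of the parametrization, scaled by the value of `ρ` at the center. -/
noncomputable def scaledDeriv (ρ : Euc n → ℝ) (κ : Chart m M) (x : Euc m) : Euc m →L[ℝ] Euc n :=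
  (κ.center ρ)⁻¹ • fderivWithin ℝ κ.param κ.dom x

theorem unifBdd_scaledDeriv (h : IsPRSingularityDatumOn S ρ K) (k : ℕ) :
    UnifBdd k (fun κ : chartsOn K S => κ.1.dom) (fun κ => scaledDeriv ρ κ.1) := by
  refine UnifBdd.of_bound (μ := fun κ : chartsOn K S => κ.1.center ρ) h.center_pos
    (fun κ => κ.1.uniqueDiffOn)
    (fun κ => κ.1.smooth.fderivWithin κ.1.uniqueDiffOn (by simp)) ?_
  obtain ⟨C, hC⟩ := exists_forall_le_of_forall_exists
    (P := fun j C => ∀ κ ∈ chartsOn K S, ∀ x ∈ κ.dom,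
      ‖iteratedFDerivWithin ℝ (j + 1) κ.param κ.dom x‖ ≤ C * κ.center ρ)
    (fun j C C' hCC' hC κ hκ x hx => (hC κ hκ x hx).trans
      (mul_le_mul_of_nonneg_right hCC' (h.center_pos ⟨κ, hκ⟩).le))
    (fun j => h.param_bound (j + 1) (by omega)) k
  refine ⟨C, fun κ x hx j hj => ?_⟩
  rw [norm_iteratedFDerivWithin_fderivWithin κ.1.uniqueDiffOn hx]
  exact hC j hj κ κ.2 x hx

theorem unifBdd_scaled (h : IsPRSingularityDatumOn S ρ K) (k : ℕ) :
    UnifBdd k (fun κ : chartsOn K S => κ.1.dom)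
      (fun κ x => (κ.1.center ρ)⁻¹ * ρ (κ.1.param x)) := by
  obtain ⟨C, hC⟩ := h.bound k
  exact UnifBdd.of_bound (μ := fun κ : chartsOn K S => κ.1.center ρ) h.center_pos
    (fun κ => κ.1.uniqueDiffOn) (fun κ => h.smooth.2 κ.1)
    ⟨C, fun κ x hx j hj => hC κ κ.2 x hx j hj⟩

theorem exists_scaledDeriv_lower (h : IsPRSingularityDatumOn S ρ K) :
    ∃ c : ℝ, 0 < c ∧ ∀ κ : chartsOn K S, ∀ x ∈ κ.1.dom, ∀ v,
      c * ‖v‖ ≤ ‖scaledDeriv ρ κ.1 x v‖ := by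
  obtain ⟨c, hc, hl⟩ := h.metric_lower
  have hc0 : 0 < c := by linarith
  -- The natural constant is 1/√c; since c ≥ 1, the smaller 1/c works and avoids the root.
  refine ⟨1 / c, by positivity, fun κ x hx v => ?_⟩
  have hp := h.center_pos κ
  have h1 := hl κ κ.2 x hx v
  rw [Chart.metric, real_inner_self_eq_norm_sq] at h1
  rw [scaledDeriv, smul_apply, norm_smul, norm_inv,
    Real.norm_of_nonneg hp.le, le_inv_mul_iff₀ hp]
  refine le_of_sq_le_sq ?_ (norm_nonneg _)
  refine le_trans ?_ h1
  have h2 : (κ.1.center ρ * (1 / c * ‖v‖)) ^ 2 = κ.1.center ρ ^ 2 * ‖v‖ ^ 2 / c * (1 / c) := by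
    field_simp
  rw [h2]
  exact mul_le_of_le_one_right (by positivity) (by rw [div_le_one hc0]; exact hc)

/-- The center values of overlapping charts are comparable. -/
theorem exists_center_le (h : IsPRSingularityDatumOn S ρ K) :
    ∃ c : ℝ, 0 < c ∧ ∀ κ κ' : chartsOn K S, (κ.1.overlap κ'.1).Nonempty →
      κ.1.center ρ ≤ c * κ'.1.center ρ := by
  obtain ⟨c, hc, he⟩ := h.equiv
  have hc0 : 0 < c := by linarith
  -- One factor c for each of the two charts, compared at a common point.
  refine ⟨c * c, by positivity, fun κ κ' ⟨x, hx, hx'⟩ => ?_⟩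
  obtain ⟨y, hy, hxy⟩ := hx'
  have h1 := (he κ κ.2 x hx).1
  have h2 := (he κ' κ'.2 y hy).2
  rw [div_le_iff₀ hc0] at h1
  rw [hxy] at h2
  nlinarith

/-- Both g and ρ² are rescaled by the squared center value, which leaves only uniformly bounded
families. -/
theorem metric_div_eq (h : IsPRSingularityDatumOn S ρ K) (κ : chartsOn K S) {x : Euc m}
    (hx : x ∈ κ.1.dom) (ξ η : Euc m) :
    κ.1.metric x ξ η / ρ (κ.1.param x) ^ 2 =
      inner ℝ (scaledDeriv ρ κ.1 x ξ) (scaledDeriv ρ κ.1 x η) *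
        (((κ.1.center ρ)⁻¹ * ρ (κ.1.param x))⁻¹ * ((κ.1.center ρ)⁻¹ * ρ (κ.1.param x))⁻¹) := by
  have hp := (h.center_pos κ).ne'
  have hq := (h.smooth.1 _ (κ.1.mapsTo hx)).ne'
  simp only [scaledDeriv, smul_apply, inner_smul_left, inner_smul_right,
    Chart.metric, map_inv₀, conj_trivial]
  field_simp

theorem exists_scaled_bounds (h : IsPRSingularityDatumOn S ρ K) :
    ∃ c : ℝ, 1 ≤ c ∧ ∀ κ : chartsOn K S, ∀ x ∈ κ.1.dom,
      1 / c ≤ (κ.1.center ρ)⁻¹ * ρ (κ.1.param x) ∧ (κ.1.center ρ)⁻¹ * ρ (κ.1.param x) ≤ c := by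
  obtain ⟨c, hc, he⟩ := h.equiv
  refine ⟨c, hc, fun κ x hx => ?_⟩
  have hp := h.center_pos κ
  obtain ⟨h1, h2⟩ := he κ κ.2 x hx
  rw [le_inv_mul_iff₀ hp, inv_mul_le_iff₀ hp]
  constructor
  · rwa [mul_one_div]
  · linarith

theorem exists_metric_equiv (h : IsPRSingularityDatumOn S ρ K) :
    ∃ c : ℝ, 1 ≤ c ∧ ∀ κ ∈ chartsOn K S, ∀ x ∈ κ.dom, ∀ ξ : Euc m,
      ‖ξ‖ ^ 2 / c ≤ κ.metric x ξ ξ / ρ (κ.param x) ^ 2 ∧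
        κ.metric x ξ ξ / ρ (κ.param x) ^ 2 ≤ c * ‖ξ‖ ^ 2 := by
  obtain ⟨a, ha, hl⟩ := h.exists_scaledDeriv_lower
  obtain ⟨C, hC, hu⟩ := (h.unifBdd_scaledDeriv 0).exists_bound
  obtain ⟨c, hc, he⟩ := h.exists_scaled_bounds
  have hc0 : 0 < c := by linarith
  -- The first term serves the lower estimate, the second the upper one, and 1 makes the constant at
  -- least 1.
  refine ⟨c ^ 2 / a ^ 2 + C ^ 2 * c ^ 2 + 1, by
    have : 0 ≤ c ^ 2 / a ^ 2 + C ^ 2 * c ^ 2 := by positivity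
    linarith, fun κ hκ x hx ξ => ?_⟩
  rw [h.metric_div_eq ⟨κ, hκ⟩ hx, real_inner_self_eq_norm_sq]
  obtain ⟨h1, h2⟩ := he ⟨κ, hκ⟩ x hx
  have h3 := hl ⟨κ, hκ⟩ x hx ξ
  have h4 := (scaledDeriv ρ κ x).le_of_opNorm_le (hu ⟨κ, hκ⟩ x hx) ξ
  simp only at h1 h2 h3 h4 ⊢
  set q := (κ.center ρ)⁻¹ * ρ (κ.param x)
  set w := ‖scaledDeriv ρ κ x ξ‖
  have hq : 0 < q := lt_of_lt_of_le (by positivity) h1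
  have h5 : 1 / c ≤ q⁻¹ := by
    rw [one_div]; exact inv_anti₀ hq h2
  have h6 : q⁻¹ ≤ c := by
    rw [inv_le_comm₀ hq hc0, ← one_div]; exact h1
  have hw : 0 ≤ w := norm_nonneg _
  constructor
  · calc ‖ξ‖ ^ 2 / (c ^ 2 / a ^ 2 + C ^ 2 * c ^ 2 + 1) ≤ ‖ξ‖ ^ 2 / (c ^ 2 / a ^ 2) := by
          refine div_le_div_of_nonneg_left (by positivity) (by positivity) ?_
          have : 0 ≤ C ^ 2 * c ^ 2 := by positivity
          linarith
      _ = (a * ‖ξ‖) ^ 2 * ((1 / c) * (1 / c)) := by field_simp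
      _ ≤ w ^ 2 * (q⁻¹ * q⁻¹) := by gcongr
  · calc w ^ 2 * (q⁻¹ * q⁻¹) ≤ (C * ‖ξ‖) ^ 2 * (c * c) := by gcongr
      _ = (C ^ 2 * c ^ 2) * ‖ξ‖ ^ 2 := by ring
      _ ≤ (c ^ 2 / a ^ 2 + C ^ 2 * c ^ 2 + 1) * ‖ξ‖ ^ 2 := by
          refine mul_le_mul_of_nonneg_right ?_ (by positivity)
          have : 0 ≤ c ^ 2 / a ^ 2 := by positivity
          linarith

theorem exists_metric_bound (h : IsPRSingularityDatumOn S ρ K) (k : ℕ) :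
    ∃ c : ℝ, ∀ κ ∈ chartsOn K S, ∀ x ∈ κ.dom, ∀ j ≤ k, ∀ a a' : Fin m,
      ‖iteratedFDerivWithin ℝ j
        (fun y => κ.metric y (EuclideanSpace.single a 1) (EuclideanSpace.single a' 1)
          / ρ (κ.param y) ^ 2) κ.dom x‖ ≤ c := by
  have hs : ∀ κ : chartsOn K S, UniqueDiffOn ℝ κ.1.dom := fun κ => κ.1.uniqueDiffOn
  obtain ⟨c, hc, he⟩ := h.exists_scaled_bounds
  have hc0 : 0 < c := by linarith
  have hinv := UnifBdd.inv_of_le (by positivity : 0 < 1 / c) hs (h.unifBdd_scaled k)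
    fun κ x hx => (he κ x hx).1
  have hA : ∀ v : Euc m, UnifBdd k (fun κ : chartsOn K S => κ.1.dom)
      (fun κ x => scaledDeriv ρ κ.1 x v) := fun v =>
    UnifBdd.clm (ContinuousLinearMap.apply ℝ (Euc n) v) hs (h.unifBdd_scaledDeriv k)
  have hmain : ∀ p : Fin m × Fin m, UnifBdd k (fun κ : chartsOn K S => κ.1.dom) (fun κ y =>
      κ.1.metric y (EuclideanSpace.single p.1 1) (EuclideanSpace.single p.2 1)
          / ρ (κ.1.param y) ^ 2) := fun p =>
    (UnifBdd.mul hs (UnifBdd.bilin (innerSL ℝ) hs (hA (EuclideanSpace.single p.1 1))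
      (hA (EuclideanSpace.single p.2 1))) (UnifBdd.mul hs hinv hinv)).congr
      fun κ x hx => h.metric_div_eq κ hx _ _
  choose C hC using fun p => (hmain p).2
  refine ⟨∑ p, |C p|, fun κ hκ x hx j hj a a' => ?_⟩
  exact ((hC (a, a') ⟨κ, hκ⟩ x hx j hj).trans (le_abs_self _)).trans
    (Finset.single_le_sum (f := fun p => |C p|) (fun p _ => abs_nonneg _) (Finset.mem_univ (a, a')))

/-- Induction on the order: the derivative of a transition map is the left inverse of the scaled
derivative of the target chart, evaluated along the transition map itself, composed with the scaled
derivative of the source chart and the ratio of the centers. Order k on the right yields order k + 1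
on the left; order 0 is bounded because ranges of normalized charts lie in the cube. -/
theorem unifBdd_transition (h : IsPRSingularityDatumOn S ρ K) (k : ℕ) :
    UnifBdd k (fun p : chartsOn K S × chartsOn K S => p.1.1.overlap p.2.1)
      (fun p x => p.2.1.coord (p.1.1.param x)) := by
  have hs : ∀ p : chartsOn K S × chartsOn K S, UniqueDiffOn ℝ (p.1.1.overlap p.2.1) :=
    fun p => p.1.1.uniqueDiffOn_overlap p.2.1
  have ht : ∀ p : chartsOn K S × chartsOn K S, UniqueDiffOn ℝ p.2.1.dom :=
    fun p => p.2.1.uniqueDiffOn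
  have hmaps : ∀ p : chartsOn K S × chartsOn K S,
      MapsTo (fun x => p.2.1.coord (p.1.1.param x)) (p.1.1.overlap p.2.1) p.2.1.dom :=
    fun p x hx => p.2.1.coord_mem hx.2
  have hsm : ∀ p : chartsOn K S × chartsOn K S,
      ContDiffOn ℝ ∞ (fun x => p.2.1.coord (p.1.1.param x)) (p.1.1.overlap p.2.1) :=
    fun p => p.2.1.contDiffOn_coord_comp (hs p) (p.1.1.smooth.mono (p.1.1.overlap_subset _))
      fun x hx => hx.2
  have hbd : ∃ C : ℝ, ∀ p : chartsOn K S × chartsOn K S, ∀ x ∈ p.1.1.overlap p.2.1,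
      ‖p.2.1.coord (p.1.1.param x)‖ ≤ C :=
    ⟨Real.sqrt m, fun p x hx => norm_le_of_mem_cube
      ((h.shrinkable.1 p.2 p.2.2).dom_subset (hmaps p hx))⟩
  obtain ⟨c, hc, hcc⟩ := h.exists_center_le
  obtain ⟨a, ha, hl⟩ := h.exists_scaledDeriv_lower
  induction k with
  | zero => exact UnifBdd.of_norm_le hsm hbd
  | succ k ih =>
    refine UnifBdd.of_fderivWithin_eq (f' := fun p x =>
      (leftInv (scaledDeriv ρ p.2.1 (p.2.1.coord (p.1.1.param x)))) ∘L
        ((p.1.1.center ρ / p.2.1.center ρ) • scaledDeriv ρ p.1.1 x)) hs hsm hbd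
      (fun p x hx => ?_) ?_
    · have hp1 := (h.center_pos p.1).ne'
      have hp2 := (h.center_pos p.2).ne'
      -- Both sides of i_κ' ∘ ψ = i_κ are divided by the center value of the target chart, so that
      -- the lift formula contains only scaled derivatives.
      have hf : HasFDerivWithinAt (fun x => (p.2.1.center ρ)⁻¹ • p.1.1.param x)
          ((p.1.1.center ρ / p.2.1.center ρ) • scaledDeriv ρ p.1.1 x) (p.1.1.overlap p.2.1) x := by
        have := ((p.1.1.hasFDerivWithinAt hx.1).mono (p.1.1.overlap_subset p.2.1)).const_smul
          (p.2.1.center ρ)⁻¹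
        have e : (p.1.1.center ρ / p.2.1.center ρ) • scaledDeriv ρ p.1.1 x =
            (p.2.1.center ρ)⁻¹ • fderivWithin ℝ p.1.1.param p.1.1.dom x := by
          unfold scaledDeriv
          rw [smul_smul]
          congr 1
          field_simp
        rw [e]
        exact this
      have hi : HasFDerivWithinAt (fun y => (p.2.1.center ρ)⁻¹ • p.2.1.param y)
          (scaledDeriv ρ p.2.1 (p.2.1.coord (p.1.1.param x))) p.2.1.dom
          (p.2.1.coord (p.1.1.param x)) :=
        (p.2.1.hasFDerivWithinAt (hmaps p hx)).const_smul (p.2.1.center ρ)⁻¹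
      refine hasFDerivWithinAt_lift (i := fun y => (p.2.1.center ρ)⁻¹ • p.2.1.param y) hx
        ((hsm p).continuousOn x hx) (hmaps p)
        hi (injective_of_le ha (hl p.2 _ (hmaps p hx))) hf fun y hy => ?_
      rw [p.2.1.param_coord hy.2]
    · refine UnifBdd.bilin (ContinuousLinearMap.compL ℝ (Euc m) (Euc n) (Euc m)) hs
        (UnifBdd.leftInv ha hs (UnifBdd.comp hs ht
          ((h.unifBdd_scaledDeriv k).reindex Prod.snd) ih hmaps)
          fun p x hx => hl p.2 _ (hmaps p hx))
        (UnifBdd.const_smul hs ⟨c, fun p hne => ?_⟩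
          (((h.unifBdd_scaledDeriv k).reindex Prod.fst).mono_set hs
            (fun p => p.1.1.uniqueDiffOn) fun p => p.1.1.overlap_subset _))
      have hp1 := h.center_pos p.1
      have hp2 := h.center_pos p.2
      rw [abs_of_pos (by positivity), div_le_iff₀ hp2]
      exact hcc p.1 p.2 hne

theorem isSingularityFunctionOn (h : IsPRSingularityDatumOn S ρ K) :
    IsSingularityFunctionOn m M S ρ := by
  refine ⟨h.smooth, K, ⟨h.atlas, h.shrinkable, h.multiplicity, fun k => ?_⟩,
    h.exists_metric_equiv, h.exists_metric_bound⟩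
  obtain ⟨-, C, hC⟩ := h.unifBdd_transition k
  exact ⟨C, fun κ hκ κ' hκ' x hx j hj => hC (⟨κ, hκ⟩, ⟨κ', hκ'⟩) x hx j hj⟩

end IsPRSingularityDatumOn

/-! ### Construction of charts -/

theorem isOpenEmbedding_mapsTo_restrict {X Y : Type*} [TopologicalSpace X] [TopologicalSpace Y]
    {f : X → Y} {s U : Set X} {t : Set Y} (hf : IsOpenEmbedding f) (hU : IsOpen U)
    (hs : s = U ∩ f ⁻¹' t) (h : MapsTo f s t) : IsOpenEmbedding (h.restrict f s t) := by
  refine .of_continuous_injective_isOpenMap (hf.continuous.restrict h)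
    (fun x y hxy => Subtype.ext (hf.injective (congrArg Subtype.val hxy))) fun V hV => ?_
  obtain ⟨W, hW, rfl⟩ := isOpen_induced_iff.1 hV
  refine isOpen_induced_iff.2 ⟨f '' (U ∩ W), hf.isOpenMap _ (hU.inter hW), ?_⟩
  ext ⟨y, hy⟩
  constructor
  · rintro ⟨x, ⟨hxU, hxW⟩, rfl⟩
    exact ⟨⟨x, hs ▸ ⟨hxU, hy⟩⟩, hxW, rfl⟩
  · rintro ⟨⟨x, hx⟩, hxW, hxy⟩
    exact ⟨x, ⟨(hs ▸ hx : x ∈ U ∩ f ⁻¹' t).1, hxW⟩, congrArg Subtype.val hxy⟩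

namespace Chart

variable {m n : ℕ} {M : Set (Euc n)}

/-- The part of the cube which the map `z ↦ x₀ + l z` sends to the range of the chart `κ`. -/
def subDom (κ : Chart m M) (x₀ : Euc m) (l : ℝ) : Set (Euc m) :=
  cube m ∩ (fun z => x₀ + l • z) ⁻¹' κ.dom

theorem hasFDerivAt_affine (x₀ : Euc m) (l : ℝ) (z : Euc m) :
    HasFDerivAt (fun z => x₀ + l • z) (l • ContinuousLinearMap.id ℝ (Euc m)) z :=
  ((hasFDerivAt_id z).const_smul l).const_add x₀

theorem hasFDerivWithinAt_sub (κ : Chart m M) {x₀ : Euc m} {l : ℝ} {z : Euc m}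
    (hz : z ∈ κ.subDom x₀ l) :
    HasFDerivWithinAt (fun z => κ.param (x₀ + l • z))
      (l • fderivWithin ℝ κ.param κ.dom (x₀ + l • z)) (κ.subDom x₀ l) z := by
  have h := (κ.hasFDerivWithinAt hz.2).comp z
    ((hasFDerivAt_affine x₀ l z).hasFDerivWithinAt (s := κ.subDom x₀ l)) fun z hz => hz.2
  rwa [ContinuousLinearMap.comp_smul, ContinuousLinearMap.comp_id] at h

/-- The chart with the parametrization `z ↦ i_κ (x₀ + l z)`. -/
noncomputable def sub (κ : Chart m M) (x₀ : Euc m) (l : ℝ) (hl : 0 < l)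
    (h : κ.subDom x₀ l = cube m ∨ κ.subDom x₀ l = cube m ∩ halfSpace m) : Chart m M where
  dom := κ.subDom x₀ l
  param := fun z => κ.param (x₀ + l • z)
  dom_open := ⟨cube m, isOpen_cube m, h⟩
  mapsTo := fun z hz => κ.mapsTo hz.2
  isOpenEmbedding := by
    have hA : IsOpenEmbedding (fun z : Euc m => x₀ + l • z) :=
      ((Homeomorph.smulOfNeZero l hl.ne').trans (Homeomorph.addLeft x₀)).isOpenEmbedding
    exact κ.isOpenEmbedding.comp (isOpenEmbedding_mapsTo_restrict hA (isOpen_cube m)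
      (s := κ.subDom x₀ l) rfl fun z hz => hz.2)
  smooth := κ.smooth.comp (by fun_prop) fun z hz => hz.2
  immersion := by
    intro z hz
    have hu := uniqueDiffOn_of_open_or_inter ⟨cube m, isOpen_cube m, h⟩
    rw [(κ.hasFDerivWithinAt_sub hz).fderivWithin (hu z hz)]
    intro v w hvw
    exact κ.immersion _ hz.2 (smul_right_injective _ hl.ne' hvw)

end Chart

/-! ### Coordinates on `ℝᵈ⁺¹` -/

/-- The first `d` coordinates of a point of `ℝᵈ⁺¹`. -/
noncomputable def initCLM (d : ℕ) : Euc (d + 1) →L[ℝ] Euc d :=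
  LinearMap.toContinuousLinearMap
    { toFun := fun w => WithLp.toLp 2 fun i => w i.castSucc
      map_add' := fun _ _ => rfl
      map_smul' := fun _ _ => rfl }

/-- The last coordinate of a point of `ℝᵈ⁺¹`. -/
noncomputable def lastCLM (d : ℕ) : Euc (d + 1) →L[ℝ] ℝ := EuclideanSpace.proj (Fin.last d)

/-- The inclusion `y ↦ (0, y)`. -/
noncomputable def tailIncl (n : ℕ) : Euc n →L[ℝ] Euc (n + 1) :=
  LinearMap.toContinuousLinearMap
    { toFun := fun y => consPoint 0 y
      map_add' := fun x y => by
        ext i; refine Fin.cases ?_ (fun i => ?_) i <;> simp [consPoint]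
      map_smul' := fun c y => by
        ext i; refine Fin.cases ?_ (fun i => ?_) i <;> simp [consPoint] }

/-- The projection `(t, y) ↦ y`. -/
noncomputable def tailCLM (n : ℕ) : Euc (n + 1) →L[ℝ] Euc n :=
  LinearMap.toContinuousLinearMap
    { toFun := fun x => tailPoint x
      map_add' := fun _ _ => rfl
      map_smul' := fun _ _ => rfl }

@[simp] theorem initCLM_apply {d : ℕ} (w : Euc (d + 1)) (i : Fin d) :
    initCLM d w i = w i.castSucc := rfl

@[simp] theorem lastCLM_apply {d : ℕ} (w : Euc (d + 1)) : lastCLM d w = w (Fin.last d) := rfl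

theorem tailIncl_apply {n : ℕ} (y : Euc n) : tailIncl n y = consPoint 0 y := rfl

@[simp] theorem tailPoint_consPoint {n : ℕ} (t : ℝ) (y : Euc n) : tailPoint (consPoint t y) = y :=
  rfl

theorem consPoint_eq {n : ℕ} (t : ℝ) (y : Euc n) :
    consPoint t y = t • EuclideanSpace.single 0 1 + tailIncl n y := by
  ext i; refine Fin.cases ?_ (fun i => ?_) i <;> simp [consPoint, tailIncl_apply]

theorem consPoint_smul {n : ℕ} (c t : ℝ) (y : Euc n) :
    consPoint (c * t) (c • y) = c • consPoint t y := by
  rw [consPoint_eq, consPoint_eq, map_smul, smul_add, smul_smul]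

theorem norm_consPoint_sq {n : ℕ} (t : ℝ) (y : Euc n) :
    ‖consPoint t y‖ ^ 2 = t ^ 2 + ‖y‖ ^ 2 := by
  simp [EuclideanSpace.norm_sq_eq, Fin.sum_univ_succ, consPoint]

theorem norm_sq_init_last {d : ℕ} (w : Euc (d + 1)) :
    ‖w‖ ^ 2 = ‖initCLM d w‖ ^ 2 + (lastCLM d w) ^ 2 := by
  simp [EuclideanSpace.norm_sq_eq, Fin.sum_univ_castSucc]

/-- The point of `ℝᵈ⁺¹` with given first `d` coordinates and last coordinate. -/
def snocPoint {d : ℕ} (z : Euc d) (u : ℝ) : Euc (d + 1) :=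
  WithLp.toLp 2 (Fin.snoc (fun i => z i) u)

@[simp] theorem initCLM_snocPoint {d : ℕ} (z : Euc d) (u : ℝ) : initCLM d (snocPoint z u) = z := by
  ext i; simp [snocPoint]

@[simp] theorem lastCLM_snocPoint {d : ℕ} (z : Euc d) (u : ℝ) : lastCLM d (snocPoint z u) = u := by
  simp [snocPoint]

theorem snocPoint_init_last {d : ℕ} (w : Euc (d + 1)) :
    snocPoint (initCLM d w) (lastCLM d w) = w := by
  ext i; refine Fin.lastCases ?_ (fun i => ?_) i <;> simp [snocPoint]

theorem continuous_snocPoint {d : ℕ} :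
    Continuous (fun p : Euc d × ℝ => snocPoint p.1 p.2) := by
  refine (PiLp.continuous_toLp 2 _).comp (continuous_pi fun i => ?_)
  refine Fin.lastCases ?_ (fun i => ?_) i
  · simpa using continuous_snd
  · simp only [Fin.snoc_castSucc]; fun_prop

theorem mem_cube_succ_iff {d : ℕ} {w : Euc (d + 1)} :
    w ∈ cube (d + 1) ↔ initCLM d w ∈ cube d ∧ lastCLM d w ∈ Ioo (-1 : ℝ) 1 := by
  constructor
  · exact fun h => ⟨fun i => h _, h _⟩
  · rintro ⟨h1, h2⟩ i
    exact Fin.lastCases h2 h1 i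

/-- Putting t in the last slot leaves the boundary coordinate 0 to the base. This needs a base of
dimension at least 1; over a base of dimension 0 the half-space condition on it is void. -/
theorem mem_halfSpace_succ_iff {d : ℕ} {w : Euc (d + 2)} :
    w ∈ halfSpace (d + 2) ↔ initCLM (d + 1) w ∈ halfSpace (d + 1) := by
  constructor
  · exact fun h i hi => h i.castSucc hi
  · intro h i hi
    have := h 0 rfl
    obtain rfl : i = 0 := Fin.ext hi
    exact this

/-- The homeomorphism `w ↦ (w', t₀ + a u)` for `w = (w', u)`. -/
noncomputable def splitHomeomorph (d : ℕ) (t₀ a : ℝ) (ha : a ≠ 0) : Euc (d + 1) ≃ₜ Euc d × ℝ where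
  toFun w := (initCLM d w, t₀ + a * lastCLM d w)
  invFun p := snocPoint p.1 ((p.2 - t₀) / a)
  left_inv w := by
    have : (t₀ + a * lastCLM d w - t₀) / a = lastCLM d w := by field_simp; ring
    simp only [this, snocPoint_init_last]
  right_inv p := by
    ext1
    · simp
    · simp only [lastCLM_snocPoint]; field_simp; ring
  continuous_toFun := by fun_prop
  continuous_invFun := continuous_snocPoint.comp
    (f := fun p : Euc d × ℝ => (p.1, (p.2 - t₀) / a)) (by fun_prop)

/-! ### Charts of pipes -/

namespace IsCharacteristic

variable {e : EndPoint} {R : ℝ → ℝ}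

theorem pos_of_mem_interior (hR : IsCharacteristic e R) {t : ℝ} (ht : t ∈ interior e.J) :
    0 < R t := hR.pos t (interior_subset ht)

theorem contDiffOn_interior (hR : IsCharacteristic e R) : ContDiffOn ℝ ∞ R (interior e.J) :=
  hR.smooth.mono interior_subset

theorem hasDerivAt (hR : IsCharacteristic e R) {t : ℝ} (ht : t ∈ interior e.J) :
    HasDerivAt R (deriv R t) t :=
  ((hR.contDiffOn_interior.differentiableOn (by simp) t ht).differentiableAt
    (isOpen_interior.mem_nhds ht)).hasDerivAt

theorem mem_pipe (hR : IsCharacteristic e R) {n : ℕ} {B : Set (Euc n)} {x : Euc (n + 1)}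
    (hx : x ∈ pipe e R B) :
    (stretch R x).1 ∈ interior e.J ∧ (stretch R x).2 ∈ B ∧
      consPoint (stretch R x).1 (R (stretch R x).1 • (stretch R x).2) = x := by
  obtain ⟨t, ht, y, hy, rfl⟩ := hx
  rw [stretch_consPoint (hR.pos_of_mem_interior ht)]
  exact ⟨ht, hy, rfl⟩

theorem contDiffOn_stretch (hR : IsCharacteristic e R) {n : ℕ} :
    ContDiffOn ℝ ∞ (stretch R : Euc (n + 1) → ℝ × Euc n) {x | x 0 ∈ interior e.J} := by
  have h0 : ContDiffOn ℝ ∞ (fun x : Euc (n + 1) => x 0) {x | x 0 ∈ interior e.J} :=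
    (EuclideanSpace.proj (𝕜 := ℝ) (0 : Fin (n + 1))).contDiff.contDiffOn
  exact h0.prodMk (((hR.contDiffOn_interior.comp h0 fun x hx => hx).inv
    fun x hx => (hR.pos_of_mem_interior hx).ne').smul (tailCLM n).contDiff.contDiffOn)

/-- The homeomorphism of `B × int J` onto the pipe. -/
noncomputable def pipeHomeomorph (hR : IsCharacteristic e R) {n : ℕ} (B : Set (Euc n)) :
    B × interior e.J ≃ₜ pipe e R B where
  toFun p := ⟨consPoint p.2 (R p.2 • p.1), p.2, p.2.2, p.1, p.1.2, rfl⟩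
  invFun x := (⟨(stretch R x.1).2, (hR.mem_pipe x.2).2.1⟩, ⟨(stretch R x.1).1, (hR.mem_pipe x.2).1⟩)
  left_inv p := by
    have := stretch_consPoint (hR.pos_of_mem_interior p.2.2) p.1.1
    ext1 <;> apply Subtype.ext <;> simp [this]
  right_inv x := Subtype.ext (hR.mem_pipe x.2).2.2
  continuous_toFun := by
    refine Continuous.subtype_mk ?_ _
    simp only [consPoint_eq]
    have : Continuous fun p : B × interior e.J => R p.2 :=
      (hR.contDiffOn_interior.continuousOn.domRestrict).comp continuous_snd
    have h2 := (tailIncl n).continuous.comp (this.smul (continuous_subtype_val.comp continuous_fst))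
    exact ((continuous_subtype_val.comp continuous_snd).smul continuous_const).add h2
  continuous_invFun := by
    have h : Continuous fun x : pipe e R B => stretch R x.1 :=
      hR.contDiffOn_stretch.continuousOn.comp_continuous continuous_subtype_val
        fun x => (hR.mem_pipe x.2).1
    exact (Continuous.subtype_mk (continuous_snd.comp h) _).prodMk
      (Continuous.subtype_mk (continuous_fst.comp h) _)

end IsCharacteristic

namespace Chart

variable {d n : ℕ} {B : Set (Euc n)} {e : EndPoint} {R : ℝ → ℝ}

/-- The parametrization `(z, u) ↦ (t, R(t) i_κ(z))` with `t = t₀ + a u`. -/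
noncomputable def pipeParam (R : ℝ → ℝ) (κ : Chart d B) (t₀ a : ℝ) (w : Euc (d + 1)) :
    Euc (n + 1) :=
  consPoint (t₀ + a * lastCLM d w) (R (t₀ + a * lastCLM d w) • κ.param (initCLM d w))

/-- The set `κ(U_κ) × (-1, 1)`. -/
def pipeDom (κ : Chart d B) : Set (Euc (d + 1)) :=
  {w | initCLM d w ∈ κ.dom ∧ lastCLM d w ∈ Ioo (-1 : ℝ) 1}

theorem pipeDom_open (κ : Chart d B) :
    ∃ O : Set (Euc (d + 1)), IsOpen O ∧ (κ.pipeDom = O ∨ κ.pipeDom = O ∩ halfSpace (d + 1)) := by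
  obtain ⟨O, hO, h⟩ := κ.dom_open
  refine ⟨{w | initCLM d w ∈ O ∧ lastCLM d w ∈ Ioo (-1 : ℝ) 1},
    (hO.preimage (initCLM d).continuous).inter (isOpen_Ioo.preimage (lastCLM d).continuous), ?_⟩
  rcases h with h | h
  · left; simp only [pipeDom, h]
  · cases d with
    | zero => left; simp only [pipeDom, h, halfSpace_zero, inter_univ]
    | succ d =>
      right
      ext w
      simp only [pipeDom, h, mem_inter_iff, mem_ofPred_eq, mem_halfSpace_succ_iff]
      tauto

/-- The derivative of `Chart.pipeParam`. -/
noncomputable def pipeDeriv (R : ℝ → ℝ) (κ : Chart d B) (t₀ a : ℝ) (w : Euc (d + 1)) :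
    Euc (d + 1) →L[ℝ] Euc (n + 1) :=
  (a • lastCLM d).smulRight (EuclideanSpace.single 0 1) +
    (tailIncl n) ∘L (R (t₀ + a * lastCLM d w) •
        ((fderivWithin ℝ κ.param κ.dom (initCLM d w)) ∘L (initCLM d)) +
      (deriv R (t₀ + a * lastCLM d w) • a • lastCLM d).smulRight (κ.param (initCLM d w)))

theorem pipeDeriv_apply (R : ℝ → ℝ) (κ : Chart d B) (t₀ a : ℝ) (w v : Euc (d + 1)) :
    pipeDeriv R κ t₀ a w v = consPoint (a * lastCLM d v)
      (R (t₀ + a * lastCLM d w) • fderivWithin ℝ κ.param κ.dom (initCLM d w) (initCLM d v) +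
        (deriv R (t₀ + a * lastCLM d w) * (a * lastCLM d v)) • κ.param (initCLM d w)) := by
  rw [consPoint_eq]
  rfl

theorem hasFDerivWithinAt_pipeParam (hR : IsCharacteristic e R) (κ : Chart d B) {t₀ a : ℝ}
    {w : Euc (d + 1)} (hw : w ∈ κ.pipeDom) (ht : t₀ + a * lastCLM d w ∈ interior e.J) :
    HasFDerivWithinAt (pipeParam R κ t₀ a) (pipeDeriv R κ t₀ a w) κ.pipeDom w := by
  have h0 : HasFDerivAt (fun w => t₀ + a * lastCLM d w) (a • lastCLM d) w :=
    ((lastCLM d).hasFDerivAt.const_smul a).const_add t₀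
  have h1 : HasFDerivAt (fun w => R (t₀ + a * lastCLM d w))
      (deriv R (t₀ + a * lastCLM d w) • a • lastCLM d) w :=
    (hR.hasDerivAt ht).comp_hasFDerivAt w h0
  have h2 : HasFDerivWithinAt (fun w => κ.param (initCLM d w))
      ((fderivWithin ℝ κ.param κ.dom (initCLM d w)) ∘L (initCLM d)) κ.pipeDom w :=
    (κ.hasFDerivWithinAt hw.1).comp w (initCLM d).hasFDerivWithinAt fun z hz => hz.1
  have h3 := (h0.hasFDerivWithinAt (s := κ.pipeDom)).smul_const
    (EuclideanSpace.single 0 1 : Euc (n + 1))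
  have h4 := (tailIncl n).hasFDerivAt.comp_hasFDerivWithinAt w
    ((h1.hasFDerivWithinAt (s := κ.pipeDom)).smul h2)
  refine (h3.add h4).congr_of_eventuallyEq ?_ ?_
  · exact Eventually.of_forall fun w => consPoint_eq _ _
  · exact consPoint_eq _ _

/-- The chart of the pipe with the parametrization `(z, u) ↦ (t, R(t) i_κ(z))`, `t = t₀ + a u`. -/
noncomputable def pipe (hR : IsCharacteristic e R) (κ : Chart d B) (t₀ a : ℝ) (ha : 0 < a)
    (hJ : ∀ u ∈ Ioo (-1 : ℝ) 1, t₀ + a * u ∈ interior e.J) : Chart (d + 1) (_root_.pipe e R B) where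
  dom := κ.pipeDom
  param := pipeParam R κ t₀ a
  dom_open := κ.pipeDom_open
  mapsTo := fun w hw => ⟨_, hJ _ hw.2, _, κ.mapsTo hw.1, rfl⟩
  isOpenEmbedding := by
    have hm : MapsTo (splitHomeomorph d t₀ a ha.ne') κ.pipeDom (κ.dom ×ˢ interior e.J) :=
      fun w hw => ⟨hw.1, hJ _ hw.2⟩
    have h1 := isOpenEmbedding_mapsTo_restrict (splitHomeomorph d t₀ a ha.ne').isOpenEmbedding
      (isOpen_Ioo.preimage (lastCLM d).continuous : IsOpen (lastCLM d ⁻¹' Ioo (-1 : ℝ) 1))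
      (s := κ.pipeDom) (t := κ.dom ×ˢ interior e.J) (by
        ext w
        exact ⟨fun hw => ⟨hw.2, hm hw⟩, fun hw => ⟨hw.2.1, hw.1⟩⟩) hm
    have h2 := (κ.isOpenEmbedding.prodMap (IsOpenEmbedding.id (X := interior e.J))).comp
      ((Homeomorph.Set.prod κ.dom (interior e.J)).isOpenEmbedding.comp h1)
    exact (hR.pipeHomeomorph B).isOpenEmbedding.comp h2
  smooth := by
    have hl : ContDiffOn ℝ ∞ (fun w => t₀ + a * lastCLM d w) κ.pipeDom := by fun_prop
    have h1 : ContDiffOn ℝ ∞ (fun w => R (t₀ + a * lastCLM d w)) κ.pipeDom :=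
      hR.contDiffOn_interior.comp hl fun w hw => hJ _ hw.2
    have h2 : ContDiffOn ℝ ∞ (fun w => κ.param (initCLM d w)) κ.pipeDom :=
      κ.smooth.comp (initCLM d).contDiff.contDiffOn fun w hw => hw.1
    refine ((hl.smul contDiffOn_const).add
      ((tailIncl n).contDiff.comp_contDiffOn (h1.smul h2))).congr fun w _ => consPoint_eq _ _
  immersion := by
    intro w hw
    have hu := uniqueDiffOn_of_open_or_inter κ.pipeDom_open
    rw [(hasFDerivWithinAt_pipeParam hR κ hw (hJ _ hw.2)).fderivWithin (hu w hw),
      injective_iff_map_eq_zero]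
    intro v hv
    rw [pipeDeriv_apply] at hv
    -- The derivative is triangular: the component along the axis kills the t-direction, and then
    -- the tail kills the base directions.
    have h0 : a * lastCLM d v = 0 := congrArg (fun x : Euc (n + 1) => x 0) hv
    have h1 := congrArg tailPoint hv
    have hpos := hR.pos_of_mem_interior (hJ _ hw.2)
    rw [tailPoint_consPoint, h0, mul_zero, zero_smul, add_zero] at h1
    have h2 : fderivWithin ℝ κ.param κ.dom (initCLM d w) (initCLM d v) = 0 :=
      (smul_eq_zero.1 (h1.trans (map_zero (tailCLM n)))).resolve_left hpos.ne'
    have h3 := (injective_iff_map_eq_zero _).1 (κ.immersion _ hw.1) _ h2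
    rw [← snocPoint_init_last v, h3, (mul_eq_zero.1 h0).resolve_left ha.ne',
      ← map_zero (initCLM d), ← map_zero (lastCLM d), snocPoint_init_last]

theorem IsNormalized.pipe {hR : IsCharacteristic e R} {κ : Chart d B} {t₀ a : ℝ} {ha : 0 < a}
    {hJ : ∀ u ∈ Ioo (-1 : ℝ) 1, t₀ + a * u ∈ interior e.J} (h : κ.IsNormalized) :
    (κ.pipe hR t₀ a ha hJ).IsNormalized := by
  rcases h with h | h
  · left
    ext w
    simp only [Chart.pipe, pipeDom, h, mem_ofPred_eq, mem_cube_succ_iff]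
  · cases d with
    | zero =>
      left
      ext w
      simp only [Chart.pipe, pipeDom, h, mem_ofPred_eq, mem_cube_succ_iff, halfSpace_zero, inter_univ]
    | succ d =>
      right
      ext w
      simp only [Chart.pipe, pipeDom, h, mem_ofPred_eq, mem_cube_succ_iff, mem_inter_iff,
        mem_halfSpace_succ_iff]
      tauto

end Chart

/-! ### Intervals and characteristics -/

namespace EndPoint

theorem interior_J_zero : interior EndPoint.zero.J = Ioo 0 1 := by simp [J]

theorem interior_J_infty : interior EndPoint.infty.J = Ioi 1 := by simp [J]

theorem convex_J (e : EndPoint) : Convex ℝ e.J := by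
  cases e
  · exact convex_Ioc 0 1
  · exact convex_Ici 1

theorem convex_interior_J (e : EndPoint) : Convex ℝ (interior e.J) := e.convex_J.interior

theorem uniqueDiffOn_J (e : EndPoint) : UniqueDiffOn ℝ e.J := by
  refine uniqueDiffOn_convex e.convex_J ?_
  cases e
  · exact ⟨1 / 2, by rw [interior_J_zero]; norm_num⟩
  · exact ⟨2, by rw [interior_J_infty]; norm_num⟩

/-- The cofinal subinterval `(0, 1/2]` of `(0, 1]`, respectively `[2, ∞)` of `[1, ∞)`. -/
def core : EndPoint → Set ℝ
  | zero => Ioc 0 (1 / 2)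
  | infty => Ici 2

theorem core_subset (e : EndPoint) : e.core ⊆ interior e.J := by
  cases e
  · rw [interior_J_zero]
    exact fun t ht => ⟨ht.1, by linarith [ht.2]⟩
  · rw [interior_J_infty]
    exact fun t ht => lt_of_lt_of_le one_lt_two (mem_Ici.1 ht)

theorem isCofinalInterval_core (e : EndPoint) : IsCofinalInterval e e.core := by
  refine ⟨?_, e.core_subset.trans interior_subset, ?_, ?_⟩
  · cases e
    · exact ordConnected_Ioc
    · exact ordConnected_Ici
  · cases e <;> norm_num [core]
  · cases e
    · have : EndPoint.zero.J \ interior EndPoint.zero.core = Icc (1 / 2) 1 := by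
        ext t
        simp only [J, core, interior_Ioc, Set.mem_sdiff, mem_Ioc, mem_Ioo, mem_Icc, not_and, not_lt]
        constructor
        · exact fun h => ⟨h.2 h.1.1, h.1.2⟩
        · exact fun h => ⟨⟨by linarith, h.2⟩, fun _ => h.1⟩
      rw [this]
      exact ⟨ordConnected_Icc, isCompact_Icc⟩
    · have : EndPoint.infty.J \ interior EndPoint.infty.core = Icc 1 2 := by
        ext t
        simp only [J, core, interior_Ici, Set.mem_sdiff, mem_Ici, mem_Ioi, mem_Icc, not_lt]
      rw [this]
      exact ⟨ordConnected_Icc, isCompact_Icc⟩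

/-- Over these t there is room for charts that avoid the part of the pipe lying over the core. -/
theorem isOpen_diff_core (e : EndPoint) :
    IsOpen (interior e.J \ e.core) := by
  cases e
  · have : interior EndPoint.zero.J \ EndPoint.zero.core = Ioo (1 / 2) 1 := by
      ext t
      simp only [interior_J_zero, core, Set.mem_sdiff, mem_Ioc, mem_Ioo, not_and, not_le]
      constructor
      · exact fun h => ⟨h.2 h.1.1, h.1.2⟩
      · exact fun h => ⟨⟨by linarith, h.2⟩, fun _ => h.1⟩
    rw [this]
    exact isOpen_Ioo
  · exact isOpen_interior.sdiff isClosed_Ici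

end EndPoint

/-- The properties of a characteristic `R` and its weight `r` on which the construction of charts
of the pipe depends. -/
structure IsPipeWeight (e : EndPoint) (R r : ℝ → ℝ) : Prop where
  char : IsCharacteristic e R
  smooth : ContDiffOn ℝ ∞ r (interior e.J)
  pos : ∀ t ∈ interior e.J, 0 < r t
  unifBdd_deriv_char : ∀ k, UnifBdd k (fun _ : Unit => interior e.J) (fun _ => deriv R)
  unifBdd_deriv : ∀ k, UnifBdd k (fun _ : Unit => interior e.J) (fun _ => deriv r)
  le_const : ∃ C, ∀ t ∈ interior e.J, r t ≤ C
  le_char : ∃ C, ∀ t ∈ interior e.J, r t ≤ C * R t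
  room : ∃ δ, 0 < δ ∧ ∀ t ∈ e.core, ∀ s, |s - t| ≤ δ * r t → s ∈ interior e.J

/-- Only R', not R, is asserted to be bounded: a funnel characteristic may tend to ∞. -/
theorem unifBdd_deriv_of_iteratedDerivWithin {e : EndPoint} {R : ℝ → ℝ}
    (hR : ContDiffOn ℝ ∞ R e.J)
    (h : ∀ k : ℕ, 1 ≤ k → ∃ c : ℝ, ∀ t ∈ e.J, |iteratedDerivWithin k R e.J t| ≤ c) (k : ℕ) :
    UnifBdd k (fun _ : Unit => interior e.J) (fun _ => deriv R) := by
  refine ⟨fun _ => (hR.mono interior_subset).deriv_of_isOpen isOpen_interior (by simp), ?_⟩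
  obtain ⟨C, hC⟩ := exists_forall_le_of_forall_exists
    (P := fun j C => ∀ t ∈ e.J, |iteratedDerivWithin (j + 1) R e.J t| ≤ C)
    (fun j C C' hCC' hC t ht => (hC t ht).trans hCC') (fun j => h (j + 1) (by omega)) k
  refine ⟨C, fun _ t ht j hj => ?_⟩
  rw [norm_iteratedFDerivWithin_eq_norm_iteratedDerivWithin,
    iteratedDerivWithin_of_isOpen isOpen_interior ht, ← iteratedDeriv_succ',
    ← iteratedDerivWithin_eq_iteratedDeriv e.uniqueDiffOn_J ?_ (interior_subset ht)]
  · exact hC j hj t (interior_subset ht)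
  · exact (hR.contDiffAt (mem_interior_iff_mem_nhds.1 ht)).of_le (by exact_mod_cast le_top)

theorem exists_pos_le_of_continuousOn {K : Set ℝ} {R : ℝ → ℝ} (hK : IsCompact K)
    (hR : ContinuousOn R K) (hpos : ∀ t ∈ K, 0 < R t) : ∃ c, 0 < c ∧ ∀ t ∈ K, c ≤ R t := by
  rcases K.eq_empty_or_nonempty with rfl | hne
  · exact ⟨1, one_pos, by simp⟩
  · obtain ⟨t, ht, hmin⟩ := hK.exists_isMinOn hne hR
    exact ⟨R t, hpos t ht, fun s hs => hmin hs⟩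

theorem exists_lipschitz_of_deriv_bound {V : Set ℝ} {R : ℝ → ℝ} (hV : IsOpen V)
    (hc : Convex ℝ V) (hR : ContDiffOn ℝ ∞ R V)
    (h : UnifBdd 0 (fun _ : Unit => V) (fun _ => deriv R)) :
    ∃ L, 0 < L ∧ ∀ s ∈ V, ∀ t ∈ V, |R s - R t| ≤ L * |s - t| := by
  obtain ⟨L, hL, hb⟩ := h.exists_bound
  refine ⟨L, hL, fun s hs t ht => ?_⟩
  exact hc.norm_image_sub_le_of_norm_deriv_le
    (fun x hx => (hR.differentiableOn (by simp) x hx).differentiableAt (hV.mem_nhds hx))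
    (fun x hx => hb () x hx) ht hs

namespace IsCuspCharacteristic

variable {e : EndPoint} {R : ℝ → ℝ}

/-- With L a Lipschitz constant, R(t) > L t for some t would keep R above the positive number R(t) -
L t on (0, t). By compactness R is also bounded below on [t, 1], so 1/R would be bounded on (0, 1],
contradicting the divergence of its integral. -/
theorem exists_le_mul_of_zero (hR : IsCuspCharacteristic EndPoint.zero R) :
    ∃ L, 0 < L ∧ ∀ t ∈ Ioo (0 : ℝ) 1, R t ≤ L * t := by
  obtain ⟨L, hL, hLip⟩ := exists_lipschitz_of_deriv_bound isOpen_interior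
    (EndPoint.convex_interior_J _) hR.characteristic.contDiffOn_interior
    (unifBdd_deriv_of_iteratedDerivWithin hR.characteristic.smooth hR.deriv_bound 0)
  rw [EndPoint.interior_J_zero] at hLip
  refine ⟨L, hL, fun t ht => ?_⟩
  by_contra! hlt
  have h1 : ∀ s ∈ Ioo 0 t, R t - L * t ≤ R s := by
    intro s hs
    have := (abs_le.1 (hLip t ht s ⟨hs.1, hs.2.trans ht.2⟩)).2
    rw [abs_of_pos (by linarith [hs.2] : 0 < t - s)] at this
    nlinarith [hs.1]
  obtain ⟨c, hc, h2⟩ := exists_pos_le_of_continuousOn (isCompact_Icc (a := t) (b := 1))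
    (hR.characteristic.smooth.continuousOn.mono fun s hs => ⟨ht.1.trans_le hs.1, hs.2⟩)
    (fun s hs => hR.characteristic.pos s ⟨ht.1.trans_le hs.1, hs.2⟩)
  set c' := min c (R t - L * t)
  have hc' : 0 < c' := lt_min hc (by linarith)
  have h3 : ∀ s ∈ EndPoint.zero.J, c' ≤ R s := by
    intro s hs
    rcases lt_or_ge s t with h | h
    · exact (min_le_right _ _).trans (h1 s ⟨hs.1, h⟩)
    · exact (min_le_left _ _).trans (h2 s ⟨h, hs.2⟩)
  have h4 : ∫⁻ s in EndPoint.zero.J, ENNReal.ofReal (1 / R s)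
      ≤ ∫⁻ _ in EndPoint.zero.J, ENNReal.ofReal (1 / c') := by
    refine setLIntegral_mono measurable_const fun s hs => ENNReal.ofReal_le_ofReal ?_
    exact one_div_le_one_div_of_le hc' (h3 s hs)
  rw [hR.integral] at h4
  simp [EndPoint.J] at h4

theorem exists_le_of_infty (hR : IsCuspCharacteristic EndPoint.infty R) :
    ∃ C, 0 < C ∧ ∀ t ∈ EndPoint.infty.J, R t ≤ C := by
  have h := hR.limit_zero rfl
  obtain ⟨a, ha⟩ := eventually_atTop.1 (h.eventually (gt_mem_nhds one_pos))
  obtain ⟨C, hC⟩ := (isCompact_Icc (a := (1 : ℝ)) (b := a)).exists_bound_of_continuousOn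
    (hR.characteristic.smooth.continuousOn.mono fun s hs => mem_Ici.2 hs.1)
  refine ⟨max C 1, by positivity, fun t ht => ?_⟩
  rcases le_total a t with h | h
  · exact (ha t h).le.trans (le_max_right _ _)
  · exact ((le_abs_self _).trans (hC t ⟨ht, h⟩)).trans (le_max_left _ _)

theorem isPipeWeight (hR : IsCuspCharacteristic e R) : IsPipeWeight e R R := by
  have hu := unifBdd_deriv_of_iteratedDerivWithin hR.characteristic.smooth hR.deriv_bound
  refine ⟨hR.characteristic, hR.characteristic.contDiffOn_interior,
    fun t ht => hR.characteristic.pos_of_mem_interior ht, hu, hu, ?_,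
    ⟨1, fun t _ => by simp⟩, ?_⟩
  · cases e with
    | zero =>
      obtain ⟨L, hL, h⟩ := hR.exists_le_mul_of_zero
      refine ⟨L, fun t ht => ?_⟩
      rw [EndPoint.interior_J_zero] at ht
      nlinarith [h t ht, ht.2]
    | infty =>
      obtain ⟨C, -, h⟩ := hR.exists_le_of_infty
      exact ⟨C, fun t ht => h t (interior_subset ht)⟩
  · cases e with
    | zero =>
      obtain ⟨L, hL, h⟩ := hR.exists_le_mul_of_zero
      -- Then |s - t| ≤ t/2, so s lies between t/2 and 3t/2 ≤ 3/4.
      refine ⟨1 / (2 * L), by positivity, fun t ht s hs => ?_⟩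
      rw [EndPoint.interior_J_zero]
      have h1 := h t ⟨ht.1, by linarith [ht.2]⟩
      have h2 : 1 / (2 * L) * R t ≤ t / 2 := by
        calc 1 / (2 * L) * R t ≤ 1 / (2 * L) * (L * t) := by gcongr
          _ = t / 2 := by field_simp
      have h3 := abs_le.1 (hs.trans h2)
      have h4 := ht.1
      have h5 := ht.2
      exact ⟨by linarith [h3.1], by linarith [h3.2]⟩
    | infty =>
      obtain ⟨C, hC, h⟩ := hR.exists_le_of_infty
      -- Then |s - t| ≤ 1/2, so t ≥ 2 gives s ≥ 3/2.
      refine ⟨1 / (2 * C), by positivity, fun t ht s hs => ?_⟩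
      rw [EndPoint.interior_J_infty]
      have ht' : (2 : ℝ) ≤ t := ht
      have h1 := h t (by linarith : (1 : ℝ) ≤ t)
      have h2 : 1 / (2 * C) * R t ≤ 1 / 2 := by
        calc 1 / (2 * C) * R t ≤ 1 / (2 * C) * C := by gcongr
          _ = 1 / 2 := by field_simp
      have h3 := abs_le.1 (hs.trans h2)
      exact mem_Ioi.2 (by linarith [h3.1])

end IsCuspCharacteristic

theorem IsFunnelCharacteristic.isPipeWeight {R : ℝ → ℝ} (hR : IsFunnelCharacteristic R) :
    IsPipeWeight EndPoint.infty R (fun _ => 1) := by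
  refine ⟨hR.characteristic, contDiffOn_const, fun _ _ => one_pos,
    unifBdd_deriv_of_iteratedDerivWithin hR.characteristic.smooth hR.deriv_bound, fun k => ?_,
    ⟨1, fun _ _ => le_rfl⟩, ?_, ⟨1 / 2, by norm_num, fun t ht s hs => ?_⟩⟩
  · simpa using UnifBdd.const (ι := Unit) (s := fun _ => interior EndPoint.infty.J) (k := k)
      (c := fun _ => (0 : ℝ)) ⟨0, by simp⟩
  · obtain ⟨l, hl, hlim⟩ := hR.limit_pos
    -- The limit may be ∞; a number strictly below it is finite and still bounds R from below near
    -- ∞.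
    obtain ⟨c, hc0, hcl⟩ := exists_between hl
    obtain ⟨a, ha⟩ := eventually_atTop.1 (hlim.eventually (lt_mem_nhds hcl))
    obtain ⟨c₂, hc₂, h2⟩ := exists_pos_le_of_continuousOn (isCompact_Icc (a := (1 : ℝ)) (b := a))
      (hR.characteristic.smooth.continuousOn.mono fun s hs => mem_Ici.2 hs.1)
      (fun s hs => hR.characteristic.pos s (mem_Ici.2 hs.1))
    have hct : c ≠ ⊤ := ne_top_of_lt hcl
    have hc : 0 < c.toReal := ENNReal.toReal_pos hc0.ne' hct
    refine ⟨1 / min c.toReal c₂, fun t ht => ?_⟩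
    have hmin : 0 < min c.toReal c₂ := lt_min hc hc₂
    rw [one_div, le_inv_mul_iff₀ hmin, mul_one]
    have ht' : (1 : ℝ) ≤ t := interior_subset ht
    rcases le_total a t with h | h
    · refine (min_le_left _ _).trans ?_
      exact (ENNReal.lt_ofReal_iff_toReal_lt hct).1 (ha t h) |>.le
    · exact (min_le_right _ _).trans (h2 t ⟨ht', h⟩)
  · rw [EndPoint.interior_J_infty]
    have ht' : (2 : ℝ) ≤ t := ht
    have h3 := abs_le.1 hs
    exact mem_Ioi.2 (by linarith [h3.1])

theorem isPipeWeight_weight {e : EndPoint} {R : ℝ → ℝ}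
    (hR : IsCuspCharacteristic e R ∨ (e = EndPoint.infty ∧ IsFunnelCharacteristic R)) :
    IsPipeWeight e R (weight e R) := by
  by_cases h : IsCuspCharacteristic e R
  · rw [weight, if_pos h]
    exact h.isPipeWeight
  · obtain ⟨rfl, hF⟩ := hR.resolve_left h
    rw [weight, if_neg h]
    exact hF.isPipeWeight

/-! ### Coverings with bounded multiplicity -/

/-- A maximal subset of `I` whose points are separated relative to the scale function `a`. -/
theorem exists_maximal_separated (I : Set ℝ) (a : ℝ → ℝ) :
    ∃ T ⊆ I, (∀ s ∈ T, ∀ t ∈ T, s ≠ t → a s / 2 ≤ |s - t|) ∧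
      ∀ t ∈ I, 0 < a t → ∃ s ∈ T, |t - s| < a t / 2 ∨ |t - s| < a s / 2 := by
  obtain ⟨T, hT⟩ := zorn_subset
    {T : Set ℝ | T ⊆ I ∧ ∀ s ∈ T, ∀ t ∈ T, s ≠ t → a s / 2 ≤ |s - t|} (by
      intro c hc hchain
      refine ⟨⋃₀ c, ⟨sUnion_subset fun T hT => (hc hT).1, ?_⟩, fun T hT => subset_sUnion_of_mem hT⟩
      rintro s ⟨T₁, hT₁, hs⟩ t ⟨T₂, hT₂, ht⟩ hst
      rcases hchain.total hT₁ hT₂ with h | h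
      · exact (hc hT₂).2 s (h hs) t ht hst
      · exact (hc hT₁).2 s hs t (h ht) hst)
  refine ⟨T, hT.prop.1, hT.prop.2, fun t ht hat => ?_⟩
  by_contra! hcon
  have hmem : t ∉ T := fun h => by
    have := (hcon t h).1
    rw [sub_self, abs_zero] at this
    linarith
  -- An uncovered t is separated from `T` with respect to both scales, so adding it would contradict
  -- maximality.
  refine hmem (hT.le_of_ge (y := insert t T) ⟨insert_subset ht hT.prop.1, ?_⟩
    (subset_insert t T) (mem_insert t T))
  rintro s (rfl | hs) u (rfl | hu) hsu
  · exact absurd rfl hsu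
  · exact (hcon u hu).1
  · rw [abs_sub_comm]; exact (hcon s hs).2
  · exact hT.prop.2 s hs u hu hsu

/-- A covering of `I` by intervals `(s - a s, s + a s)` of bounded multiplicity, for a slowly varying
scale function `a`. -/
theorem exists_interval_cover {V I : Set ℝ} (hIV : I ⊆ V) {a : ℝ → ℝ} (ha : ∀ t ∈ V, 0 < a t)
    (hLip : ∀ s ∈ V, ∀ t ∈ V, |a s - a t| ≤ 1 / 10 * |s - t|) :
    ∃ T ⊆ I, (∀ t ∈ I, ∃ s ∈ T, |t - s| < 3 / 4 * a s) ∧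
      ∀ p ∈ V, ∃ F : Finset ℝ, F.card ≤ 16 ∧ ∀ s ∈ T, |p - s| < a s → s ∈ F := by
  obtain ⟨T, hTI, hsep, hcov⟩ := exists_maximal_separated I a
  refine ⟨T, hTI, fun t ht => ?_, fun p hp => ?_⟩
  · obtain ⟨s, hs, h⟩ := hcov t ht (ha t (hIV ht))
    refine ⟨s, hs, ?_⟩
    have h1 := (abs_le.1 (hLip t (hIV ht) s (hIV (hTI hs)))).2
    have h2 := ha s (hIV (hTI hs))
    -- If |t - s| < a(t)/2, the Lipschitz bound gives |t - s| < (10/19) a(s), which is below (3/4)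
    -- a(s).
    rcases h with h | h <;> linarith
  · have hc := ha p hp
    set N : Set ℝ := {s ∈ T | |p - s| < a s}
    have hN : ∀ s ∈ N, |p - s| < 2 * a p ∧ a p / 2 ≤ a s := by
      intro s hs
      have h1 := abs_le.1 (hLip p hp s (hIV (hTI hs.1)))
      have h2 := hs.2
      have h3 := ha s (hIV (hTI hs.1))
      constructor <;> linarith [h1.1, h1.2]
    -- The nodes near p lie within 2 a(p) of p and are a(p)/4 apart. Cutting that interval into 16
    -- cells of length a(p)/4 leaves at most one node in each.
    set φ : ℝ → ℤ := fun s => ⌊(s - p) / (a p / 4)⌋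
    have hmaps : MapsTo φ N (Finset.Ico (-8 : ℤ) 8 : Finset ℤ) := by
      intro s hs
      have h := abs_lt.1 (hN s hs).1
      simp only [φ, Finset.coe_Ico, mem_Ico, Int.le_floor, Int.floor_lt]
      rw [le_div_iff₀ (by positivity), div_lt_iff₀ (by positivity)]
      push_cast
      constructor <;> linarith [h.1, h.2]
    have hinj : InjOn φ N := by
      intro s hs t ht hst
      by_contra hne
      have h1 := Int.abs_sub_lt_one_of_floor_eq_floor hst
      rw [← sub_div, abs_div, abs_of_pos (by positivity : 0 < a p / 4), div_lt_one (by positivity)]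
        at h1
      have h2 := hsep s hs.1 t ht.1 hne
      have h3 := (hN s hs).2
      have h4 : s - p - (t - p) = s - t := by ring
      rw [h4] at h1
      linarith
    have hfin : N.Finite := Set.Finite.of_injOn hmaps hinj (Finset.finite_toSet _)
    refine ⟨hfin.toFinset, ?_, fun s hs hps => by simpa using ⟨hs, hps⟩⟩
    have := Finset.card_le_card_of_injOn (s := hfin.toFinset) (t := Finset.Ico (-8 : ℤ) 8) φ
      (fun s hs => hmaps (by simpa using hs)) (fun s hs t ht => hinj (by simpa using hs)
        (by simpa using ht))
    simpa using this

/-! ### Grids of small cubes in the ranges of normalized charts -/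

/-- The grid points of mesh size `l / 2`. -/
noncomputable def gridPoint {d : ℕ} (l : ℝ) (k : Fin d → ℤ) : Euc d :=
  WithLp.toLp 2 fun i => l / 2 * k i

@[simp] theorem gridPoint_apply {d : ℕ} (l : ℝ) (k : Fin d → ℤ) (i : Fin d) :
    gridPoint l k i = l / 2 * k i := rfl

theorem exists_finset_grid {d : ℕ} {l : ℝ} (hl : 0 < l) (x : Euc d) :
    ∃ F : Finset (Fin d → ℤ), F.card ≤ 4 ^ d ∧
      ∀ k, ∀ z ∈ cube d, gridPoint l k + l • z = x → k ∈ F := by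
  -- Coordinatewise k = 2x/l - 2z with |2z| < 2, which leaves four integers around the floor of
  -- 2x/l.
  refine ⟨Fintype.piFinset fun i => Finset.Icc (⌊2 * x i / l⌋ - 1) (⌊2 * x i / l⌋ + 2), ?_, ?_⟩
  · rw [Fintype.card_piFinset]
    refine le_of_eq ?_
    have : ∀ i : Fin d, (Finset.Icc (⌊2 * x i / l⌋ - 1) (⌊2 * x i / l⌋ + 2)).card = 4 := by
      intro i
      rw [Int.card_Icc]
      ring_nf
      rfl
    simp [this]
  · intro k z hz hx
    refine Fintype.mem_piFinset.2 fun i => ?_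
    have h1 : 2 * x i / l = k i + 2 * z i := by
      rw [← hx]
      simp only [PiLp.add_apply, gridPoint_apply, PiLp.smul_apply, smul_eq_mul]
      field_simp
    have h2 := hz i
    have h3 := Int.floor_le (2 * x i / l)
    have h4 := Int.lt_floor_add_one (2 * x i / l)
    rw [h1] at h3 h4 ⊢
    rw [Finset.mem_Icc]
    constructor
    · have : (⌊(k i : ℝ) + 2 * z i⌋ : ℝ) < k i + 2 := by linarith [h2.2]
      have : ⌊(k i : ℝ) + 2 * z i⌋ < k i + 2 := by exact_mod_cast this
      omega
    · have : (k i : ℝ) < ⌊(k i : ℝ) + 2 * z i⌋ + 3 := by linarith [h2.1]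
      have : k i < ⌊(k i : ℝ) + 2 * z i⌋ + 3 := by exact_mod_cast this
      omega

namespace Chart

variable {d n : ℕ} {M : Set (Euc n)}

theorem affine_mem_cube {x₀ z : Euc d} {l : ℝ} (hl : 0 < l) (hx₀ : ∀ i, |x₀ i| + l ≤ 1)
    (hz : z ∈ cube d) : x₀ + l • z ∈ cube d := by
  intro i
  have h1 := hx₀ i
  have h2 := neg_abs_le (x₀ i)
  have h3 := le_abs_self (x₀ i)
  have h4 := hz i
  simp only [PiLp.add_apply, PiLp.smul_apply, smul_eq_mul, mem_Ioo]
  constructor <;> nlinarith [h4.1, h4.2]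

theorem mem_smul_of_forall_abs_lt {D : Set (Euc d)} (hD : D = cube d ∨ D = cube d ∩ halfSpace d)
    {τ : ℝ} (hτ : 0 < τ) {z : Euc d} (hz : z ∈ D) (hzτ : ∀ i, |z i| < τ) : z ∈ τ • D := by
  have hc : τ⁻¹ • z ∈ cube d := fun i => by
    rw [PiLp.smul_apply, smul_eq_mul]
    refine abs_lt.1 ?_
    rw [abs_mul, abs_inv, abs_of_pos hτ, inv_mul_lt_iff₀ hτ, mul_one]
    exact hzτ i
  refine ⟨τ⁻¹ • z, ?_, smul_inv_smul₀ hτ.ne' z⟩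
  rcases hD with rfl | rfl
  · exact hc
  · refine ⟨hc, fun i hi => ?_⟩
    have := hz.2 i hi
    rw [PiLp.smul_apply, smul_eq_mul]
    positivity

/-- A point of the range of a normalized chart which is close to a grid point lies in a cube, or in
a half-cube, around a grid point. -/
theorem exists_grid_of_near {κ : Chart d M} (hκ : κ.IsNormalized) {l τ : ℝ}
    (hl : 0 < l) (hl1 : l ≤ 1) {x : Euc d} (hx : x ∈ κ.dom) {c : Fin d → ℤ}
    (hc : ∀ i, |x i - l / 2 * c i| < τ * l) (hc1 : ∀ i, |l / 2 * c i| + l ≤ 1)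
    (hc2 : ∀ i, τ * l ≤ x i → 2 ≤ c i) :
    ∃ k : Fin d → ℤ, (κ.subDom (gridPoint l k) l = cube d ∨
        κ.subDom (gridPoint l k) l = cube d ∩ halfSpace d) ∧
      ∃ z : Euc d, (∀ i, |z i| < τ) ∧ gridPoint l k + l • z = x := by
  have key : ∀ k : Fin d → ℤ, (∀ i, |x i - l / 2 * k i| < τ * l) →
      ∃ z : Euc d, (∀ i, |z i| < τ) ∧ gridPoint l k + l • z = x := by
    intro k hk
    refine ⟨l⁻¹ • (x - gridPoint l k), fun i => ?_, ?_⟩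
    · rw [PiLp.smul_apply, smul_eq_mul, abs_mul, abs_inv, abs_of_pos hl, inv_mul_lt_iff₀ hl,
        mul_comm l]
      exact hk i
    · rw [smul_inv_smul₀ hl.ne']; abel
  rcases hκ with hd | hd
  · refine ⟨c, Or.inl (inter_eq_left.2 fun z hz => ?_), key c hc⟩
    rw [mem_preimage, hd]
    exact affine_mem_cube hl hc1 hz
  · have hxh : ∀ i : Fin d, i.val = 0 → 0 ≤ x i := by
      rw [hd] at hx
      exact hx.2
    by_cases hcase : ∃ i : Fin d, i.val = 0 ∧ x i < τ * l
    · obtain ⟨i₀, hi₀, hxi₀⟩ := hcase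
      -- Near the boundary face the grid point is moved onto the face, so that its cube meets the
      -- range in a half-cube. Away from the face `hc2` puts the grid point at distance at least l,
      -- so that its cube stays inside.
      set k : Fin d → ℤ := fun i => if i.val = 0 then 0 else c i
      have hk0 : ∀ i : Fin d, i.val = 0 → gridPoint l k i = 0 := by
        intro i hi; simp [k, hi]
      refine ⟨k, Or.inr ?_, key k fun i => ?_⟩
      · ext z
        simp only [subDom, mem_inter_iff, mem_preimage, hd]
        have hh : gridPoint l k + l • z ∈ halfSpace d ↔ z ∈ halfSpace d := by
          refine forall₂_congr fun i hi => ?_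
          rw [PiLp.add_apply, hk0 i hi, zero_add, PiLp.smul_apply, smul_eq_mul,
            mul_nonneg_iff_of_pos_left hl]
        rw [hh]
        refine ⟨fun h => ⟨h.1, h.2.2⟩, fun h => ⟨h.1, affine_mem_cube hl (fun i => ?_) h.1, h.2⟩⟩
        by_cases hi : i.val = 0
        · rw [hk0 i hi, abs_zero, zero_add]
          exact hl1
        · simp only [gridPoint_apply, k, hi, if_false]
          exact hc1 i
      · by_cases hi : i.val = 0
        · obtain rfl : i = i₀ := Fin.ext (hi.trans hi₀.symm)
          simp only [k, hi, if_true, Int.cast_zero, mul_zero, sub_zero]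
          rw [abs_of_nonneg (hxh i hi)]
          exact hxi₀
        · simp only [k, hi, if_false]
          exact hc i
    · push Not at hcase
      refine ⟨c, Or.inl (inter_eq_left.2 fun z hz => ?_), key c hc⟩
      rw [mem_preimage, hd]
      refine ⟨affine_mem_cube hl hc1 hz, fun i hi => ?_⟩
      have h7 : (2 : ℝ) ≤ c i := by exact_mod_cast hc2 i (hcase i hi)
      have h8 := (hz i).1
      simp only [PiLp.add_apply, gridPoint_apply, PiLp.smul_apply, smul_eq_mul]
      nlinarith

theorem mem_subDom_of_affine_eq {κ : Chart d M} {x₀ x z : Euc d} {l : ℝ} (hx : x ∈ κ.dom)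
    (hz : ∀ i, |z i| < 1) (h : x₀ + l • z = x) : z ∈ κ.subDom x₀ l :=
  ⟨fun i => abs_lt.1 (hz i), by rw [mem_preimage, h]; exact hx⟩

/-- The shrunken grid cubes cover the shrunken range of a chart. -/
theorem exists_grid_cover_shrunk {κ : Chart d M} (hκ : κ.IsNormalized) {r l : ℝ} (hr : 0 < r)
    (hr1 : r < 1) (hl : 0 < l) (hlr : l ≤ (1 - r) / 2) {x : Euc d} (hx : x ∈ r • κ.dom) :
    ∃ k : Fin d → ℤ, (κ.subDom (gridPoint l k) l = cube d ∨
        κ.subDom (gridPoint l k) l = cube d ∩ halfSpace d) ∧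
      ∃ z ∈ (4 / 5 : ℝ) • κ.subDom (gridPoint l k) l, gridPoint l k + l • z = x := by
  have hxd : x ∈ κ.dom := by
    obtain ⟨y, hy, rfl⟩ := hx
    exact hκ.convex.smul_mem_of_zero_mem hκ.zero_mem hy ⟨hr.le, hr1.le⟩
  have hxr : ∀ i, |x i| ≤ r := by
    obtain ⟨y, hy, rfl⟩ := hx
    intro i
    have := (abs_lt.2 (hκ.dom_subset hy i)).le
    simp only [PiLp.smul_apply, smul_eq_mul]
    rw [abs_mul, abs_of_pos hr]
    nlinarith
  -- Rounding to the nearest grid point: the spacing is l/2, so the error is at most l/4.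
  have hfl : ∀ i, |x i - l / 2 * (⌊2 * x i / l + 1 / 2⌋ : ℤ)| ≤ 1 / 4 * l := by
    intro i
    have h3 := Int.floor_le (2 * x i / l + 1 / 2)
    have h4 := Int.lt_floor_add_one (2 * x i / l + 1 / 2)
    set q : ℝ := ((⌊2 * x i / l + 1 / 2⌋ : ℤ) : ℝ)
    have h5 : x i = l / 2 * (2 * x i / l) := by field_simp
    rw [h5, ← mul_sub, abs_mul, abs_of_pos (by positivity : 0 < l / 2)]
    have : |2 * x i / l - q| ≤ 1 / 2 := abs_le.2 ⟨by linarith, by linarith⟩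
    nlinarith
  obtain ⟨k, hk, z, hz, hzx⟩ := exists_grid_of_near hκ hl (by linarith) (τ := 4 / 5) hxd
    (fun i => (hfl i).trans_lt (by linarith))
    (fun i => by
      have h1 := abs_le.1 (hfl i)
      have h2 := abs_le.1 (hxr i)
      have : |l / 2 * (⌊2 * x i / l + 1 / 2⌋ : ℤ)| ≤ r + 1 / 4 * l :=
        abs_le.2 ⟨by linarith [h1.2, h2.1], by linarith [h1.1, h2.2]⟩
      linarith)
    (fun i hi => by
      rw [Int.le_floor]
      -- The factor 4/5 is large enough for this: 8/5 + 1/2 > 2, so rounding gives at least 2.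
      have : 8 / 5 ≤ 2 * x i / l := by
        rw [le_div_iff₀ hl]; linarith
      push_cast
      linarith)
  exact ⟨k, hk, z, mem_smul_of_forall_abs_lt hk (by norm_num)
    (mem_subDom_of_affine_eq hxd (fun i => (hz i).trans (by norm_num)) hzx) hz, hzx⟩

/-- The grid point to the left of x is within l/2, where l = 1/N. Within l of an end of (-1, 1) its
interval could stick out, so the extreme grid points ±(1 - l) are used instead; they belong to the
grid because 1/l is an integer. -/
theorem exists_int_near {N : ℕ} (hN : 0 < N) {x : ℝ} (hx : x ∈ Ioo (-1 : ℝ) 1) :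
    ∃ c : ℤ, |x - 1 / N / 2 * c| < 1 * (1 / N) ∧ |1 / N / 2 * (c : ℝ)| + 1 / N ≤ 1 ∧
      (1 * (1 / N : ℝ) ≤ x → 2 ≤ c) := by
  have hN' : (0 : ℝ) < N := by exact_mod_cast hN
  have hm : (1 : ℝ) / N / 2 * (2 * N - 2) = 1 - 1 / N := by field_simp
  have hl : (0 : ℝ) < 1 / N := by positivity
  have hl1 : (1 : ℝ) / N ≤ 1 := by
    rw [div_le_one hN']; exact_mod_cast hN
  set l : ℝ := 1 / N
  have h3 := Int.floor_le (2 * x / l)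
  have h4 := Int.lt_floor_add_one (2 * x / l)
  have h5 : l / 2 * (2 * x / l) = x := by field_simp
  rcases lt_or_ge (1 - l) x with h | h
  · refine ⟨2 * N - 2, ?_, ?_, fun hlx => ?_⟩
    · push_cast
      rw [hm, abs_lt]
      constructor <;> linarith [hx.2]
    · push_cast
      rw [hm, abs_of_nonneg (by linarith)]
      linarith
    -- For N = 1 the index 2N - 2 is 0, but then l ≤ x < 1 is impossible; otherwise it is at least
    -- 2.
    · have : l < 1 := by linarith [hx.2]
      have : 1 < N := by
        rw [div_lt_one hN'] at this
        exact_mod_cast this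
      omega
  · rcases lt_or_ge x (-(1 - l)) with h' | h'
    · refine ⟨-(2 * N - 2), ?_, ?_, fun hlx => ?_⟩
      · push_cast
        rw [mul_neg, hm, abs_lt]
        constructor <;> linarith [hx.1]
      · push_cast
        rw [mul_neg, hm, abs_neg, abs_of_nonneg (by linarith)]
        linarith
      · linarith
    · refine ⟨⌊2 * x / l⌋, ?_, ?_, fun hlx => ?_⟩
      · have h6 := mul_le_mul_of_nonneg_left h3 (by positivity : 0 ≤ l / 2)
        have h7 := mul_lt_mul_of_pos_left h4 (by positivity : 0 < l / 2)
        rw [h5] at h6 h7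
        rw [abs_lt]
        constructor <;> linarith
      · have h6 : (⌊2 * x / l⌋ : ℝ) ≤ 2 * N - 2 := by
          refine h3.trans ?_
          have := mul_le_mul_of_nonneg_left h (by positivity : (0 : ℝ) ≤ 2 * N)
          rw [← hm] at this
          calc 2 * x / l = 2 * N * x := by simp only [l]; field_simp
            _ ≤ _ := this
            _ = 2 * N - 2 := by simp only [l]; field_simp
        have h7 : (-(2 * N - 2) : ℝ) ≤ ⌊2 * x / l⌋ := by
          have : (-(2 * N - 2) : ℤ) ≤ ⌊2 * x / l⌋ := by
            rw [Int.le_floor]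
            push_cast
            have := mul_le_mul_of_nonneg_left h' (by positivity : (0 : ℝ) ≤ 2 * N)
            rw [← hm] at this
            calc (-(2 * N - 2) : ℝ) = 2 * N * (-(l / 2 * (2 * N - 2))) := by
                  simp only [l]; field_simp
              _ ≤ _ := this
              _ = 2 * x / l := by simp only [l]; field_simp
          exact_mod_cast this
        have h8 : |(⌊2 * x / l⌋ : ℝ)| ≤ 2 * N - 2 := abs_le.2 ⟨h7, h6⟩
        have h9 := mul_le_mul_of_nonneg_left h8 (by positivity : 0 ≤ l / 2)
        rw [hm] at h9
        rw [abs_mul, abs_of_pos (by positivity : 0 < l / 2)]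
        linarith
      · rw [Int.le_floor]
        push_cast
        rw [le_div_iff₀ hl]
        linarith

/-- The grid cubes of mesh size `1 / (2 N)` cover the range of a chart. -/
theorem exists_grid_cover {κ : Chart d M} (hκ : κ.IsNormalized) {N : ℕ} (hN : 0 < N) {x : Euc d}
    (hx : x ∈ κ.dom) :
    ∃ k : Fin d → ℤ, (κ.subDom (gridPoint (1 / N) k) (1 / N) = cube d ∨
        κ.subDom (gridPoint (1 / N) k) (1 / N) = cube d ∩ halfSpace d) ∧
      ∃ z ∈ κ.subDom (gridPoint (1 / N) k) (1 / N), gridPoint (1 / N) k + (1 / N : ℝ) • z = x := by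
  have hN' : (0 : ℝ) < N := by exact_mod_cast hN
  choose c hc hc1 hc2 using fun i => exists_int_near hN (hκ.dom_subset hx i)
  obtain ⟨k, hk, z, hz, hzx⟩ := exists_grid_of_near hκ (by positivity)
    (by rw [div_le_one hN']; exact_mod_cast hN) hx hc hc1 hc2
  exact ⟨k, hk, z, mem_subDom_of_affine_eq hx hz hzx, hzx⟩

end Chart

/-! ### Boundedness of singularity functions on bounded submanifolds -/

namespace IsPRSingularityDatumOn

variable {d n : ℕ} {B S : Set (Euc n)} {b : Euc n → ℝ} {K : Set (Chart d B)}

/-- On a segment of fixed length ε from the center, the scaled derivative varies by at most c/2,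
half its lower bound. Hence the image moves by at least b_κ c ε/2, which cannot exceed the diameter
of B. -/
theorem exists_center_bound_of_pos (h : IsPRSingularityDatumOn S b K) (hd : 0 < d)
    (hB : Bornology.IsBounded B) :
    ∃ β, 0 < β ∧ ∀ κ : chartsOn K S, κ.1.center b ≤ β := by
  obtain ⟨ρ, hρ⟩ := hB.exists_norm_le
  obtain ⟨c, hc, hlow⟩ := h.exists_scaledDeriv_lower
  have hA := h.unifBdd_scaledDeriv 1
  obtain ⟨C, hC, hup⟩ := (hA.fderivWithin fun κ => κ.1.uniqueDiffOn).exists_bound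
  set ε := min (1 / 2) (c / (2 * C)) with hε
  have hε0 : 0 < ε := by positivity
  have hε1 : ε ≤ 1 / 2 := min_le_left _ _
  have hε2 : C * ε ≤ c / 2 := by
    have : ε ≤ c / (2 * C) := min_le_right _ _
    rw [le_div_iff₀ (by positivity)] at this
    linarith
  refine ⟨4 * (|ρ| + 1) / (ε * c), by positivity, fun κ => ?_⟩
  have hp := h.center_pos κ
  have hn := h.shrinkable.1 κ κ.2
  -- The segment goes in the positive direction of coordinate 0, so it also stays in half-cubes; d >
  -- 0 is used here.
  set y : Euc d := EuclideanSpace.single ⟨0, hd⟩ ε with hy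
  have hyn : ‖y‖ = ε := by simp [y, abs_of_pos hε0]
  have hyc : y ∈ cube d := by
    intro i
    simp only [y, PiLp.single_apply]
    split_ifs
    · exact ⟨by linarith, by linarith⟩
    · norm_num
  have hyd : y ∈ κ.1.dom := by
    rcases hn with hn | hn <;> rw [hn]
    · exact hyc
    · refine ⟨hyc, fun i _ => ?_⟩
      simp only [y, PiLp.single_apply]
      split_ifs
      · exact hε0.le
      · exact le_rfl
  have hA0 : ∀ x ∈ κ.1.dom, ‖scaledDeriv b κ.1 x - scaledDeriv b κ.1 0‖ ≤ C * ‖x‖ := by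
    intro x hx
    simpa using hn.convex.norm_image_sub_le_of_norm_fderivWithin_le
      ((hA.1 κ).differentiableOn (by simp)) (fun z hz => hup κ z hz) hn.zero_mem hx
  have hder : ∀ x ∈ κ.1.dom,
      HasFDerivWithinAt κ.1.param (κ.1.center b • scaledDeriv b κ.1 x) κ.1.dom x := by
    intro x hx
    rw [scaledDeriv, smul_inv_smul₀ hp.ne']
    exact κ.1.hasFDerivWithinAt hx
  have hmv := Convex.norm_image_sub_le_of_norm_hasFDerivWithin_le'
    (s := κ.1.dom ∩ Metric.closedBall 0 ε) (x := 0) (y := y)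
    (φ := κ.1.center b • scaledDeriv b κ.1 0) (C := κ.1.center b * (C * ε))
    (fun x hx => (hder x hx.1).mono inter_subset_left)
    (fun x hx => by
      rw [← smul_sub, norm_smul, Real.norm_of_nonneg hp.le]
      have h1 := hA0 x hx.1
      have h2 : ‖x‖ ≤ ε := by simpa using hx.2
      gcongr
      exact h1.trans (by gcongr))
    (hn.convex.inter (convex_closedBall 0 ε)) ⟨hn.zero_mem, by simp [hε0.le]⟩
    ⟨hyd, by simp [hyn]⟩
  rw [sub_zero, hyn, smul_apply] at hmv
  have h1 := hlow κ 0 hn.zero_mem y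
  rw [hyn] at h1
  have h2 : ‖κ.1.center b • scaledDeriv b κ.1 0 y‖ ≥ κ.1.center b * (c * ε) := by
    rw [norm_smul, Real.norm_of_nonneg hp.le]
    gcongr
  have h3 : ‖κ.1.param y - κ.1.param 0‖ ≤ 2 * (|ρ| + 1) := by
    have h4 := hρ _ (κ.1.mapsTo hyd)
    have h5 := hρ _ (κ.1.mapsTo hn.zero_mem)
    have := norm_sub_le (κ.1.param y) (κ.1.param 0)
    linarith [le_abs_self ρ]
  have h6 := norm_sub_norm_le (κ.1.center b • scaledDeriv b κ.1 0 y)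
    (κ.1.param y - κ.1.param 0)
  rw [norm_sub_rev] at hmv
  rw [le_div_iff₀ (by positivity)]
  have h7 : κ.1.center b * (C * ε) * ε ≤ κ.1.center b * (c / 2) * ε := by gcongr
  linarith

theorem exists_center_bound (h : IsPRSingularityDatumOn S b K) (hB : Bornology.IsBounded B)
    (hb0 : d = 0 → BddAbove (b '' S)) :
    ∃ β, 0 < β ∧ ∀ κ : chartsOn K S, κ.1.center b ≤ β := by
  rcases Nat.eq_zero_or_pos d with hd | hd
  · obtain ⟨C, hC⟩ := hb0 hd
    obtain ⟨c, hc, he⟩ := h.equiv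
    have hc0 : 0 < c := by linarith
    refine ⟨max (c * C) 1, by positivity, fun κ => le_max_of_le_left ?_⟩
    -- For d = 0 a chart has no size, so the center is compared with a point of S in the patch,
    -- where b is bounded by assumption.
    obtain ⟨p, ⟨x, hx, rfl⟩, hpS⟩ := κ.2.2
    have h1 := (he κ κ.2 x hx).1
    rw [div_le_iff₀ hc0] at h1
    have h2 := hC ⟨_, hpS, rfl⟩
    nlinarith
  · exact h.exists_center_bound_of_pos hd hB

end IsPRSingularityDatumOn

/-! ### The charts of a pipe near the end point -/

/-- The parameters for the construction of the charts of a pipe from the charts of its base. -/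
structure PipeSetup (e : EndPoint) (R r : ℝ → ℝ) {d n : ℕ} {B : Set (Euc n)} (S : Set (Euc n))
    (b : Euc n → ℝ) (K : Set (Chart d B)) where
  weight : IsPipeWeight e R r
  datum : IsPRSingularityDatumOn S b K
  bounded : Bornology.IsBounded B
  /-- The shrinking factor of the charts of the base. -/
  ρ : ℝ
  /-- The relative length of the intervals. -/
  δ : ℝ
  /-- The relative mesh size of the grids. -/
  θ : ℝ
  /-- A bound for the singularity function of the base. -/
  β : ℝ
  /-- The centers of the intervals. -/
  nodes : chartsOn K S → Set ℝ
  δ_pos : 0 < δ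
  θ_pos : 0 < θ
  β_pos : 0 < β
  ρ_mem : ρ ∈ Ioo (0 : ℝ) 1
  cover : S ⊆ ⋃ κ ∈ chartsOn K S, κ.param '' (ρ • κ.dom)
  center_le : ∀ κ : chartsOn K S, κ.1.center b ≤ β
  room : ∀ κ : chartsOn K S, ∀ t ∈ e.core, ∀ s, |s - t| ≤ δ * r t * κ.1.center b →
    s ∈ interior e.J
  osc_char : ∀ κ : chartsOn K S, ∀ t ∈ e.core, ∀ s, |s - t| ≤ δ * r t * κ.1.center b →
    R t / 2 ≤ R s ∧ R s ≤ 2 * R t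
  osc : ∀ κ : chartsOn K S, ∀ t ∈ e.core, ∀ s, |s - t| ≤ δ * r t * κ.1.center b →
    r t / 2 ≤ r s ∧ r s ≤ 2 * r t
  mesh_le : ∀ t ∈ interior e.J, θ * r t ≤ (1 - ρ) / 2 * R t
  nodes_subset : ∀ κ, nodes κ ⊆ e.core
  nodes_cover : ∀ κ, ∀ t ∈ e.core, ∃ s ∈ nodes κ, |t - s| < 3 / 4 * (δ * r s * κ.1.center b)
  nodes_mult : ∀ κ, ∀ t ∈ interior e.J, ∃ F : Finset ℝ, F.card ≤ 16 ∧
    ∀ s ∈ nodes κ, |t - s| < δ * r s * κ.1.center b → s ∈ F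

section

variable {e : EndPoint} {R r : ℝ → ℝ} {d n : ℕ} {B S : Set (Euc n)} {b : Euc n → ℝ}
  {K : Set (Chart d B)}

/-- All constants are fixed before any chart is chosen. The nodes depend on the base chart because
the interval length δ r(t) b_κ does. -/
theorem IsPRSingularityDatumOn.nonempty_pipeSetup (h : IsPRSingularityDatumOn S b K)
    (hw : IsPipeWeight e R r) (hB : Bornology.IsBounded B) (hb0 : d = 0 → BddAbove (b '' S)) :
    Nonempty (PipeSetup e R r S b K) := by
  obtain ⟨ρ, hρ, hcov⟩ := h.shrinkable.2
  obtain ⟨β, hβ, hcen⟩ := h.exists_center_bound hB hb0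
  obtain ⟨L₁, hL₁, hLip₁⟩ := exists_lipschitz_of_deriv_bound isOpen_interior e.convex_interior_J
    hw.char.contDiffOn_interior (hw.unifBdd_deriv_char 0)
  obtain ⟨L₂, hL₂, hLip₂⟩ := exists_lipschitz_of_deriv_bound isOpen_interior e.convex_interior_J
    hw.smooth (hw.unifBdd_deriv 0)
  obtain ⟨δ₀, hδ₀, hroom⟩ := hw.room
  obtain ⟨C, hC⟩ := hw.le_char
  have hCR : ∀ t ∈ interior e.J, r t ≤ (|C| + 1) * R t := fun t ht => by
    have h1 := hC t ht
    have h2 := hw.char.pos_of_mem_interior ht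
    nlinarith [le_abs_self C]
  set L := L₁ + L₂
  set D := |C| + 1
  have hD : 1 ≤ D := by simp [D]
  have hL : 0 < L := by positivity
  -- The first bound keeps the intervals inside J. The second makes R and r vary by at most a tenth
  -- on them, using r ≤ D R, and gives the length function the Lipschitz constant 1/10.
  set δ := min (δ₀ / β) (1 / (10 * β * L * D))
  have hδ : 0 < δ := by positivity
  have hδ1 : δ * β ≤ δ₀ := by
    rw [← le_div_iff₀ hβ]; exact min_le_left _ _
  have hδ2 : δ * β * L * D ≤ 1 / 10 := by
    have : δ ≤ 1 / (10 * β * L * D) := min_le_right _ _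
    rw [le_div_iff₀ (by positivity)] at this
    linarith
  have hδ3 : δ * β * L ≤ 1 / 10 := by
    refine le_trans ?_ hδ2
    exact le_mul_of_one_le_right (by positivity) hD
  have hscale : ∀ κ : chartsOn K S, ∀ t ∈ e.core, δ * r t * κ.1.center b ≤ δ * β * r t := by
    intro κ t ht
    have := hw.pos t (e.core_subset ht)
    calc δ * r t * κ.1.center b ≤ δ * r t * β := by gcongr; exact hcen κ
      _ = δ * β * r t := by ring
  have hV : ∀ κ : chartsOn K S, ∀ t ∈ e.core, ∀ s, |s - t| ≤ δ * r t * κ.1.center b →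
      s ∈ interior e.J := by
    intro κ t ht s hs
    have := hw.pos t (e.core_subset ht)
    exact hroom t ht s ((hs.trans (hscale κ t ht)).trans (by gcongr))
  have hosc : ∀ κ : chartsOn K S, ∀ t ∈ e.core, ∀ s, |s - t| ≤ δ * r t * κ.1.center b →
      L * |s - t| ≤ 1 / 10 * r t ∧ L * |s - t| ≤ 1 / 10 * R t := by
    intro κ t ht s hs
    have ht' := e.core_subset ht
    have h1 := hw.pos t ht'
    have h2 := hw.char.pos_of_mem_interior ht'
    have h3 : L * |s - t| ≤ L * (δ * β * r t) := by
      gcongr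
      exact hs.trans (hscale κ t ht)
    constructor
    · calc L * |s - t| ≤ (δ * β * L) * r t := by linarith
        _ ≤ _ := by gcongr
    · calc L * |s - t| ≤ L * (δ * β * (D * R t)) := h3.trans (by gcongr; exact hCR t ht')
        _ = δ * β * L * D * R t := by ring
        _ ≤ _ := by gcongr
  have hnodes : ∀ κ : chartsOn K S, ∃ T ⊆ e.core,
      (∀ t ∈ e.core, ∃ s ∈ T, |t - s| < 3 / 4 * (δ * r s * κ.1.center b)) ∧
      ∀ p ∈ interior e.J, ∃ F : Finset ℝ, F.card ≤ 16 ∧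
        ∀ s ∈ T, |p - s| < δ * r s * κ.1.center b → s ∈ F := by
    intro κ
    have hp := h.center_pos κ
    refine exists_interval_cover e.core_subset (a := fun t => δ * r t * κ.1.center b)
      (fun t ht => ?_) fun s hs t ht => ?_
    · have := hw.pos t ht
      positivity
    · have h1 := hLip₂ s hs t ht
      have h2 : δ * r s * κ.1.center b - δ * r t * κ.1.center b = δ * κ.1.center b * (r s - r t) := by
        ring
      rw [h2, abs_mul, abs_of_pos (by positivity)]
      calc δ * κ.1.center b * |r s - r t| ≤ δ * β * (L * |s - t|) := by
            gcongr
            · exact hcen κ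
            · exact h1.trans (by gcongr; simp only [L]; linarith)
        _ = δ * β * L * |s - t| := by ring
        _ ≤ _ := by gcongr
  choose T hT1 hT2 hT3 using hnodes
  -- The choice θ = (1 - ρ)/(2D) makes the grid cubes small enough to cover the shrunken range
  -- without leaving the cube.
  refine ⟨⟨hw, h, hB, ρ, δ, (1 - ρ) / (2 * D), β, T, hδ, ?_, hβ, hρ, hcov, hcen, hV, ?_, ?_, ?_,
    hT1, hT2, hT3⟩⟩
  · have := hρ.2
    have : 0 < 1 - ρ := by linarith
    positivity
  · intro κ t ht s hs
    have h1 := (hosc κ t ht s hs).2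
    have h2 := hLip₁ s (hV κ t ht s hs) t (e.core_subset ht)
    have h3 : L₁ * |s - t| ≤ L * |s - t| := by gcongr; simp only [L]; linarith
    have h4 := abs_le.1 (h2.trans (h3.trans h1))
    have h5 := hw.char.pos_of_mem_interior (e.core_subset ht)
    constructor <;> linarith [h4.1, h4.2]
  · intro κ t ht s hs
    have h1 := (hosc κ t ht s hs).1
    have h2 := hLip₂ s (hV κ t ht s hs) t (e.core_subset ht)
    have h3 : L₂ * |s - t| ≤ L * |s - t| := by gcongr; simp only [L]; linarith
    have h4 := abs_le.1 (h2.trans (h3.trans h1))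
    have h5 := hw.pos t (e.core_subset ht)
    constructor <;> linarith [h4.1, h4.2]
  · intro t ht
    have h1 := hCR t ht
    have h2 : 0 < 1 - ρ := by linarith [hρ.2]
    calc (1 - ρ) / (2 * D) * r t ≤ (1 - ρ) / (2 * D) * (D * R t) := by gcongr
      _ = (1 - ρ) / 2 * R t := by field_simp

end

namespace PipeSetup

variable {e : EndPoint} {R r : ℝ → ℝ} {d n : ℕ} {B S : Set (Euc n)} {b : Euc n → ℝ}
  {K : Set (Chart d B)} (σ : PipeSetup e R r S b K)

/-- The inverse of the mesh size of the grid at `t`. -/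
noncomputable def gridNumber (t : ℝ) : ℕ := ⌈R t / (σ.θ * r t)⌉₊

/-- The size of the grid cubes at `t`. -/
noncomputable def mesh (t : ℝ) : ℝ := 1 / σ.gridNumber t

/-- The length of the intervals at `t`. -/
noncomputable def scale (κ : chartsOn K S) (t : ℝ) : ℝ := σ.δ * r t * κ.1.center b

theorem gridNumber_pos {t : ℝ} (ht : t ∈ interior e.J) : 0 < σ.gridNumber t := by
  have h1 := σ.weight.pos t ht
  have h2 := σ.weight.char.pos_of_mem_interior ht
  have h3 := σ.θ_pos
  exact Nat.ceil_pos.2 (by positivity)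

theorem mesh_pos {t : ℝ} (ht : t ∈ interior e.J) : 0 < σ.mesh t := by
  have : (0 : ℝ) < σ.gridNumber t := by exact_mod_cast σ.gridNumber_pos ht
  exact one_div_pos.2 this

theorem scale_pos (κ : chartsOn K S) {t : ℝ} (ht : t ∈ interior e.J) : 0 < σ.scale κ t := by
  have h1 := σ.weight.pos t ht
  have h2 := σ.datum.center_pos κ
  have h3 := σ.δ_pos
  unfold scale
  positivity

/-- The quotient of `R(t) · mesh` and `r(t)` lies between `θ / 2` and `θ`. -/
theorem mesh_bounds {t : ℝ} (ht : t ∈ interior e.J) :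
    σ.θ / 2 ≤ R t * σ.mesh t / r t ∧ R t * σ.mesh t / r t ≤ σ.θ := by
  have h1 := σ.weight.pos t ht
  have h2 := σ.weight.char.pos_of_mem_interior ht
  have h3 := σ.θ_pos
  have h4 := σ.mesh_le t ht
  have h5 : (0 : ℝ) < σ.gridNumber t := by exact_mod_cast σ.gridNumber_pos ht
  have hle : σ.θ * r t ≤ R t := by
    nlinarith [σ.ρ_mem.1, σ.ρ_mem.2]
  have h6 : R t / (σ.θ * r t) ≤ σ.gridNumber t := Nat.le_ceil _
  have h7 : (σ.gridNumber t : ℝ) < R t / (σ.θ * r t) + 1 := Nat.ceil_lt_add_one (by positivity)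
  -- For a number at least 1, rounding up at most doubles it; hence the factor 1/2 in the lower
  -- bound.
  have h8 : 1 ≤ R t / (σ.θ * r t) := by
    rw [le_div_iff₀ (by positivity), one_mul]; exact hle
  have h9 : R t / (σ.θ * r t) * (σ.θ * r t) = R t := div_mul_cancel₀ _ (by positivity)
  set q := R t / (σ.θ * r t)
  rw [mesh, mul_one_div, div_div]
  constructor
  · rw [le_div_iff₀ (by positivity), ← h9]
    have : (0 : ℝ) < σ.θ * r t := by positivity
    nlinarith
  · rw [div_le_iff₀ (by positivity), ← h9]
    have : (0 : ℝ) < σ.θ * r t := by positivity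
    nlinarith

theorem mesh_le_shrink {t : ℝ} (ht : t ∈ interior e.J) : σ.mesh t ≤ (1 - σ.ρ) / 2 := by
  have h1 := σ.weight.pos t ht
  have h2 := σ.weight.char.pos_of_mem_interior ht
  have h3 := (σ.mesh_bounds ht).2
  rw [div_le_iff₀ h1] at h3
  have h4 := h3.trans (σ.mesh_le t ht)
  rw [mul_comm] at h4
  exact le_of_mul_le_mul_right h4 h2

/-- The index set of the charts of the pipe: a chart of the base, a node, and a grid point. -/
@[ext]
structure Index where
  κ : chartsOn K S
  t : ℝ
  k : Fin d → ℤ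
  t_mem : t ∈ σ.nodes κ
  k_mem : κ.1.subDom (gridPoint (σ.mesh t) k) (σ.mesh t) = cube d ∨
    κ.1.subDom (gridPoint (σ.mesh t) k) (σ.mesh t) = cube d ∩ halfSpace d

namespace Index

variable {σ} (i : σ.Index)

theorem t_mem_core : i.t ∈ e.core := σ.nodes_subset _ i.t_mem

theorem t_mem_interior : i.t ∈ interior e.J := e.core_subset i.t_mem_core

/-- The part of the chart of the base which belongs to the index. -/
noncomputable def baseChart : Chart d B :=
  i.κ.1.sub (gridPoint (σ.mesh i.t) i.k) (σ.mesh i.t) (σ.mesh_pos i.t_mem_interior) i.k_mem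

theorem time_near {u : ℝ} (hu : u ∈ Ioo (-1 : ℝ) 1) :
    |i.t + σ.scale i.κ i.t * u - i.t| ≤ σ.δ * r i.t * i.κ.1.center b := by
  rw [add_sub_cancel_left, abs_mul, abs_of_pos (σ.scale_pos i.κ i.t_mem_interior)]
  exact mul_le_of_le_one_right (σ.scale_pos i.κ i.t_mem_interior).le (abs_lt.2 hu).le

/-- The chart of the pipe which belongs to the index. -/
noncomputable def chart : Chart (d + 1) (pipe e R B) :=
  i.baseChart.pipe σ.weight.char i.t (σ.scale i.κ i.t) (σ.scale_pos i.κ i.t_mem_interior)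
    fun _ hu => σ.room i.κ i.t i.t_mem_core _ (i.time_near hu)

/-- The coordinate `t` as a function of the coordinates of the chart. -/
noncomputable def time (w : Euc (d + 1)) : ℝ := i.t + σ.scale i.κ i.t * lastCLM d w

/-- The coordinates of the chart of the base as a function of the coordinates of the chart. -/
noncomputable def base (w : Euc (d + 1)) : Euc d :=
  gridPoint (σ.mesh i.t) i.k + σ.mesh i.t • initCLM d w

theorem isNormalized_baseChart : i.baseChart.IsNormalized := i.k_mem

theorem isNormalized_chart : i.chart.IsNormalized := i.isNormalized_baseChart.pipe

theorem mem_dom_iff {w : Euc (d + 1)} : w ∈ i.chart.dom ↔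
    initCLM d w ∈ i.baseChart.dom ∧ lastCLM d w ∈ Ioo (-1 : ℝ) 1 := Iff.rfl

theorem param_eq (w : Euc (d + 1)) :
    i.chart.param w = consPoint (i.time w) (R (i.time w) • i.κ.1.param (i.base w)) := rfl

theorem base_mem {w : Euc (d + 1)} (hw : w ∈ i.chart.dom) : i.base w ∈ i.κ.1.dom := hw.1.2

theorem time_near' {w : Euc (d + 1)} (hw : w ∈ i.chart.dom) :
    |i.time w - i.t| ≤ σ.δ * r i.t * i.κ.1.center b := i.time_near hw.2

theorem time_mem {w : Euc (d + 1)} (hw : w ∈ i.chart.dom) : i.time w ∈ interior e.J :=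
  σ.room i.κ i.t i.t_mem_core _ (i.time_near' hw)

theorem stretch_param {w : Euc (d + 1)} (hw : w ∈ i.chart.dom) :
    stretch R (i.chart.param w) = (i.time w, i.κ.1.param (i.base w)) :=
  stretch_consPoint (σ.weight.char.pos_of_mem_interior (i.time_mem hw)) _

theorem pipeFunction_param {w : Euc (d + 1)} (hw : w ∈ i.chart.dom) :
    pipeFunction R r b (i.chart.param w) = r (i.time w) * b (i.κ.1.param (i.base w)) := by
  rw [pipeFunction, i.stretch_param hw]

theorem zero_mem : (0 : Euc (d + 1)) ∈ i.chart.dom := i.isNormalized_chart.zero_mem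

/-- The weight `r(t) b_κ` of the index. -/
noncomputable def weight : ℝ := r i.t * i.κ.1.center b

theorem weight_pos : 0 < i.weight :=
  mul_pos (σ.weight.pos _ i.t_mem_interior) (σ.datum.center_pos _)

theorem scale_eq : σ.scale i.κ i.t = σ.δ * i.weight := by
  unfold scale weight; ring

end Index

end PipeSetup

/-! ### Uniform estimates for the charts of a pipe -/

namespace PipeSetup

variable {e : EndPoint} {R r : ℝ → ℝ} {d n : ℕ} {B S : Set (Euc n)} {b : Euc n → ℝ}
  {K : Set (Chart d B)} (σ : PipeSetup e R r S b K)

theorem uniqueDiffOn_dom (i : σ.Index) : UniqueDiffOn ℝ i.chart.dom := i.chart.uniqueDiffOn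

theorem exists_weight_le : ∃ C, 0 < C ∧ ∀ i : σ.Index, i.weight ≤ C := by
  obtain ⟨C, hC⟩ := σ.weight.le_const
  refine ⟨(|C| + 1) * σ.β, mul_pos (by positivity) σ.β_pos, fun i => ?_⟩
  have h1 := hC i.t i.t_mem_interior
  have h2 := σ.weight.pos i.t i.t_mem_interior
  have h3 := σ.datum.center_pos i.κ
  have h4 := le_abs_self C
  exact mul_le_mul (by linarith) (σ.center_le i.κ) h3.le (by positivity)

theorem hasFDerivWithinAt_time (i : σ.Index) (w : Euc (d + 1)) :
    HasFDerivWithinAt i.time (σ.scale i.κ i.t • lastCLM d) i.chart.dom w :=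
  have h : HasFDerivAt (fun w => i.t + σ.scale i.κ i.t * lastCLM d w)
      (σ.scale i.κ i.t • lastCLM d) w :=
    ((lastCLM d).hasFDerivAt.const_smul (σ.scale i.κ i.t)).const_add i.t
  h.hasFDerivWithinAt

theorem hasFDerivWithinAt_base (i : σ.Index) (w : Euc (d + 1)) :
    HasFDerivWithinAt i.base (σ.mesh i.t • initCLM d) i.chart.dom w :=
  have h : HasFDerivAt (fun w => gridPoint (σ.mesh i.t) i.k + σ.mesh i.t • initCLM d w)
      (σ.mesh i.t • initCLM d) w :=
    ((initCLM d).hasFDerivAt.const_smul (σ.mesh i.t)).const_add (gridPoint (σ.mesh i.t) i.k)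
  h.hasFDerivWithinAt

theorem mesh_le_one {t : ℝ} (ht : t ∈ interior e.J) : σ.mesh t ≤ 1 := by
  have := σ.mesh_le_shrink ht
  linarith [σ.ρ_mem.1]

theorem unifBdd_comp_time {g : ℝ → ℝ} {k : ℕ}
    (hg : UnifBdd k (fun _ : Unit => interior e.J) (fun _ => g)) :
    UnifBdd k (fun i : σ.Index => i.chart.dom) (fun i w => g (i.time w)) := by
  obtain ⟨C, hC, hw⟩ := σ.exists_weight_le
  refine UnifBdd.comp_affine (t := fun _ => interior e.J) (g := fun _ => g)
    (L := fun i : σ.Index => σ.scale i.κ i.t • lastCLM d) σ.uniqueDiffOn_dom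
    (fun _ => isOpen_interior.uniqueDiffOn) (hg.reindex fun _ => ())
    (fun i w _ => σ.hasFDerivWithinAt_time i w)
    ⟨σ.δ * C * ‖lastCLM d‖, fun i => ?_⟩ fun i w hw => i.time_mem hw
  have h1 := i.weight_pos
  have h2 := σ.δ_pos
  rw [norm_smul, i.scale_eq, Real.norm_of_nonneg (by positivity)]
  gcongr
  exact hw i

theorem unifBdd_comp_base {F : Type*} [NormedAddCommGroup F] [NormedSpace ℝ F]
    {g : chartsOn K S → Euc d → F} {k : ℕ}
    (hg : UnifBdd k (fun κ : chartsOn K S => κ.1.dom) g) :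
    UnifBdd k (fun i : σ.Index => i.chart.dom) (fun i w => g i.κ (i.base w)) := by
  refine UnifBdd.comp_affine (t := fun i : σ.Index => i.κ.1.dom) (g := fun i => g i.κ)
    (L := fun i : σ.Index => σ.mesh i.t • initCLM d) σ.uniqueDiffOn_dom
    (fun i => i.κ.1.uniqueDiffOn) (hg.reindex fun i : σ.Index => i.κ)
    (fun i w _ => σ.hasFDerivWithinAt_base i w)
    ⟨1 * ‖initCLM d‖, fun i => ?_⟩ fun i w hw => i.base_mem hw
  rw [norm_smul, Real.norm_of_nonneg (σ.mesh_pos i.t_mem_interior).le]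
  gcongr
  exact σ.mesh_le_one i.t_mem_interior

/-- The quotients `f(t) / f(t₀)` are uniformly bounded for `f = R` and `f = r`. -/
theorem unifBdd_quotient {f : ℝ → ℝ} (hf : ContDiffOn ℝ ∞ f (interior e.J))
    (hpos : ∀ t ∈ interior e.J, 0 < f t)
    (hf' : ∀ k, UnifBdd k (fun _ : Unit => interior e.J) (fun _ => deriv f))
    (hosc : ∀ κ : chartsOn K S, ∀ t ∈ e.core, ∀ s, |s - t| ≤ σ.δ * r t * κ.1.center b →
      f t / 2 ≤ f s ∧ f s ≤ 2 * f t)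
    (hrf : ∃ C, ∀ t ∈ interior e.J, r t ≤ C * f t) (k : ℕ) :
    UnifBdd k (fun i : σ.Index => i.chart.dom) (fun i w => (f i.t)⁻¹ * f (i.time w)) := by
  refine UnifBdd.mono_order (k := k + 1) ?_ (Nat.le_succ k)
  obtain ⟨C, hC⟩ := hrf
  have hder : ∀ i : σ.Index, ∀ w ∈ i.chart.dom,
      HasFDerivWithinAt (fun w => (f i.t)⁻¹ * f (i.time w))
        (((f i.t)⁻¹ * σ.scale i.κ i.t) • (deriv f (i.time w) • lastCLM d)) i.chart.dom w := by
    intro i w hw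
    have h1 : HasDerivAt f (deriv f (i.time w)) (i.time w) :=
      ((hf.differentiableOn (by simp) _ (i.time_mem hw)).differentiableAt
        (isOpen_interior.mem_nhds (i.time_mem hw))).hasDerivAt
    have h2 := (h1.comp_hasFDerivWithinAt w (σ.hasFDerivWithinAt_time i w)).const_smul (f i.t)⁻¹
    have h3 : (f i.t)⁻¹ • (deriv f (i.time w) • (σ.scale i.κ i.t • lastCLM d)) =
        ((f i.t)⁻¹ * σ.scale i.κ i.t) • (deriv f (i.time w) • lastCLM d) := by
      simp only [smul_smul]; congr 1; ring
    rw [← h3]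
    exact h2
  have hsm : ∀ i : σ.Index, ContDiffOn ℝ ∞ (fun w => (f i.t)⁻¹ * f (i.time w)) i.chart.dom := by
    intro i
    have ht : ContDiffOn ℝ ∞ i.time i.chart.dom := by unfold Index.time; fun_prop
    exact contDiffOn_const.mul (hf.comp ht fun w hw => i.time_mem hw)
  refine UnifBdd.of_fderivWithin_eq σ.uniqueDiffOn_dom hsm ⟨2, fun i w hw => ?_⟩ hder
    -- Each derivative carries the factor a/f(t₀), where a = δ r(t₀) b_κ is at most δ C f(t₀) β; the
    -- remaining factor f' is bounded to all orders.
    (UnifBdd.const_smul σ.uniqueDiffOn_dom ⟨σ.δ * σ.β * C, fun i _ => ?_⟩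
      (UnifBdd.smul σ.uniqueDiffOn_dom (σ.unifBdd_comp_time (hf' k))
        (UnifBdd.const ⟨‖lastCLM d‖, fun _ _ => le_rfl⟩)))
  · have h1 := hpos _ i.t_mem_interior
    have h2 := hpos _ (i.time_mem hw)
    rw [Real.norm_of_nonneg (by positivity), inv_mul_le_iff₀ h1, mul_comm]
    exact (hosc i.κ i.t i.t_mem_core _ (i.time_near' hw)).2
  · have h1 := hpos _ i.t_mem_interior
    have h2 := σ.weight.pos _ i.t_mem_interior
    have h3 := σ.scale_pos i.κ i.t_mem_interior
    have h4 := σ.δ_pos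
    have h5 := hC _ i.t_mem_interior
    have h6 := σ.datum.center_pos i.κ
    rw [abs_of_pos (by positivity), inv_mul_le_iff₀ h1]
    calc σ.scale i.κ i.t = σ.δ * r i.t * i.κ.1.center b := rfl
      _ ≤ σ.δ * r i.t * σ.β := by gcongr; exact σ.center_le i.κ
      _ ≤ σ.δ * (C * f i.t) * σ.β := by have := σ.β_pos; gcongr
      _ = _ := by ring

theorem unifBdd_char_quotient (k : ℕ) :
    UnifBdd k (fun i : σ.Index => i.chart.dom) (fun i w => (R i.t)⁻¹ * R (i.time w)) :=
  σ.unifBdd_quotient σ.weight.char.contDiffOn_interior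
    (fun _ ht => σ.weight.char.pos_of_mem_interior ht) σ.weight.unifBdd_deriv_char σ.osc_char
    σ.weight.le_char k

theorem unifBdd_weight_quotient (k : ℕ) :
    UnifBdd k (fun i : σ.Index => i.chart.dom) (fun i w => (r i.t)⁻¹ * r (i.time w)) :=
  σ.unifBdd_quotient σ.weight.smooth σ.weight.pos σ.weight.unifBdd_deriv σ.osc
    ⟨1, fun _ _ => by simp⟩ k

/-- Order 0 uses that B is bounded; the derivatives are b_κ times scaled derivatives, and the b_κ
are bounded. -/
theorem unifBdd_param_base (k : ℕ) :
    UnifBdd k (fun i : σ.Index => i.chart.dom) (fun i w => i.κ.1.param (i.base w)) := by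
  refine UnifBdd.mono_order (k := k + 1) ?_ (Nat.le_succ k)
  refine σ.unifBdd_comp_base (g := fun κ => κ.1.param) ?_
  obtain ⟨C, hC⟩ := σ.bounded.exists_norm_le
  refine UnifBdd.of_fderivWithin (fun κ => κ.1.uniqueDiffOn) (fun κ => κ.1.smooth)
    ⟨C, fun κ x hx => hC _ (κ.1.mapsTo hx)⟩
    ((UnifBdd.const_smul (c := fun κ : chartsOn K S => κ.1.center b)
      (fun κ => κ.1.uniqueDiffOn) ⟨σ.β, fun κ _ => ?_⟩
      (σ.datum.unifBdd_scaledDeriv k)).congr fun κ x hx => ?_)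
  · rw [abs_of_pos (σ.datum.center_pos κ)]
    exact σ.center_le κ
  · simp only [IsPRSingularityDatumOn.scaledDeriv]
    rw [smul_inv_smul₀ (σ.datum.center_pos κ).ne']

/-- The derivative of the parametrization of a chart of the pipe, divided by the weight. -/
noncomputable def scaledDeriv (i : σ.Index) (w : Euc (d + 1)) : Euc (d + 1) →L[ℝ] Euc (n + 1) :=
  σ.δ • (lastCLM d).smulRight (EuclideanSpace.single 0 1) +
    (tailIncl n) ∘L
      (((R i.t * σ.mesh i.t / r i.t) • ((R i.t)⁻¹ * R (i.time w)) •
        ((IsPRSingularityDatumOn.scaledDeriv b i.κ.1 (i.base w)) ∘L (initCLM d))) +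
      (σ.δ • deriv R (i.time w) • (lastCLM d).smulRight (i.κ.1.param (i.base w))))

theorem unifBdd_scaledDeriv (k : ℕ) :
    UnifBdd k (fun i : σ.Index => i.chart.dom) (fun i w => σ.scaledDeriv i w) := by
  have hs := σ.uniqueDiffOn_dom
  have h1 : UnifBdd k (fun i : σ.Index => i.chart.dom) (fun i w =>
      (R i.t * σ.mesh i.t / r i.t) • ((R i.t)⁻¹ * R (i.time w)) •
        ((IsPRSingularityDatumOn.scaledDeriv b i.κ.1 (i.base w)) ∘L (initCLM d))) := by
    refine UnifBdd.const_smul hs ⟨σ.θ, fun i _ => ?_⟩ (UnifBdd.smul hs (σ.unifBdd_char_quotient k) ?_)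
    · have h := σ.mesh_bounds i.t_mem_interior
      have := σ.θ_pos
      rw [abs_of_nonneg (by linarith)]
      exact h.2
    · exact UnifBdd.clm ((ContinuousLinearMap.compL ℝ (Euc (d + 1)) (Euc d) (Euc n)).flip (initCLM d))
        hs (σ.unifBdd_comp_base (σ.datum.unifBdd_scaledDeriv k))
  have h2 : UnifBdd k (fun i : σ.Index => i.chart.dom) (fun i w =>
      σ.δ • deriv R (i.time w) • (lastCLM d).smulRight (i.κ.1.param (i.base w))) :=
    UnifBdd.const_smul hs ⟨|σ.δ|, fun _ _ => le_rfl⟩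
      (UnifBdd.smul hs (σ.unifBdd_comp_time (σ.weight.unifBdd_deriv_char k))
        (UnifBdd.clm (ContinuousLinearMap.smulRightL ℝ (Euc (d + 1)) (Euc n) (lastCLM d)) hs
          (σ.unifBdd_param_base k)))
  exact UnifBdd.add hs (UnifBdd.const ⟨_, fun _ _ => le_rfl⟩)
    (UnifBdd.clm (ContinuousLinearMap.compL ℝ (Euc (d + 1)) (Euc n) (Euc (n + 1)) (tailIncl n)) hs
      (UnifBdd.add hs h1 h2))

theorem scaledDeriv_apply (i : σ.Index) (w v : Euc (d + 1)) :
    σ.scaledDeriv i w v = consPoint (σ.δ * lastCLM d v)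
      ((R i.t * σ.mesh i.t / r i.t * ((R i.t)⁻¹ * R (i.time w))) •
          IsPRSingularityDatumOn.scaledDeriv b i.κ.1 (i.base w) (initCLM d v) +
        (σ.δ * deriv R (i.time w) * lastCLM d v) • i.κ.1.param (i.base w)) := by
  rw [consPoint_eq]
  simp only [scaledDeriv, add_apply, smul_apply, ContinuousLinearMap.comp_apply,
    ContinuousLinearMap.smulRight_apply, smul_smul, mul_assoc]

/-- The weight r(t₀) b_κ factors out because the interval length is δ times it, and R(t₀) l b_κ is
R(t₀) l / r(t₀) times it. -/
theorem fderivWithin_chart (i : σ.Index) {w : Euc (d + 1)} (hw : w ∈ i.chart.dom) :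
    fderivWithin ℝ i.chart.param i.chart.dom w = i.weight • σ.scaledDeriv i w := by
  have h1 : HasFDerivWithinAt i.chart.param
      (Chart.pipeDeriv R i.baseChart i.t (σ.scale i.κ i.t) w) i.chart.dom w :=
    Chart.hasFDerivWithinAt_pipeParam σ.weight.char i.baseChart hw (i.time_mem hw)
  rw [h1.fderivWithin (σ.uniqueDiffOn_dom i w hw)]
  have h2 : fderivWithin ℝ i.baseChart.param i.baseChart.dom (initCLM d w) =
      σ.mesh i.t • fderivWithin ℝ i.κ.1.param i.κ.1.dom (i.base w) :=
    (i.κ.1.hasFDerivWithinAt_sub hw.1).fderivWithin (i.baseChart.uniqueDiffOn _ hw.1)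
  ext1 v
  have hr := (σ.weight.pos _ i.t_mem_interior).ne'
  have hR := (σ.weight.char.pos_of_mem_interior i.t_mem_interior).ne'
  have hb := (σ.datum.center_pos i.κ).ne'
  have h3 : i.t + σ.scale i.κ i.t * lastCLM d w = i.time w := rfl
  have h4 : i.baseChart.param (initCLM d w) = i.κ.1.param (i.base w) := rfl
  rw [Chart.pipeDeriv_apply, smul_apply, scaledDeriv_apply, ← consPoint_smul, h2, h3, h4,
    i.scale_eq, smul_add, smul_smul, smul_smul, smul_apply, smul_smul,
    IsPRSingularityDatumOn.scaledDeriv, smul_apply, smul_smul]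
  congr 1
  · ring
  · congr 2
    · unfold Index.weight
      field_simp
    · ring

/-- Triangular form: the axial component controls the last coordinate of v. The term with R' is then
controlled as well, and subtracting it from the tail leaves a multiple of the scaled derivative of
the base chart, which is bounded below. -/
theorem exists_scaledDeriv_lower :
    ∃ C, 1 ≤ C ∧ ∀ i : σ.Index, ∀ w ∈ i.chart.dom, ∀ v, ‖v‖ ^ 2 ≤ C * ‖σ.scaledDeriv i w v‖ ^ 2 := by
  obtain ⟨c, hc, hlow⟩ := σ.datum.exists_scaledDeriv_lower
  obtain ⟨C₁, hC₁, h1⟩ := (σ.unifBdd_comp_time (σ.weight.unifBdd_deriv_char 0)).exists_bound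
  obtain ⟨C₂, hC₂, h2⟩ := (σ.unifBdd_param_base 0).exists_bound
  have hδ := σ.δ_pos
  have hθ := σ.θ_pos
  -- The factors come from the mesh, from the oscillation of R over the interval, and from the base
  -- chart.
  set α := σ.θ / 2 * (1 / 2) * c
  have hα : 0 < α := by positivity
  set A := (1 + C₁ * C₂) / α
  refine ⟨1 + (1 / σ.δ ^ 2 + A ^ 2), by
    have : 0 ≤ 1 / σ.δ ^ 2 + A ^ 2 := by positivity
    linarith, fun i w hw v => ?_⟩
  set N := ‖σ.scaledDeriv i w v‖
  have hN : 0 ≤ N := norm_nonneg _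
  have hNsq : N ^ 2 = _ := congrArg (fun x => ‖x‖ ^ 2) (σ.scaledDeriv_apply i w v)
  rw [norm_consPoint_sq] at hNsq
  set y := (R i.t * σ.mesh i.t / r i.t * ((R i.t)⁻¹ * R (i.time w))) •
          IsPRSingularityDatumOn.scaledDeriv b i.κ.1 (i.base w) (initCLM d v)
  set z := (σ.δ * deriv R (i.time w) * lastCLM d v) • i.κ.1.param (i.base w)
  have hu : σ.δ * |lastCLM d v| ≤ N := by
    refine le_of_sq_le_sq ?_ hN
    rw [hNsq, mul_pow, sq_abs, mul_pow]
    linarith [sq_nonneg ‖y + z‖]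
  have hyz : ‖y + z‖ ≤ N := by
    refine le_of_sq_le_sq ?_ hN
    rw [hNsq]
    linarith [sq_nonneg (σ.δ * lastCLM d v)]
  have hz : ‖z‖ ≤ C₁ * C₂ * N := by
    rw [norm_smul, Real.norm_eq_abs, abs_mul, abs_mul, abs_of_pos hδ]
    calc σ.δ * |deriv R (i.time w)| * |lastCLM d v| * ‖i.κ.1.param (i.base w)‖
        = |deriv R (i.time w)| * ‖i.κ.1.param (i.base w)‖ * (σ.δ * |lastCLM d v|) := by ring
      _ ≤ C₁ * C₂ * N := by
        gcongr
        · exact h1 i w hw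
        · exact h2 i w hw
  have hy : α * ‖initCLM d v‖ ≤ ‖y‖ := by
    have h3 := (σ.mesh_bounds i.t_mem_interior).1
    have h4 := (σ.osc_char i.κ i.t i.t_mem_core _ (i.time_near' hw)).1
    have hR := σ.weight.char.pos_of_mem_interior i.t_mem_interior
    have h5 : 1 / 2 ≤ (R i.t)⁻¹ * R (i.time w) := by
      rw [le_inv_mul_iff₀ hR]; linarith
    have h6 := hlow i.κ (i.base w) (i.base_mem hw) (initCLM d v)
    have h7 : σ.θ / 2 * (1 / 2) ≤ R i.t * σ.mesh i.t / r i.t * ((R i.t)⁻¹ * R (i.time w)) := by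
      refine mul_le_mul h3 h5 (by norm_num) ?_
      linarith
    have h8 : 0 < σ.θ / 2 * (1 / 2) := by positivity
    rw [norm_smul, Real.norm_of_nonneg (h8.le.trans h7)]
    calc α * ‖initCLM d v‖ = σ.θ / 2 * (1 / 2) * (c * ‖initCLM d v‖) := by
          simp only [α]; ring
      _ ≤ _ := mul_le_mul h7 h6 (by positivity) (h8.le.trans h7)
  have hA : ‖initCLM d v‖ ≤ A * N := by
    have h9 : ‖y‖ ≤ ‖y + z‖ + ‖z‖ := by
      simpa using norm_sub_le (y + z) z
    simp only [A]
    rw [div_mul_eq_mul_div, le_div_iff₀ hα]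
    linarith
  have hB : |lastCLM d v| ≤ 1 / σ.δ * N := by
    rw [one_div, le_inv_mul_iff₀ hδ]; exact hu
  rw [norm_sq_init_last, ← sq_abs (lastCLM d v)]
  calc ‖initCLM d v‖ ^ 2 + |lastCLM d v| ^ 2 ≤ (A * N) ^ 2 + (1 / σ.δ * N) ^ 2 := by gcongr
    _ = (1 / σ.δ ^ 2 + A ^ 2) * N ^ 2 := by ring
    _ ≤ _ := mul_le_mul_of_nonneg_right (by linarith) (by positivity)

theorem exists_center_bounds :
    ∃ c, 1 ≤ c ∧ ∀ i : σ.Index, i.weight ≤ c * i.chart.center (pipeFunction R r b) ∧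
      i.chart.center (pipeFunction R r b) ≤ c * i.weight ∧
      ∀ w ∈ i.chart.dom, i.weight / c ≤ pipeFunction R r b (i.chart.param w) ∧
        pipeFunction R r b (i.chart.param w) ≤ c * i.weight := by
  obtain ⟨c, hc, he⟩ := σ.datum.equiv
  have hc0 : 0 < c := by linarith
  have main : ∀ i : σ.Index, ∀ w ∈ i.chart.dom,
      i.weight / (2 * c) ≤ pipeFunction R r b (i.chart.param w) ∧
        pipeFunction R r b (i.chart.param w) ≤ 2 * c * i.weight := by
    intro i w hw
    obtain ⟨h1, h2⟩ := he i.κ i.κ.2 (i.base w) (i.base_mem hw)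
    obtain ⟨h3, h4⟩ := σ.osc i.κ i.t i.t_mem_core _ (i.time_near' hw)
    change r i.t / 2 ≤ r (i.time w) at h3
    change r (i.time w) ≤ 2 * r i.t at h4
    have h5 := σ.datum.center_pos i.κ
    have h6 := σ.weight.pos _ i.t_mem_interior
    have h7 := σ.weight.pos _ (i.time_mem hw)
    have h8 := σ.datum.smooth.1 _ (i.κ.1.mapsTo (i.base_mem hw))
    rw [i.pipeFunction_param hw]
    constructor
    · calc i.weight / (2 * c) = (r i.t / 2) * (i.κ.1.center b / c) := by
            unfold Index.weight; field_simp
        _ ≤ _ := by gcongr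
    · calc r (i.time w) * b (i.κ.1.param (i.base w)) ≤ (2 * r i.t) * (c * i.κ.1.center b) := by
            gcongr
        _ = _ := by unfold Index.weight; ring
  -- The factor 2 is the oscillation of r, and c that of b on its chart.
  refine ⟨2 * c, by linarith, fun i => ⟨?_, (main i 0 i.zero_mem).2, main i⟩⟩
  have := (main i 0 i.zero_mem).1
  rw [div_le_iff₀ (by positivity)] at this
  rw [Chart.center]
  linarith

theorem unifBdd_pipeFunction (k : ℕ) :
    UnifBdd k (fun i : σ.Index => i.chart.dom)
      (fun i w => (i.weight)⁻¹ • pipeFunction R r b (i.chart.param w)) := by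
  refine (UnifBdd.mul σ.uniqueDiffOn_dom (σ.unifBdd_weight_quotient k)
    (σ.unifBdd_comp_base (σ.datum.unifBdd_scaled k))).congr fun i w hw => ?_
  have h5 := (σ.datum.center_pos i.κ).ne'
  have h6 := (σ.weight.pos _ i.t_mem_interior).ne'
  simp only [i.pipeFunction_param hw, smul_eq_mul]
  unfold Index.weight
  field_simp

end PipeSetup

/-! ### The pipe as a singular manifold -/

/-- A function which is smooth in the charts of an atlas is smooth along smooth maps into the
submanifold. -/
theorem IsSmoothPositive.contDiffOn_comp {m n : ℕ} {M : Set (Euc n)} {ρ : Euc n → ℝ}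
    {K : Set (Chart m M)} (hK : IsAtlas K) (hρ : IsSmoothPositive m M ρ)
    {E : Type*} [NormedAddCommGroup E] [NormedSpace ℝ E] {s : Set E} {f : E → Euc n}
    (hs : UniqueDiffOn ℝ s) (hf : ContDiffOn ℝ ∞ f s) (hfs : MapsTo f s M) :
    ContDiffOn ℝ ∞ (fun x => ρ (f x)) s := by
  intro x hx
  obtain ⟨κ, -, hκ⟩ := hK (f x) (hfs hx)
  obtain ⟨W, hW, hWe⟩ := κ.exists_isOpen_patch
  obtain ⟨O, hO, hOe⟩ := continuousOn_iff'.1 hf.continuousOn W hW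
  have hsO : ∀ y ∈ s ∩ O, f y ∈ κ.patch := by
    intro y hy
    rw [hWe]
    have h : y ∈ f ⁻¹' W ∩ s := by rw [hOe]; exact ⟨hy.2, hy.1⟩
    exact ⟨hfs hy.1, h.1⟩
  have hxO : x ∈ O := by
    have h : x ∈ f ⁻¹' W ∩ s := ⟨(hWe ▸ hκ : f x ∈ M ∩ W).2, hx⟩
    rw [hOe] at h
    exact h.1
  have h1 : ContDiffOn ℝ ∞ (fun y => ρ (f y)) (s ∩ O) := by
    refine ((hρ.2 κ).comp (κ.contDiffOn_coord_comp (hs.inter hO) (hf.mono inter_subset_left) hsO)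
      fun y hy => κ.coord_mem (hsO y hy)).congr fun y hy => ?_
    simp only [Function.comp_apply, κ.param_coord (hsO y hy)]
  exact (h1 x ⟨hx, hxO⟩).mono_of_mem_nhdsWithin
    (inter_mem self_mem_nhdsWithin (mem_nhdsWithin_of_mem_nhds (hO.mem_nhds hxO)))

theorem Chart.IsNormalized.smul_dom_subset {m n : ℕ} {M : Set (Euc n)} {κ : Chart m M}
    (h : κ.IsNormalized) {r : ℝ} (hr : 0 ≤ r) (hr1 : r ≤ 1) : r • κ.dom ⊆ κ.dom := by
  rintro _ ⟨x, hx, rfl⟩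
  exact h.convex.smul_mem_of_zero_mem h.zero_mem hx ⟨hr, hr1⟩

/-- Turns finite multiplicity into a count at a point. Finiteness is part of the claim: an infinite
family would contain k + 1 charts through y. -/
theorem exists_finset_charts {m n : ℕ} {M S : Set (Euc n)} {K : Set (Chart m M)} {k : ℕ}
    (hk : ∀ F : Finset (Chart m M), ↑F ⊆ chartsOn K S → k < F.card → (⋂ κ ∈ F, κ.patch) = ∅)
    (y : Euc n) : ∃ A : Finset (chartsOn K S), A.card ≤ k ∧ ∀ κ, y ∈ κ.1.patch → κ ∈ A := by
  set N : Set (chartsOn K S) := {κ | y ∈ κ.1.patch}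
  have hcard : ∀ F : Finset (chartsOn K S), ↑F ⊆ N → F.card ≤ k := by
    intro F hF
    by_contra! hlt
    have h := hk (F.map (Function.Embedding.subtype _)) (by
      intro κ hκ
      obtain ⟨κ', -, rfl⟩ := Finset.mem_map.1 (Finset.mem_coe.1 hκ)
      exact κ'.2) (by simpa using hlt)
    have hy : y ∈ ⋂ κ ∈ F.map (Function.Embedding.subtype _), κ.patch := by
      refine mem_iInter₂.2 fun κ hκ => ?_
      obtain ⟨κ', hκ', rfl⟩ := Finset.mem_map.1 hκ
      exact hF hκ'
    rw [h] at hy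
    exact hy
  have hfin : N.Finite := by
    by_contra hinf
    obtain ⟨F, hF, hFc⟩ := Set.Infinite.exists_subset_card_eq hinf (k + 1)
    have := hcard F hF
    omega
  exact ⟨hfin.toFinset, hcard _ (by simp), fun κ hκ => hfin.mem_toFinset.2 hκ⟩

theorem IsPipeWeight.isSmoothPositive_pipeFunction {e : EndPoint} {R r : ℝ → ℝ}
    (hw : IsPipeWeight e R r) {d n : ℕ} {B : Set (Euc n)} {b : Euc n → ℝ} {K : Set (Chart d B)}
    (hK : IsAtlas K) (hb : IsSmoothPositive d B b) :
    IsSmoothPositive (d + 1) (pipe e R B) (pipeFunction R r b) := by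
  constructor
  · intro p hp
    obtain ⟨h1, h2, -⟩ := hw.char.mem_pipe hp
    exact mul_pos (hw.pos _ h1) (hb.1 _ h2)
  · intro κ
    have h : ContDiffOn ℝ ∞ (fun x => stretch R (κ.param x)) κ.dom :=
      hw.char.contDiffOn_stretch.comp κ.smooth
        fun x hx => (hw.char.mem_pipe (κ.mapsTo hx)).1
    exact (hw.smooth.comp (contDiff_fst.comp_contDiffOn h)
      fun x hx => (hw.char.mem_pipe (κ.mapsTo hx)).1).mul
      (hb.contDiffOn_comp hK κ.uniqueDiffOn (contDiff_snd.comp_contDiffOn h)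
        fun x hx => (hw.char.mem_pipe (κ.mapsTo hx)).2.1)

/-- Charts of the pipe over a given chart of the base and inside a given set of parameters `t`. -/
theorem IsCharacteristic.exists_chart_over {e : EndPoint} {R : ℝ → ℝ} (hR : IsCharacteristic e R)
    {d n : ℕ} {B : Set (Euc n)} (κ : Chart d B) {O : Set ℝ} (hO : IsOpen O) (hOJ : O ⊆ interior e.J)
    {t : ℝ} (ht : t ∈ O) {y : Euc n} (hy : y ∈ κ.patch) :
    ∃ c : Chart (d + 1) (pipe e R B), consPoint t (R t • y) ∈ c.patch ∧
      ∀ p ∈ c.patch, (stretch R p).1 ∈ O ∧ (stretch R p).2 ∈ κ.patch := by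
  obtain ⟨ε, hε, hball⟩ := Metric.isOpen_iff.1 hO t ht
  have hmem : ∀ u ∈ Ioo (-1 : ℝ) 1, t + ε * u ∈ O := fun u hu => by
    refine hball ?_
    rw [Metric.mem_ball, Real.dist_eq, add_sub_cancel_left, abs_mul, abs_of_pos hε]
    exact mul_lt_of_lt_one_right hε (abs_lt.2 hu)
  obtain ⟨x, hx, rfl⟩ := hy
  refine ⟨κ.pipe hR t ε hε fun u hu => hOJ (hmem u hu),
    ⟨snocPoint x 0, ⟨by rwa [initCLM_snocPoint], by rw [lastCLM_snocPoint]; norm_num⟩, ?_⟩, ?_⟩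
  · change Chart.pipeParam R κ t ε (snocPoint x 0) = _
    rw [Chart.pipeParam, initCLM_snocPoint, lastCLM_snocPoint, mul_zero, add_zero]
  · rintro _ ⟨w, hw, rfl⟩
    have hO' := hmem _ hw.2
    have h := stretch_consPoint (hR.pos_of_mem_interior (hOJ hO'))
      (κ.param (initCLM d w))
    change (stretch R (Chart.pipeParam R κ t ε w)).1 ∈ O ∧
      (stretch R (Chart.pipeParam R κ t ε w)).2 ∈ κ.patch
    rw [Chart.pipeParam, h]
    exact ⟨hO', _, hw.1, rfl⟩

/-! ### The atlas of the pipe: covering, shrinkability, multiplicity and estimates -/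

namespace PipeSetup

variable {e : EndPoint} {R r : ℝ → ℝ} {d n : ℕ} {B S : Set (Euc n)} {b : Euc n → ℝ}
  {K : Set (Chart d B)} (σ : PipeSetup e R r S b K)

/-- The part of the pipe on which the singularity function is considered. -/
abbrev part (_σ : PipeSetup e R r S b K) : Set (Euc (n + 1)) := pipePart e R B e.core S

/-- The atlas of the pipe: the charts which belong to the indices, and all charts which do not meet
the part under consideration. -/
def atlas : Set (Chart (d + 1) (pipe e R B)) :=
  range (fun i : σ.Index => i.chart) ∪ {c | c.patch ∩ σ.part = ∅}

theorem exists_index {c : Chart (d + 1) (pipe e R B)} (hc : c ∈ chartsOn σ.atlas σ.part) :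
    ∃ i : σ.Index, i.chart = c := by
  rcases hc.1 with h | h
  · exact h
  · exact absurd h hc.2.ne_empty

theorem chart_mem_atlas (i : σ.Index) : i.chart ∈ σ.atlas := Or.inl ⟨i, rfl⟩

theorem exists_coord_last (κ : chartsOn K S) {t : ℝ} (ht : t ∈ e.core) :
    ∃ s ∈ σ.nodes κ, ∃ u : ℝ, |u| < 3 / 4 ∧ s + σ.scale κ s * u = t := by
  obtain ⟨s, hs, h⟩ := σ.nodes_cover κ t ht
  have hp := σ.scale_pos κ (e.core_subset (σ.nodes_subset κ hs))
  refine ⟨s, hs, (t - s) / σ.scale κ s, ?_, by field_simp; ring⟩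
  rw [abs_div, abs_of_pos hp, div_lt_iff₀ hp]
  exact h

theorem param_snocPoint (i : σ.Index) {z : Euc d} {u : ℝ} :
    i.chart.param (snocPoint z u) = consPoint (i.t + σ.scale i.κ i.t * u)
      (R (i.t + σ.scale i.κ i.t * u) •
        i.κ.1.param (gridPoint (σ.mesh i.t) i.k + σ.mesh i.t • z)) := by
  rw [i.param_eq, Index.time, Index.base, initCLM_snocPoint, lastCLM_snocPoint]

/-- Over the core interval, the charts cover the patches of the charts of the base. -/
theorem exists_mem_patch (κ : chartsOn K S) {t : ℝ} (ht : t ∈ e.core) {y : Euc n}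
    (hy : y ∈ κ.1.patch) : ∃ i : σ.Index, consPoint t (R t • y) ∈ i.chart.patch := by
  obtain ⟨s, hs, u, hu, hus⟩ := σ.exists_coord_last κ ht
  obtain ⟨x, hx, rfl⟩ := hy
  have hs' := e.core_subset (σ.nodes_subset κ hs)
  obtain ⟨k, hk, z, hz, hzx⟩ := Chart.exists_grid_cover (σ.datum.shrinkable.1 κ κ.2)
    (σ.gridNumber_pos hs') hx
  set i : σ.Index := ⟨κ, s, k, hs, hk⟩
  refine ⟨i, snocPoint z u, i.mem_dom_iff.2 ⟨?_, ?_⟩, ?_⟩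
  · rw [initCLM_snocPoint]; exact hz
  · rw [lastCLM_snocPoint]; exact abs_lt.1 (hu.trans (by norm_num))
  · rw [param_snocPoint]
    change consPoint (s + σ.scale κ s * u) (R (s + σ.scale κ s * u) •
      κ.1.param (gridPoint (σ.mesh s) k + σ.mesh s • z)) = _
    rw [hus]
    exact congrArg (fun x => consPoint t (R t • κ.1.param x)) hzx

theorem exists_mem_shrunk_patch {p : Euc (n + 1)} (hp : p ∈ σ.part) :
    ∃ i : σ.Index, p ∈ i.chart.param '' ((4 / 5 : ℝ) • i.chart.dom) := by
  obtain ⟨hpP, ht, hyS⟩ := hp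
  have hpe := (σ.weight.char.mem_pipe hpP).2.2
  set t := (stretch R p).1
  set y := (stretch R p).2
  obtain ⟨κ, hκ, x, hx, hxy⟩ := mem_iUnion₂.1 (σ.cover hyS)
  obtain ⟨s, hs, u, hu, hus⟩ := σ.exists_coord_last ⟨κ, hκ⟩ ht
  have hs' := e.core_subset (σ.nodes_subset ⟨κ, hκ⟩ hs)
  obtain ⟨k, hk, z, ⟨z', hz', hzz'⟩, hzx⟩ := Chart.exists_grid_cover_shrunk
    (σ.datum.shrinkable.1 κ hκ) σ.ρ_mem.1 σ.ρ_mem.2 (σ.mesh_pos hs') (σ.mesh_le_shrink hs') hx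
  set i : σ.Index := ⟨⟨κ, hκ⟩, s, k, hs, hk⟩
  -- The factor 4/5 serves both variables: |u| < 3/4 gives |5u/4| < 15/16, and the grid cubes were
  -- shrunk by 4/5.
  have hsnoc : (4 / 5 : ℝ) • snocPoint z' (5 / 4 * u) = snocPoint z u := by
    rw [← snocPoint_init_last ((4 / 5 : ℝ) • snocPoint z' (5 / 4 * u)), map_smul, map_smul,
      initCLM_snocPoint, lastCLM_snocPoint, smul_eq_mul]
    congr 1
    ring
  refine ⟨i, snocPoint z u, ⟨snocPoint z' (5 / 4 * u), i.mem_dom_iff.2 ⟨?_, ?_⟩, hsnoc⟩, ?_⟩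
  · rw [initCLM_snocPoint]; exact hz'
  · rw [lastCLM_snocPoint]
    have := abs_lt.1 hu
    constructor <;> linarith [this.1, this.2]
  · rw [param_snocPoint]
    change consPoint (s + σ.scale ⟨κ, hκ⟩ s * u) (R (s + σ.scale ⟨κ, hκ⟩ s * u) •
      κ.param (gridPoint (σ.mesh s) k + σ.mesh s • z)) = _
    rw [hus, hzx, hxy]
    exact hpe

theorem isShrinkableOn_atlas : IsShrinkableOn σ.atlas σ.part := by
  refine ⟨fun c hc => ?_, 4 / 5, by norm_num, fun p hp => ?_⟩
  · obtain ⟨i, rfl⟩ := σ.exists_index hc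
    exact i.isNormalized_chart
  · obtain ⟨i, hi⟩ := σ.exists_mem_shrunk_patch hp
    refine mem_iUnion₂.2 ⟨i.chart, ⟨σ.chart_mem_atlas i, p, ?_, hp⟩, hi⟩
    exact image_mono (i.isNormalized_chart.smul_dom_subset (by norm_num) (by norm_num)) hi

/-- Where t is outside the core, or the base chart misses S, a small chart avoiding the part exists.
In the remaining case the point may lie over a limit point of S, so the index charts must cover
whole patches of the base and not just their shrunken parts. -/
theorem isAtlas_atlas : IsAtlas σ.atlas := by
  intro p hp
  obtain ⟨ht, hy, hpe⟩ := σ.weight.char.mem_pipe hp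
  rw [← hpe]
  set t := (stretch R p).1
  set y := (stretch R p).2
  obtain ⟨κ, hκ, hyκ⟩ := σ.datum.atlas y hy
  by_cases hκS : κ ∈ chartsOn K S
  · by_cases htc : t ∈ e.core
    · obtain ⟨i, hi⟩ := σ.exists_mem_patch ⟨κ, hκS⟩ htc hyκ
      exact ⟨i.chart, σ.chart_mem_atlas i, hi⟩
    · obtain ⟨c, hc, hcp⟩ := σ.weight.char.exists_chart_over κ e.isOpen_diff_core sdiff_subset ⟨ht, htc⟩ hyκ
      refine ⟨c, Or.inr (eq_empty_of_forall_notMem fun q hq => ?_), hc⟩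
      exact (hcp q hq.1).1.2 hq.2.2.1
  · obtain ⟨c, hc, hcp⟩ := σ.weight.char.exists_chart_over κ isOpen_interior Subset.rfl ht hyκ
    refine ⟨c, Or.inr (eq_empty_of_forall_notMem fun q hq => ?_), hc⟩
    exact hκS ⟨hκ, _, (hcp q hq.1).2, hq.2.2.2⟩

theorem mem_patch_of_index {i : σ.Index} {p : Euc (n + 1)} (hp : p ∈ i.chart.patch) :
    (stretch R p).1 ∈ interior e.J ∧ |(stretch R p).1 - i.t| < σ.δ * r i.t * i.κ.1.center b ∧
      (stretch R p).2 ∈ i.κ.1.patch ∧ ∃ z ∈ cube d,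
        gridPoint (σ.mesh i.t) i.k + σ.mesh i.t • z = i.κ.1.coord (stretch R p).2 := by
  obtain ⟨w, hw, rfl⟩ := hp
  rw [i.stretch_param hw]
  refine ⟨i.time_mem hw, ?_, ⟨_, i.base_mem hw, rfl⟩, initCLM d w, hw.1.1, ?_⟩
  · have hs := σ.scale_pos i.κ i.t_mem_interior
    simp only [Index.time, add_sub_cancel_left, abs_mul, abs_of_pos hs]
    exact mul_lt_of_lt_one_right hs (abs_lt.2 hw.2)
  · exact (i.κ.1.coord_param (i.base_mem hw)).symm

open Classical in
theorem hasFiniteMultiplicityOn_atlas : HasFiniteMultiplicityOn σ.atlas σ.part := by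
  obtain ⟨k₀, hk₀⟩ := σ.datum.multiplicity
  refine ⟨k₀ * (16 * 4 ^ d), fun F hF hcard => ?_⟩
  by_contra hne
  obtain ⟨p, hp⟩ := nonempty_iff_ne_empty.2 hne
  have hpF : ∀ c ∈ F, p ∈ c.patch := fun c hc => mem_iInter₂.1 hp c hc
  obtain ⟨c₀, hc₀⟩ := Finset.card_pos.1 (lt_of_le_of_lt (Nat.zero_le _) hcard)
  obtain ⟨i₀, hi₀⟩ := σ.exists_index (hF hc₀)
  have ht := (σ.mem_patch_of_index (hi₀ ▸ hpF c₀ hc₀ : p ∈ i₀.chart.patch)).1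
  set t := (stretch R p).1
  set y := (stretch R p).2
  obtain ⟨A, hA, hAm⟩ := exists_finset_charts hk₀ y
  choose T hT hTm using fun κ => σ.nodes_mult κ t ht
  have hgrid : ∀ (κ : chartsOn K S) (s : ℝ), ∃ G : Finset (Fin d → ℤ), G.card ≤ 4 ^ d ∧
      (s ∈ interior e.J → ∀ k, ∀ z ∈ cube d,
        gridPoint (σ.mesh s) k + σ.mesh s • z = κ.1.coord y → k ∈ G) := by
    intro κ s
    by_cases hs : s ∈ interior e.J
    · obtain ⟨G, hG, hGm⟩ := exists_finset_grid (σ.mesh_pos hs) (κ.1.coord y)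
      exact ⟨G, hG, fun _ => hGm⟩
    · exact ⟨∅, by simp, fun h => absurd h hs⟩
  choose G hG hGm using hgrid
  choose ix hix using fun c : F => σ.exists_index (hF c.2)
  -- The charts through p are counted by index: at most k₀ base charts, 16 nodes for each, and 4 ^ d
  -- grid points for each node.
  set Z : Finset (chartsOn K S × ℝ × (Fin d → ℤ)) := A.biUnion fun κ => (T κ).biUnion fun s =>
    (G κ s).image fun k => (κ, s, k)
  have hZ : Z.card ≤ k₀ * (16 * 4 ^ d) :=
    (Finset.card_biUnion_le_card_mul _ _ _ fun κ _ =>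
      (Finset.card_biUnion_le_card_mul _ _ _ fun s _ => Finset.card_image_le.trans (hG κ s)).trans
        (Nat.mul_le_mul_right _ (hT κ))).trans (Nat.mul_le_mul_right _ hA)
  have hmap : F.attach.card ≤ Z.card := by
    refine Finset.card_le_card_of_injOn (fun c => ((ix c).κ, (ix c).t, (ix c).k)) (fun c _ => ?_)
      fun c _ c' _ hcc' => ?_
    · have hpc : p ∈ (ix c).chart.patch := by rw [hix c]; exact hpF c.1 c.2
      obtain ⟨-, h2, h3, z, hz, h4⟩ := σ.mem_patch_of_index hpc
      simp only [Z, Finset.coe_biUnion, mem_iUnion, Finset.mem_coe, Finset.mem_image]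
      exact ⟨_, hAm _ h3, _, hTm _ _ (ix c).t_mem h2, _,
        hGm _ _ (ix c).t_mem_interior _ z hz h4, rfl⟩
    · simp only [Prod.mk.injEq] at hcc'
      have h : ix c = ix c' := Index.ext hcc'.1 hcc'.2.1 hcc'.2.2
      exact Subtype.ext ((hix c).symm.trans ((congrArg Index.chart h).trans (hix c')))
  rw [Finset.card_attach] at hmap
  omega

theorem isPRSingularityDatumOn :
    IsPRSingularityDatumOn σ.part (pipeFunction R r b) σ.atlas := by
  obtain ⟨c, hc, hcb⟩ := σ.exists_center_bounds
  have hc0 : 0 < c := by linarith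
  have hsm := σ.weight.isSmoothPositive_pipeFunction σ.datum.atlas σ.datum.smooth
  refine ⟨σ.isAtlas_atlas, σ.isShrinkableOn_atlas, σ.hasFiniteMultiplicityOn_atlas, hsm,
    fun k => ?_, ⟨c * c, by nlinarith, fun κ hκ w hw => ?_⟩, ?_, fun k hk => ?_⟩
  · obtain ⟨C, hC⟩ := UnifBdd.bound (f := fun (i : σ.Index) w =>
      pipeFunction R r b (i.chart.param w)) (fun i => i.weight_pos) σ.uniqueDiffOn_dom
      (σ.unifBdd_pipeFunction k)
    refine ⟨|C| * c, fun κ hκ w hw j hj => ?_⟩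
    obtain ⟨i, rfl⟩ := σ.exists_index hκ
    calc _ ≤ C * i.weight := hC i w hw j hj
      _ ≤ |C| * (c * i.chart.center (pipeFunction R r b)) := by
        have := i.weight_pos
        gcongr
        · exact le_abs_self C
        · exact (hcb i).1
      _ = _ := by ring
  · obtain ⟨i, rfl⟩ := σ.exists_index hκ
    obtain ⟨h1, h2, h3⟩ := hcb i
    obtain ⟨h4, h5⟩ := h3 w hw
    constructor
    · rw [div_le_iff₀ (by positivity)]
      rw [div_le_iff₀ hc0] at h4
      nlinarith
    · nlinarith
  · obtain ⟨C, hC, hl⟩ := σ.exists_scaledDeriv_lower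
    have hC0 : 0 < C := by linarith
    refine ⟨c ^ 2 * C, by nlinarith, fun κ hκ w hw ξ => ?_⟩
    obtain ⟨i, rfl⟩ := σ.exists_index hκ
    have h1 := hl i w hw ξ
    have h2 := (hcb i).2.1
    have h3 : 0 < i.chart.center (pipeFunction R r b) :=
      hsm.1 _ (i.chart.mapsTo i.zero_mem)
    rw [Chart.metric, real_inner_self_eq_norm_sq, σ.fderivWithin_chart i hw, smul_apply, norm_smul,
      Real.norm_of_nonneg i.weight_pos.le, mul_pow, div_le_iff₀ (by positivity)]
    calc i.chart.center (pipeFunction R r b) ^ 2 * ‖ξ‖ ^ 2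
        ≤ (c * i.weight) ^ 2 * (C * ‖σ.scaledDeriv i w ξ‖ ^ 2) := by gcongr
      _ = _ := by ring
  -- The bounds start at order 1, so they are read off from the derivative at one order less; the
  -- values of the parametrization need not be small compared with the weight.
  · obtain ⟨k, rfl⟩ := Nat.exists_eq_add_of_le' hk
    have hu : UnifBdd k (fun i : σ.Index => i.chart.dom) (fun i w =>
        (i.weight)⁻¹ • fderivWithin ℝ i.chart.param i.chart.dom w) :=
      (σ.unifBdd_scaledDeriv k).congr fun i w hw => by
        simp only [σ.fderivWithin_chart i hw]
        rw [inv_smul_smul₀ i.weight_pos.ne']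
    obtain ⟨C, hC⟩ := UnifBdd.bound (fun i : σ.Index => i.weight_pos) σ.uniqueDiffOn_dom hu
    refine ⟨|C| * c, fun κ hκ w hw => ?_⟩
    obtain ⟨i, rfl⟩ := σ.exists_index hκ
    rw [← norm_iteratedFDerivWithin_fderivWithin (σ.uniqueDiffOn_dom i) hw]
    calc _ ≤ C * i.weight := hC i w hw k le_rfl
      _ ≤ |C| * (c * i.chart.center (pipeFunction R r b)) := by
        have := i.weight_pos
        gcongr
        · exact le_abs_self C
        · exact (hcb i).1
      _ = _ := by ring

end PipeSetup

theorem proposition7p3 (e : EndPoint) (R : ℝ → ℝ)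
    (hR : IsCuspCharacteristic e R ∨ (e = EndPoint.infty ∧ IsFunnelCharacteristic R))
    (d n : ℕ) (B S : Set (Euc n)) (hB : IsSubmanifold d B) (hBdd : Bornology.IsBounded B)
    (hS : S ⊆ B) (b : Euc n → ℝ) (hb : IsPRSingularityFunctionOn d B S b)
    (hb0 : d = 0 → BddAbove (b '' S)) :
    ∃ I : Set ℝ, IsCofinalInterval e I ∧
      IsPRSingularityFunctionOn (d + 1) (pipe e R B) (pipePart e R B I S)
        (pipeFunction R (weight e R) b) ∧
      IsSingularityFunctionOn (d + 1) (pipe e R B) (pipePart e R B I S)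
        (pipeFunction R (weight e R) b) := by
  obtain ⟨K, hK⟩ := hb
  obtain ⟨σ⟩ := hK.nonempty_pipeSetup (isPipeWeight_weight hR) hBdd hb0
  have h := σ.isPRSingularityDatumOn
  exact ⟨e.core, e.isCofinalInterval_core, ⟨σ.atlas, h⟩, h.isSingularityFunctionOn⟩
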